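/- **Setting.** Intervals are closed intervals $[\ell,r]\subset\mathbb R$ with $\ell\le r$. For a finite set $S$ of intervals, an independent set is a subset $I\subseteq S$ of pairwise disjoint intervals, and $\alpha(S)$ is the maximum size of an independent set of $S$. For an integer $k\ge 0$, an independent set $I\subseteq S$ is *$k$-maximal* if for no $0\le t\le k$ there are $A\subseteq I$ and $B\subseteq S\setminus I$ with $|A|=t$, $|B|=t+1$ such that $(I\setminus A)\cup B$ is independent. It is *$k$-valid* if it is $k$-maximal and no interval of $S\setminus I$ is contained in an interval of $I$. It is a *$(1+\varepsilon)$-approximate maximum independent set* if $\alpha(S)\le(1+\varepsilon)|I|$. **Model.** Algorithms are finite programs of a comparison-based pointer machine: one time step allocates a cell, follows a pointer, branches, reads a local variable, calls a subroutine, or compares two endpoints of input intervals; comparison is the only operation on endpoints. An algorithm is first given a parameter $k$, with $S=\emptyset$, and then processes an arbitrary sequence of insertions $S\leftarrow S\cup\{x\}$ and deletions $S\leftarrow S\setminus\{x\}$. It *maintains* an independent set $I$ of $S$ if after every update its memory holds $I$ explicitly, in a binary tree that has one node per interval of $I$ and lists $I$ from left to right. Time bounds are worst-case bounds for each single update, and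 $n=|S|$ is the number of intervals present when the update arrives. **Theorem.** There are an algorithm and a constant $C$ such that the following hold. 1. For every integer $k\ge 1$, the algorithm with parameter $k$ maintains a $k$-valid independent set of $S$, with at most $C\,k\log(n+2)$ steps per insertion and at most $C\,k^2\log(n+2)$ steps per deletion. 2. For every $\varepsilon>0$ there are an integer $k\ge1$ and a constant $D$, depending only on $\varepsilon$, such that the algorithm with parameter $k$ maintains a $(1+\varepsilon)$-approximate maximum independent set of $S$, with at most $D\log(n+2)$ steps per insertion or deletion, that is, in $O_\varepsilon(\log n)$ worst-case time per update. -/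

import Mathlib

/-! ### Intervals and independent sets

A closed interval `[l, r]` with `l ≤ r` is an element `J` of Mathlib's `NonemptyInterval α`, with
endpoints `J.fst` and `J.snd`. Its order `J ≤ K` is containment of `J` in `K`. -/

section Intervals

variable {α : Type*} [LinearOrder α]

/-- A set of intervals is independent if its members are pairwise disjoint. -/
def IsIndep (I : Finset (NonemptyInterval α)) : Prop :=
  (I : Set (NonemptyInterval α)).PairwiseDisjoint (fun J => (J : Set α))

open Classical in
/-- The size of a maximum independent subset of `S`. -/
noncomputable def indepNum (S : Finset (NonemptyInterval α)) : ℕ :=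
  (S.powerset.filter IsIndep).sup Finset.card

/-- `I` is a `k`-maximal independent subset of `S`: for no `t ≤ k` can `t` of its members be
exchanged for `t + 1` intervals of `S \ I`. The case `t = 0` says that `I` is maximal for
inclusion. -/
def IsKMaximal (k : ℕ) (S I : Finset (NonemptyInterval α)) : Prop :=
  I ⊆ S ∧ IsIndep I ∧
    ∀ t ≤ k, ∀ A ⊆ I, ∀ B ⊆ S \ I, A.card = t → B.card = t + 1 → ¬ IsIndep ((I \ A) ∪ B)

/-- `I` is a `k`-valid independent subset of `S`: it is `k`-maximal, and no interval of `S \ I` is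
contained in an interval of `I`. -/
def IsKValid (k : ℕ) (S I : Finset (NonemptyInterval α)) : Prop :=
  IsKMaximal k S I ∧ ∀ J ∈ S \ I, ∀ K ∈ I, ¬ J ≤ K

/-- `I` is a `(1 + ε)`-approximate maximum independent subset of `S`. -/
def IsApproxMIS (ε : ℝ) (S I : Finset (NonemptyInterval α)) : Prop :=
  I ⊆ S ∧ IsIndep I ∧ (indepNum S : ℝ) ≤ (1 + ε) * (I.card : ℝ)

end Intervals

/-! ### The machine model

A comparison-based pointer machine without destructive updates (a first-order fragment of pure
Lisp). Its data are pointers to immutable cells: a cell is empty, or holds two pointers, or holds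
one input key. A program is a fixed finite text. In one time step it allocates a cell, follows a
pointer, branches, reads a local variable, calls a subroutine, or compares two keys. Comparison is
the only operation on keys; no key is ever created by a program. -/

/-- The data of the machine. -/
inductive Val (α : Type*) where
  | nil : Val α
  | key : α → Val α
  | cons : Val α → Val α → Val α

namespace Val

variable {α : Type*}

/-- The first pointer of a cell (`nil` if there is none). -/
def fst : Val α → Val α
  | cons u _ => u
  | _ => nil

/-- The second pointer of a cell (`nil` if there is none). -/
def snd : Val α → Val α
  | cons _ v => v
  | _ => nil

/-- The truth values of the machine. -/
def ofProp (p : Prop) [Decidable p] : Val α := if p then cons nil nil else nil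

/-- The comparison `a < b` of two keys (false on data that are not keys). -/
def lt [LinearOrder α] : Val α → Val α → Val α
  | key a, key b => ofProp (a < b)
  | _, _ => nil

/-- A number in unary. -/
def unary : ℕ → Val α
  | 0 => nil
  | n + 1 => cons nil (unary n)

/-- An interval as input: the pair of its endpoints, which are keys. -/
def interval [LinearOrder α] (J : NonemptyInterval α) : Val α := cons (key J.fst) (key J.snd)

/-- `Stores v l`: the datum `v` is a binary tree with one node for each entry of `l`, and `l` is its
in-order traversal. A node holds its interval, some further information, and two subtrees. -/
inductive Stores [LinearOrder α] : Val α → List (NonemptyInterval α) → Prop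
  | nil : Stores nil []
  | node {J : NonemptyInterval α} {info left right : Val α} {l r : List (NonemptyInterval α)} :
      Stores left l → Stores right r →
      Stores (cons (cons (interval J) info) (cons left right)) (l ++ J :: r)

/-- `Holds v I`: the first component of the memory `v` is a tree that stores `I`, each interval
once, from left to right. -/
def Holds [LinearOrder α] (v : Val α) (I : Finset (NonemptyInterval α)) : Prop :=
  ∃ sol aux l, v = cons sol aux ∧ Stores sol l ∧
    l.Pairwise (fun J K => J.snd < K.fst) ∧ l.toFinset = I

end Val

/-- Program texts. `var i` is the `i`-th local variable, `bind a b` computes `a`, makes its value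
local variable `0` (shifting the others), and computes `b`; `call f a` calls the `f`-th subroutine
with one argument. -/
inductive Code where
  | var : ℕ → Code
  | nil : Code
  | cons : Code → Code → Code
  | fst : Code → Code
  | snd : Code → Code
  | lt : Code → Code → Code
  | ite : Code → Code → Code → Code
  | bind : Code → Code → Code
  | call : ℕ → Code → Code

/-- `Runs defs env e v c`: with the subroutines `defs` and the local variables `env`, the code `e`
terminates with value `v` after `c` time steps. -/
inductive Runs {α : Type*} [LinearOrder α] (defs : List Code) :
    List (Val α) → Code → Val α → ℕ → Prop
  | var {env} (i : ℕ) : Runs defs env (.var i) (env.getD i .nil) 1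
  | nil {env} : Runs defs env .nil .nil 1
  | cons {env a b u v m n} : Runs defs env a u m → Runs defs env b v n →
      Runs defs env (.cons a b) (.cons u v) (m + n + 1)
  | fst {env a u m} : Runs defs env a u m → Runs defs env (.fst a) u.fst (m + 1)
  | snd {env a u m} : Runs defs env a u m → Runs defs env (.snd a) u.snd (m + 1)
  | lt {env a b u v m n} : Runs defs env a u m → Runs defs env b v n →
      Runs defs env (.lt a b) (u.lt v) (m + n + 1)
  | iteCons {env a b c u₁ u₂ v m n} : Runs defs env a (.cons u₁ u₂) m → Runs defs env b v n →
      Runs defs env (.ite a b c) v (m + n + 1)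
  | iteNil {env a b c v m n} : Runs defs env a .nil m → Runs defs env c v n →
      Runs defs env (.ite a b c) v (m + n + 1)
  | iteKey {env a b c x v m n} : Runs defs env a (.key x) m → Runs defs env c v n →
      Runs defs env (.ite a b c) v (m + n + 1)
  | bind {env a b u v m n} : Runs defs env a u m → Runs defs (u :: env) b v n →
      Runs defs env (.bind a b) v (m + n + 1)
  | call {env f a u v m n} : Runs defs env a u m → Runs defs [u] (defs.getD f .nil) v n →
      Runs defs env (.call f a) v (m + n + 1)

/-- Computations are deterministic, in value and in time. -/
theorem Runs.unique {α : Type*} [LinearOrder α] {defs : List Code} {env : List (Val α)} {e : Code}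
    {v w : Val α} {m n : ℕ} (h : Runs defs env e v m) (h' : Runs defs env e w n) :
    v = w ∧ m = n := by
  induction h generalizing w n with
  | var => cases h'; exact ⟨rfl, rfl⟩
  | nil => cases h'; exact ⟨rfl, rfl⟩
  | fst _ ih => cases h' with | fst h => obtain ⟨rfl, rfl⟩ := ih h; exact ⟨rfl, rfl⟩
  | snd _ ih => cases h' with | snd h => obtain ⟨rfl, rfl⟩ := ih h; exact ⟨rfl, rfl⟩
  | cons _ _ ih₁ ih₂ =>
    cases h' with
    | cons h₁ h₂ => obtain ⟨rfl, rfl⟩ := ih₁ h₁; obtain ⟨rfl, rfl⟩ := ih₂ h₂; exact ⟨rfl, rfl⟩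
  | lt _ _ ih₁ ih₂ =>
    cases h' with
    | lt h₁ h₂ => obtain ⟨rfl, rfl⟩ := ih₁ h₁; obtain ⟨rfl, rfl⟩ := ih₂ h₂; exact ⟨rfl, rfl⟩
  | bind _ _ ih₁ ih₂ =>
    cases h' with
    | bind h₁ h₂ => obtain ⟨rfl, rfl⟩ := ih₁ h₁; obtain ⟨rfl, rfl⟩ := ih₂ h₂; exact ⟨rfl, rfl⟩
  | call _ _ ih₁ ih₂ =>
    cases h' with
    | call h₁ h₂ => obtain ⟨rfl, rfl⟩ := ih₁ h₁; obtain ⟨rfl, rfl⟩ := ih₂ h₂; exact ⟨rfl, rfl⟩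
  | iteCons _ _ ih₁ ih₂ =>
    cases h' with
    | iteCons h₁ h₂ => have a := ih₁ h₁; have b := ih₂ h₂; simp_all
    | iteNil h₁ h₂ => exact nomatch (ih₁ h₁).1
    | iteKey h₁ h₂ => exact nomatch (ih₁ h₁).1
  | iteNil _ _ ih₁ ih₂ =>
    cases h' with
    | iteCons h₁ h₂ => exact nomatch (ih₁ h₁).1
    | iteNil h₁ h₂ => have a := ih₁ h₁; have b := ih₂ h₂; simp_all
    | iteKey h₁ h₂ => exact nomatch (ih₁ h₁).1
  | iteKey _ _ ih₁ ih₂ =>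
    cases h' with
    | iteCons h₁ h₂ => exact nomatch (ih₁ h₁).1
    | iteNil h₁ h₂ => exact nomatch (ih₁ h₁).1
    | iteKey h₁ h₂ => have a := ih₁ h₁; have b := ih₂ h₂; simp_all

/-! ### Dynamic algorithms -/

/-- A dynamic algorithm: finitely many subroutines and three entry points. `init` gets a number `k`
and returns the memory for the empty set of intervals; `ins` and `del` get an interval and the
memory, and return the new memory. -/
structure DynAlg where
  defs : List Code
  init : Code
  ins : Code
  del : Code

namespace DynAlg

variable {α : Type*} [LinearOrder α]

/-- Started with parameter `k`, the memory becomes `v` after `c` steps. -/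
def RunsInit (P : DynAlg) (k : ℕ) (v : Val α) (c : ℕ) : Prop :=
  Runs P.defs [Val.unary k] P.init v c

/-- The insertion of `J` turns the memory `v` into `w` in `c` steps. -/
def RunsIns (P : DynAlg) (J : NonemptyInterval α) (v w : Val α) (c : ℕ) : Prop :=
  Runs P.defs [Val.interval J, v] P.ins w c

/-- The deletion of `J` turns the memory `v` into `w` in `c` steps. -/
def RunsDel (P : DynAlg) (J : NonemptyInterval α) (v w : Val α) (c : ℕ) : Prop :=
  Runs P.defs [Val.interval J, v] P.del w c

/-- `P.Reach k S v`: some sequence of updates, started from the empty set with parameter `k`,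
leads to the current set of intervals `S` and to the memory `v`. -/
inductive Reach (P : DynAlg) (k : ℕ) : Finset (NonemptyInterval α) → Val α → Prop
  | init {v c} : P.RunsInit k v c → Reach P k ∅ v
  | ins {S v J w c} : Reach P k S v → P.RunsIns J v w c → Reach P k (insert J S) w
  | del {S v J w c} : Reach P k S v → P.RunsDel J v w c → Reach P k (S.erase J) w

/-- Started with parameter `k`, the algorithm `P` maintains, for the current set `S` of intervals,
an explicitly stored set `I` with `good S I`; if `S` has `n` members, then every insertion takes
at most `insTime n` steps and every deletion at most `delTime n` steps, in the worst case. -/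
def Maintains (α : Type*) [LinearOrder α] (P : DynAlg) (k : ℕ)
    (good : Finset (NonemptyInterval α) → Finset (NonemptyInterval α) → Prop)
    (insTime delTime : ℕ → ℝ) : Prop :=
  (∃ (v : Val α) (c : ℕ), P.RunsInit k v c) ∧
  ∀ (S : Finset (NonemptyInterval α)) (v : Val α), P.Reach k S v →
    (∃ I, v.Holds I ∧ good S I) ∧
    (∀ J, ∃ w c, P.RunsIns J v w c ∧ (c : ℝ) ≤ insTime S.card) ∧
    (∀ J, ∃ w c, P.RunsDel J v w c ∧ (c : ℝ) ≤ delTime S.card)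

end DynAlg

/-! The solution is a list of inclusion-minimal intervals, read from left to right, and its local
optimality is tested gap by gap. `NoExchange` at a gap compares chains of at most k + 1 intervals of
S that start there with the solution intervals to the right: the last member of the chain must reach
the solution interval of the same index. Chains may reuse solution intervals, so only consecutive
blocks have to be compared. Cutting a competitor at the intervals it shares with the solution turns
this into k-maximality (`NoExchanges.length_le`). Charging blocks of k + 2 competing intervals to
blocks of k + 1 solution intervals gives the ratio (k + 2)/(k + 1) (`NoExchanges.mul_length_le`).
Minimality excludes containments.

Exchanges are searched greedily, always continuing with the least right end. The greedy chain stays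
ahead of every other chain, so if it finds no exchange there is none of the searched sizes
(`ITree.exchange_spec`). A successful greedy exchange harms no good gap. Gaps in front of greedy
intervals inherit optimality from the gap behind them (`NoExchanges.append_greedy`). The last new
interval ends no earlier than the last removed one (`Exchange.exists_removed`). At each position
left ends only move left (`Exchange.pointwise`), which keeps gaps further left good.

Suppose S changes at x, and the solution interval K around x, if there is one, is removed. Gaps with
more than k solution intervals between them and x stay good, and so do gaps behind a kept interval
that ends at or after the left end of x. Hence the attempts start k intervals before x. An attempt
that fails, or that removes more than the block between its start and x, leaves all gaps to the
right good; otherwise it only makes this block greedy and longer by one (`Improves.noExchanges_or`).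
Three such gains are impossible if nothing was removed; if K was removed, they carry the chain past
the end of K, where the old optimality takes over. So three attempts of size 2k + 2 restore a
solution (`IsSolution.update_of_improves`), for insertions and deletions alike.

Each attempt makes O(k) queries and updates of AVL trees that carry the best interval of every
subtree. The machine has no arithmetic: a node stores the height difference of its subtrees in unary
and the parity of its own height. Parity suffices because an update changes a height by at most one.
Programs are verified by a weakest-precondition calculus that also counts steps. -/

/-! ### Chains of intervals, gaps and exchanges. -/

section ListTheory

variable {α : Type*} [LinearOrder α]

/-- A list of pairwise disjoint intervals from left to right, all to the right of `p`. -/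
def ChainFrom : WithBot α → List (NonemptyInterval α) → Prop
  | _, [] => True
  | p, J :: c => p < (J.fst : WithBot α) ∧ ChainFrom J.snd c

/-- The right end of the last interval of a list (`p` if there is none). -/
def endFrom : WithBot α → List (NonemptyInterval α) → WithBot α
  | p, [] => p
  | _, J :: c => endFrom J.snd c

/-- No exchange of size at most `k` starts right after `p`, where `B` lists the intervals of the
current solution to the right of `p`. -/
def NoExchange (S : Finset (NonemptyInterval α)) (k : ℕ) (p : WithBot α)
    (B : List (NonemptyInterval α)) : Prop :=
  ∀ c d, ChainFrom p (c ++ [d]) → (∀ J ∈ c ++ [d], J ∈ S) → c.length ≤ k →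
    ∃ J, B[c.length]? = some J ∧ J.fst ≤ d.snd

/-- No exchange of size at most `k` starts right after `p` or after an interval of `B`. -/
def NoExchanges (S : Finset (NonemptyInterval α)) (k : ℕ) (p : WithBot α)
    (B : List (NonemptyInterval α)) : Prop :=
  ∀ B₁ B₂, B = B₁ ++ B₂ → NoExchange S k (endFrom p B₁) B₂

/-- All members of the list are inclusion-minimal members of `S`. -/
def AllMinimal (S : Finset (NonemptyInterval α)) (B : List (NonemptyInterval α)) : Prop :=
  ∀ J ∈ B, J ∈ S ∧ ∀ d ∈ S, d ≤ J → d = J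

/-- `c` has the least right end among the intervals of `S` to the right of `p`, and among those
the greatest left end. -/
def IsNext (S : Finset (NonemptyInterval α)) (p : WithBot α) (c : NonemptyInterval α) : Prop :=
  c ∈ S ∧ p < (c.fst : WithBot α) ∧ ∀ d ∈ S, p < (d.fst : WithBot α) →
    c.snd < d.snd ∨ (c.snd = d.snd ∧ d.fst ≤ c.fst)

/-- Every interval of the list is the next one after its predecessor. -/
def GreedyFrom (S : Finset (NonemptyInterval α)) : WithBot α → List (NonemptyInterval α) → Prop
  | _, [] => True
  | p, J :: c => IsNext S p J ∧ GreedyFrom S J.snd c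

/-- The greedy exchange after `p`: the first intervals of `B` are replaced by one more interval,
the list `g`; the intervals `R` of `B` are kept. -/
inductive Exchange (S : Finset (NonemptyInterval α)) : WithBot α → List (NonemptyInterval α) →
    List (NonemptyInterval α) → List (NonemptyInterval α) → Prop
  | base {p c B} : IsNext S p c → ChainFrom c.snd B → Exchange S p B [c] B
  | step {p c J B g R} : IsNext S p c → J.fst ≤ c.snd → Exchange S c.snd B g R →
      Exchange S p (J :: B) (c :: g) R

/-- One attempt to improve the solution after `p`, by an exchange of size at most `n`. -/
def Improves (S : Finset (NonemptyInterval α)) (n : ℕ) (p : WithBot α)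
    (B B' : List (NonemptyInterval α)) : Prop :=
  (B' = B ∧ NoExchange S n p B) ∨ ∃ g R, Exchange S p B g R ∧ B' = g ++ R

theorem fst_lt_of_before {J K : NonemptyInterval α}
    (h : (J.snd : WithBot α) < (K.fst : WithBot α)) : J.snd < K.fst := by exact_mod_cast h

theorem ChainFrom.mono {p q : WithBot α} {c : List (NonemptyInterval α)} (h : ChainFrom q c)
    (hpq : p ≤ q) : ChainFrom p c := by
  cases c with
  | nil => trivial
  | cons J c => exact ⟨lt_of_le_of_lt hpq h.1, h.2⟩

theorem chainFrom_append {p : WithBot α} {a b : List (NonemptyInterval α)} :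
    ChainFrom p (a ++ b) ↔ ChainFrom p a ∧ ChainFrom (endFrom p a) b := by
  induction a generalizing p with
  | nil => simp [ChainFrom, endFrom]
  | cons J a ih => simp [ChainFrom, endFrom, ih, and_assoc]

theorem endFrom_append (p : WithBot α) (a b : List (NonemptyInterval α)) :
    endFrom p (a ++ b) = endFrom (endFrom p a) b := by
  induction a generalizing p with
  | nil => rfl
  | cons J a ih => simp [endFrom, ih]

theorem lt_snd_of_lt_fst {p : WithBot α} {J : NonemptyInterval α}
    (h : p < (J.fst : WithBot α)) : p < (J.snd : WithBot α) :=
  lt_of_lt_of_le h (by exact_mod_cast J.fst_le_snd)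

theorem ChainFrom.lt_fst {p : WithBot α} {c : List (NonemptyInterval α)} (h : ChainFrom p c) :
    ∀ J ∈ c, p < (J.fst : WithBot α) := by
  induction c generalizing p with
  | nil => simp
  | cons K c ih =>
    intro J hJ
    rcases List.mem_cons.1 hJ with rfl | hJ
    · exact h.1
    · exact (lt_snd_of_lt_fst h.1).trans (ih h.2 J hJ)

theorem ChainFrom.le_endFrom {p : WithBot α} {c : List (NonemptyInterval α)}
    (h : ChainFrom p c) : p ≤ endFrom p c := by
  induction c generalizing p with
  | nil => exact le_rfl
  | cons K c ih => exact (lt_snd_of_lt_fst h.1).le.trans (ih h.2)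

theorem ChainFrom.snd_le_endFrom {p : WithBot α} {c : List (NonemptyInterval α)}
    (h : ChainFrom p c) : ∀ J ∈ c, (J.snd : WithBot α) ≤ endFrom p c := by
  induction c generalizing p with
  | nil => simp
  | cons K c ih =>
    intro J hJ
    rcases List.mem_cons.1 hJ with rfl | hJ
    · exact h.2.le_endFrom
    · exact ih h.2 J hJ

theorem ChainFrom.pairwise {p : WithBot α} {c : List (NonemptyInterval α)} (h : ChainFrom p c) :
    c.Pairwise (fun J K => J.snd < K.fst) := by
  induction c generalizing p with
  | nil => exact .nil
  | cons K c ih =>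
    exact .cons (fun J hJ => fst_lt_of_before (h.2.lt_fst J hJ)) (ih h.2)

theorem chainFrom_of_pairwise {p : WithBot α} {c : List (NonemptyInterval α)}
    (h : c.Pairwise (fun J K => J.snd < K.fst)) (hp : ∀ J ∈ c, p < (J.fst : WithBot α)) :
    ChainFrom p c := by
  induction c generalizing p with
  | nil => trivial
  | cons K c ih =>
    rw [List.pairwise_cons] at h
    exact ⟨hp K (by simp), ih h.2 (fun J hJ => by exact_mod_cast h.1 J hJ)⟩

theorem ChainFrom.sublist {p : WithBot α} {c c' : List (NonemptyInterval α)} (h : ChainFrom p c)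
    (hs : c'.Sublist c) : ChainFrom p c' :=
  chainFrom_of_pairwise (h.pairwise.sublist hs) (fun J hJ => h.lt_fst J (hs.subset hJ))

theorem ChainFrom.nodup {p : WithBot α} {c : List (NonemptyInterval α)} (h : ChainFrom p c) :
    c.Nodup :=
  h.pairwise.imp (fun {J K} hJK => by
    rintro rfl; exact absurd J.fst_le_snd (not_le.2 hJK))

/-! ### Exchange-free gaps -/

theorem NoExchange.mono_start {S : Finset (NonemptyInterval α)} {k : ℕ} {p q : WithBot α}
    {B : List (NonemptyInterval α)} (h : NoExchange S k p B) (hpq : p ≤ q) :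
    NoExchange S k q B :=
  fun c d hc hS hk => h c d (hc.mono hpq) hS hk

theorem NoExchange.mono_size {S : Finset (NonemptyInterval α)} {k n : ℕ} {p : WithBot α}
    {B : List (NonemptyInterval α)} (h : NoExchange S n p B) (hkn : k ≤ n) :
    NoExchange S k p B :=
  fun c d hc hS hk => h c d hc hS (hk.trans hkn)

/-- The solution enters only through the left end at each position, and moving left ends to the left
makes exchanges harder. Gaps to the left of a repaired region survive for this reason. -/
theorem NoExchange.of_pointwise {S : Finset (NonemptyInterval α)} {k : ℕ} {p : WithBot α}
    {B B' : List (NonemptyInterval α)} (h : NoExchange S k p B)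
    (hB : ∀ (i : ℕ) (J : NonemptyInterval α), B[i]? = some J →
      ∃ J', B'[i]? = some J' ∧ J'.fst ≤ J.fst) :
    NoExchange S k p B' := by
  intro c d hc hS hk
  obtain ⟨J, hJ, hd⟩ := h c d hc hS hk
  obtain ⟨J', hJ', h'⟩ := hB _ _ hJ
  exact ⟨J', hJ', h'.trans hd⟩

/-- The first interval of a competing chain ends no earlier than `J`, so the rest of that chain
competes with `B` behind `J`, at a size smaller by one. -/
theorem NoExchange.cons_next {S : Finset (NonemptyInterval α)} {k : ℕ} {p : WithBot α}
    {J : NonemptyInterval α} {B : List (NonemptyInterval α)} (hJ : IsNext S p J)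
    (h : NoExchange S k J.snd B) : NoExchange S k p (J :: B) := by
  intro c d hc hS hk
  have key : ∀ e ∈ S, p < (e.fst : WithBot α) → J.snd ≤ e.snd := fun e he hpe => by
    rcases hJ.2.2 e he hpe with h | h
    · exact h.le
    · exact h.1.le
  cases c with
  | nil => exact ⟨J, rfl, J.fst_le_snd.trans (key d (hS d (by simp)) hc.1)⟩
  | cons e c =>
    have he : J.snd ≤ e.snd := key e (hS e (by simp)) hc.1
    have hk' : c.length ≤ k := by simp at hk; omega
    obtain ⟨K, hK, hd⟩ := h c d (hc.2.mono (by exact_mod_cast he))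
      (fun K hK => hS K (by simp at hK ⊢; tauto)) hk'
    exact ⟨K, by simpa using hK, hd⟩

/-- A chain behind `J` becomes a chain behind `p` when `J` is put in front of it; this costs one
unit of size. -/
theorem NoExchange.tail {S : Finset (NonemptyInterval α)} {k : ℕ} {p : WithBot α}
    {J : NonemptyInterval α} {B : List (NonemptyInterval α)} (h : NoExchange S (k + 1) p (J :: B))
    (hJ : J ∈ S) (hp : p < (J.fst : WithBot α)) : NoExchange S k J.snd B := by
  intro c d hc hS hk
  obtain ⟨K, hK, hd⟩ := h (J :: c) d ⟨hp, hc⟩ (fun K hK => by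
    rcases List.mem_cons.1 hK with rfl | hK
    · exact hJ
    · exact hS K hK) (by simpa using hk)
  exact ⟨K, by simpa using hK, hd⟩

theorem noExchanges_nil {S : Finset (NonemptyInterval α)} {k : ℕ} {p : WithBot α} :
    NoExchanges S k p [] ↔ NoExchange S k p [] := by
  constructor
  · intro h; exact h [] [] rfl
  · intro h B₁ B₂ hB
    obtain ⟨rfl, rfl⟩ := List.append_eq_nil_iff.1 hB.symm
    exact h

theorem noExchanges_cons {S : Finset (NonemptyInterval α)} {k : ℕ} {p : WithBot α}
    {J : NonemptyInterval α} {B : List (NonemptyInterval α)} :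
    NoExchanges S k p (J :: B) ↔ NoExchange S k p (J :: B) ∧ NoExchanges S k J.snd B := by
  constructor
  · intro h
    exact ⟨h [] _ rfl, fun B₁ B₂ hB => h (J :: B₁) B₂ (by simp [hB])⟩
  · rintro ⟨h₁, h₂⟩ B₁ B₂ hB
    cases B₁ with
    | nil => obtain rfl : J :: B = B₂ := hB; exact h₁
    | cons K B₁ =>
      obtain ⟨rfl, rfl⟩ := List.cons.inj hB
      exact h₂ _ _ rfl

theorem NoExchanges.append_right {S : Finset (NonemptyInterval α)} {k : ℕ} {p : WithBot α}
    {A B : List (NonemptyInterval α)} (h : NoExchanges S k p (A ++ B)) :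
    NoExchanges S k (endFrom p A) B := by
  rintro B₁ B₂ rfl
  have := h (A ++ B₁) B₂ (by simp)
  rwa [endFrom_append] at this

theorem NoExchanges.noExchange {S : Finset (NonemptyInterval α)} {k : ℕ} {p : WithBot α}
    {B : List (NonemptyInterval α)} (h : NoExchanges S k p B) : NoExchange S k p B :=
  h [] B rfl

theorem NoExchanges.mono_start {S : Finset (NonemptyInterval α)} {k : ℕ} {p q : WithBot α}
    {B : List (NonemptyInterval α)} (h : NoExchanges S k p B) (hpq : p ≤ q) :
    NoExchanges S k q B := by
  cases B with
  | nil => rw [noExchanges_nil] at h ⊢; exact h.mono_start hpq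
  | cons J B => rw [noExchanges_cons] at h ⊢; exact ⟨h.1.mono_start hpq, h.2⟩

/-- Optimality propagates backwards through greedy intervals, without loss of size, by
`NoExchange.cons_next`. -/
theorem NoExchanges.append_greedy {S : Finset (NonemptyInterval α)} {k : ℕ} {p : WithBot α}
    {g R : List (NonemptyInterval α)} (hg : GreedyFrom S p g)
    (h : NoExchanges S k (endFrom p g) R) : NoExchanges S k p (g ++ R) := by
  induction g generalizing p with
  | nil => exact h
  | cons J g ih =>
    have := ih hg.2 h
    exact noExchanges_cons.2 ⟨this.noExchange.cons_next hg.1, this⟩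

/-- Greedy stays ahead: the i-th greedy interval ends no later than the i-th interval of any other
chain. -/
theorem GreedyFrom.noExchange {S : Finset (NonemptyInterval α)} {p : WithBot α}
    {g : List (NonemptyInterval α)} (hg : GreedyFrom S p g) :
    ∀ n < g.length, NoExchange S n p g := by
  induction g generalizing p with
  | nil => simp
  | cons J g ih =>
    intro n hn c d hc hS hk
    have key : ∀ e ∈ S, p < (e.fst : WithBot α) → J.snd ≤ e.snd := fun e he hpe => by
      rcases hg.1.2.2 e he hpe with h | h
      · exact h.le
      · exact h.1.le
    cases c with
    | nil => exact ⟨J, rfl, J.fst_le_snd.trans (key d (hS d (by simp)) hc.1)⟩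
    | cons e c =>
      have he : J.snd ≤ e.snd := key e (hS e (by simp)) hc.1
      simp only [List.length_cons] at hn hk
      obtain ⟨K, hK, hd⟩ := ih hg.2 c.length (by omega) c d (hc.2.mono (by exact_mod_cast he))
        (fun K hK => hS K (by simp at hK ⊢; tauto)) le_rfl
      exact ⟨K, by simpa using hK, hd⟩

/-- If the solution cannot be improved much after `p`, then it cannot be improved after the
first intervals to the right of `p` either. -/
theorem NoExchange.noExchanges_append {S : Finset (NonemptyInterval α)} {k : ℕ} {p : WithBot α}
    {G B : List (NonemptyInterval α)} (h : NoExchange S (k + G.length) p (G ++ B))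
    (hc : ChainFrom p G) (hG : ∀ J ∈ G, J ∈ S)
    (hB : ∀ J B', B = J :: B' → NoExchanges S k J.snd B') : NoExchanges S k p (G ++ B) := by
  induction G generalizing p with
  | nil =>
    cases B with
    | nil => exact noExchanges_nil.2 h
    | cons J B => exact noExchanges_cons.2 ⟨h, hB J B rfl⟩
  | cons J G ih =>
    refine noExchanges_cons.2 ⟨h.mono_size (by omega), ih ?_ hc.2 (fun K hK => hG K (by simp [hK]))⟩
    exact NoExchange.tail h (hG J (by simp)) hc.1

/-! ### Greedy exchanges -/

theorem IsNext.snd_le {S : Finset (NonemptyInterval α)} {p : WithBot α} {c d : NonemptyInterval α}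
    (h : IsNext S p c) (hd : d ∈ S) (hp : p < (d.fst : WithBot α)) : c.snd ≤ d.snd := by
  rcases h.2.2 d hd hp with h | h
  · exact h.le
  · exact h.1.le

/-- This is what the tie-breaking is for: among equal right ends the greatest left end gives the
shortest interval. -/
theorem IsNext.minimal {S : Finset (NonemptyInterval α)} {p : WithBot α} {c : NonemptyInterval α}
    (h : IsNext S p c) : ∀ d ∈ S, d ≤ c → d = c := by
  intro d hd hdc
  have h₁ : c.fst ≤ d.fst := hdc.1
  have h₂ : d.snd ≤ c.snd := hdc.2
  rcases h.2.2 d hd (lt_of_lt_of_le h.2.1 (by exact_mod_cast h₁)) with h' | h'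
  · exact absurd h' (not_lt.2 h₂)
  · exact NonemptyInterval.ext (Prod.ext (le_antisymm h'.2 h₁) h'.1.symm)

theorem Exchange.greedyFrom {S : Finset (NonemptyInterval α)} {p : WithBot α}
    {B g R : List (NonemptyInterval α)} (h : Exchange S p B g R) : GreedyFrom S p g := by
  induction h with
  | base h _ => exact ⟨h, trivial⟩
  | step h _ _ ih => exact ⟨h, ih⟩

theorem Exchange.chainFrom {S : Finset (NonemptyInterval α)} {p : WithBot α}
    {B g R : List (NonemptyInterval α)} (h : Exchange S p B g R) : ChainFrom p (g ++ R) := by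
  induction h with
  | base h h' => exact ⟨h.2.1, h'⟩
  | step h _ _ ih => exact ⟨h.2.1, ih⟩

theorem GreedyFrom.allMinimal {S : Finset (NonemptyInterval α)} {p : WithBot α}
    {g : List (NonemptyInterval α)} (h : GreedyFrom S p g) : AllMinimal S g := by
  induction g generalizing p with
  | nil => intro J hJ; simp at hJ
  | cons J g ih =>
    intro K hK
    rcases List.mem_cons.1 hK with rfl | hK
    · exact ⟨h.1.1, h.1.minimal⟩
    · exact ih h.2 K hK

/-- Otherwise `d` would be properly contained in `J`. -/
theorem snd_le_snd_of_fst_lt {S : Finset (NonemptyInterval α)} {J d : NonemptyInterval α}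
    (hJ : ∀ d ∈ S, d ≤ J → d = J) (hd : d ∈ S) (h : J.fst < d.fst) : J.snd ≤ d.snd := by
  by_contra hlt
  have := hJ d hd ⟨h.le, (not_le.1 hlt).le⟩
  subst this
  exact lt_irrefl _ h

/-- The comparison of ends makes the gap in front of the kept part `R` start no earlier than before,
so its optimality is inherited by `NoExchanges.mono_start`. -/
theorem Exchange.exists_removed {S : Finset (NonemptyInterval α)} {p : WithBot α}
    {B g R : List (NonemptyInterval α)} (h : Exchange S p B g R) (hmin : AllMinimal S B)
    (hc : ChainFrom p B) :
    ∃ T, B = T ++ R ∧ g.length = T.length + 1 ∧ endFrom p T ≤ endFrom p g := by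
  induction h with
  | base h h' => exact ⟨[], rfl, rfl, (lt_snd_of_lt_fst h.2.1).le⟩
  | @step p c J B g R h hJ hE ih =>
    have hJS := hmin J (by simp)
    have hcJ : c.snd ≤ J.snd := h.snd_le hJS.1 hc.1
    obtain ⟨T, rfl, hlen, hend⟩ := ih (fun K hK => hmin K (by simp [hK]))
      (hc.2.mono (by exact_mod_cast hcJ))
    refine ⟨J :: T, rfl, by simp [hlen], ?_⟩
    cases T with
    | cons K T => exact hend
    | nil =>
      obtain ⟨d, rfl⟩ := List.length_eq_one_iff.1 hlen
      have hd := hE.greedyFrom.1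
      -- The last removed `J` starts before `c` ends, and `d` starts after that; by minimality of
      -- `J`, `d` cannot end inside `J`.
      have hlt : J.fst < d.fst := lt_of_le_of_lt hJ (fst_lt_of_before hd.2.1)
      exact WithBot.coe_le_coe.2 (snd_le_snd_of_fst_lt hJS.2 hd.1 hlt)

theorem Exchange.kept_subset {S : Finset (NonemptyInterval α)} {p : WithBot α}
    {B g R : List (NonemptyInterval α)} (h : Exchange S p B g R) : R ⊆ B := by
  induction h with
  | base => exact List.Subset.refl _
  | step _ _ _ ih => exact List.subset_cons_of_subset _ ih

theorem ChainFrom.fst_le_fst_succ {p : WithBot α} {B : List (NonemptyInterval α)}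
    (h : ChainFrom p B) {i : ℕ} {J K : NonemptyInterval α} (hJ : B[i]? = some J)
    (hK : B[i + 1]? = some K) : J.fst ≤ K.fst := by
  induction B generalizing p i with
  | nil => simp at hJ
  | cons L B ih =>
    cases i with
    | zero =>
      simp at hJ hK; subst hJ
      exact L.fst_le_snd.trans
        (fst_lt_of_before (h.2.lt_fst K (List.mem_of_getElem? hK))).le
    | succ i => exact ih h.2 (by simpa using hJ) (by simpa using hK)

/-- Before the extra interval, `c` ends no later than the interval `K` it replaces and does not lie
properly inside it, so it starts no later. Behind the extra interval the old list is shifted by one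
position. -/
theorem Exchange.pointwise {S : Finset (NonemptyInterval α)} {p : WithBot α}
    {B g R : List (NonemptyInterval α)} (h : Exchange S p B g R) (hmin : AllMinimal S B)
    (hc : ChainFrom p B) (i : ℕ) (J : NonemptyInterval α) (hJ : B[i]? = some J) :
    ∃ J', (g ++ R)[i]? = some J' ∧ J'.fst ≤ J.fst := by
  induction h generalizing i J with
  | @base p c B h h' =>
    cases i with
    | zero =>
      refine ⟨c, rfl, c.fst_le_snd.trans ?_⟩
      exact (fst_lt_of_before (h'.lt_fst J (List.mem_of_getElem? hJ))).le
    -- After the insertion of `c` the old predecessor stands at this position.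
    | succ i =>
      have hi : i < B.length := by
        have := (List.getElem?_eq_some_iff.1 hJ).1; omega
      exact ⟨B[i], by simp [hi], hc.fst_le_fst_succ (by simp [hi]) hJ⟩
  | @step p c K B g R h hK hE ih =>
    have hKS := hmin K (by simp)
    have hcK : c.snd ≤ K.snd := h.snd_le hKS.1 hc.1
    cases i with
    | zero =>
      simp at hJ; subst hJ
      refine ⟨c, rfl, ?_⟩
      by_contra hlt
      have := hKS.2 c h.1 ⟨(not_le.1 hlt).le, hcK⟩
      subst this
      exact hlt le_rfl
    | succ i =>
      obtain ⟨J', hJ', hle⟩ := ih (fun K hK => hmin K (by simp [hK]))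
        (hc.2.mono (by exact_mod_cast hcK)) i J (by simpa using hJ)
      exact ⟨J', by simpa using hJ', hle⟩

theorem Exchange.allMinimal {S : Finset (NonemptyInterval α)} {p : WithBot α}
    {B g R : List (NonemptyInterval α)} (h : Exchange S p B g R) (hmin : AllMinimal S B)
    (hc : ChainFrom p B) : AllMinimal S (g ++ R) := by
  obtain ⟨T, rfl, -, -⟩ := h.exists_removed hmin hc
  intro J hJ
  rcases List.mem_append.1 hJ with hJ | hJ
  · exact h.greedyFrom.allMinimal J hJ
  · exact hmin J (by simp [hJ])

/-- An exchange either repairs all gaps to the right of `p`, or it takes place entirely in the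
range of `G`. -/
theorem Exchange.noExchanges_or {S : Finset (NonemptyInterval α)} {k : ℕ} {p : WithBot α}
    {G B g R : List (NonemptyInterval α)} (h : Exchange S p (G ++ B) g R)
    (hmin : AllMinimal S (G ++ B)) (hc : ChainFrom p (G ++ B))
    (hG : ∀ n < G.length, NoExchange S n p G)
    (hB : ∀ J B', B = J :: B' → NoExchanges S k J.snd B') :
    NoExchanges S k p (g ++ R) ∨ (R = B ∧ g.length = G.length + 1) := by
  obtain ⟨T, hT, hlen, hend⟩ := h.exists_removed hmin hc
  -- Otherwise `g` would be an exchange inside `G` of a size excluded by `hG`: the interval of `G`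
  -- that its last member must reach is kept in `R`.
  have hle : G.length ≤ T.length := by
    by_contra hlt
    rw [not_le] at hlt
    have hg : g ≠ [] := by rintro rfl; simp at hlen
    obtain ⟨c, d, rfl⟩ : ∃ c d, g = c ++ [d] :=
      ⟨g.dropLast, g.getLast hg, (List.dropLast_append_getLast hg).symm⟩
    have hchain := h.chainFrom
    have hgm := h.greedyFrom.allMinimal
    have hcl : c.length = T.length := by simpa using hlen
    obtain ⟨J, hJ, hd⟩ := hG c.length (by omega) c d (chainFrom_append.1 hchain).1
      (fun J hJ => (hgm J hJ).1) le_rfl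
    have hJR : J ∈ R := by
      have h1 : (T ++ R)[T.length]? = some J := by
        rw [← hT, ← hcl, List.getElem?_append_left (by omega)]; exact hJ
      rw [List.getElem?_append_right le_rfl] at h1
      exact List.mem_of_getElem? h1
    have := (chainFrom_append.1 hchain).2.lt_fst J hJR
    rw [endFrom_append] at this
    exact absurd (fst_lt_of_before this) (not_lt.2 hd)
  obtain ⟨T₂, rfl⟩ : ∃ T₂, T = G ++ T₂ := by
    refine ⟨T.drop G.length, ?_⟩
    have : G = T.take G.length := by
      have := congrArg (List.take G.length) hT
      rw [List.take_append_of_le_length hle] at this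
      simpa using this
    conv_lhs => rw [← List.take_append_drop G.length T, ← this]
  have hB' : B = T₂ ++ R := by simpa using hT
  cases T₂ with
  | nil => right; exact ⟨by simpa using hB'.symm, by simpa using hlen⟩
  | cons J T₂ =>
    left
    refine NoExchanges.append_greedy h.greedyFrom ?_
    -- At least one interval of `B` was removed, so the gap in front of `R` is among those that `hB`
    -- covers.
    have := (hB J (T₂ ++ R) hB').append_right
    refine this.mono_start (le_trans (le_of_eq ?_) hend)
    rw [endFrom_append]; rfl

theorem Improves.pointwise {S : Finset (NonemptyInterval α)} {n : ℕ} {p : WithBot α}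
    {B B' : List (NonemptyInterval α)} (h : Improves S n p B B') (hmin : AllMinimal S B)
    (hc : ChainFrom p B) (i : ℕ) (J : NonemptyInterval α) (hJ : B[i]? = some J) :
    ∃ J', B'[i]? = some J' ∧ J'.fst ≤ J.fst := by
  rcases h with ⟨rfl, -⟩ | ⟨g, R, h, rfl⟩
  · exact ⟨J, hJ, le_rfl⟩
  · exact h.pointwise hmin hc i J hJ

theorem Improves.allMinimal {S : Finset (NonemptyInterval α)} {n : ℕ} {p : WithBot α}
    {B B' : List (NonemptyInterval α)} (h : Improves S n p B B') (hmin : AllMinimal S B)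
    (hc : ChainFrom p B) : AllMinimal S B' := by
  rcases h with ⟨rfl, -⟩ | ⟨g, R, h, rfl⟩
  · exact hmin
  · exact h.allMinimal hmin hc

theorem Improves.chainFrom {S : Finset (NonemptyInterval α)} {n : ℕ} {p : WithBot α}
    {B B' : List (NonemptyInterval α)} (h : Improves S n p B B')
    (hc : ChainFrom p B) : ChainFrom p B' := by
  rcases h with ⟨rfl, -⟩ | ⟨g, R, h, rfl⟩
  · exact hc
  · exact h.chainFrom

/-- Later attempts do not spoil a repaired suffix. This is the dichotomy with empty `G`; its second
case would insert an interval without removing one, which the gap at `p` forbids. -/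
theorem Improves.noExchanges {S : Finset (NonemptyInterval α)} {n k : ℕ} {p : WithBot α}
    {B B' : List (NonemptyInterval α)} (h : Improves S n p B B') (hmin : AllMinimal S B)
    (hc : ChainFrom p B) (hB : NoExchanges S k p B) : NoExchanges S k p B' := by
  rcases h with ⟨rfl, -⟩ | ⟨g, R, h, rfl⟩
  · exact hB
  · rcases h.noExchanges_or (G := []) (B := B) (k := k) hmin hc (by simp)
      (fun J B' hJ => by subst hJ; exact (noExchanges_cons.1 hB).2) with h' | ⟨rfl, hlen⟩
    · exact h'
    · exfalso
      obtain ⟨d, rfl⟩ := List.length_eq_one_iff.1 hlen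
      have hd := h.greedyFrom.1
      obtain ⟨J, hJ, hle⟩ := hB.noExchange [] d ⟨hd.2.1, trivial⟩ (by simpa using hd.1) (by simp)
      have := h.chainFrom.2.lt_fst J (List.mem_of_getElem? hJ)
      exact absurd (fst_lt_of_before this) (not_lt.2 hle)

theorem Improves.noExchanges_or {S : Finset (NonemptyInterval α)} {n k : ℕ} {p : WithBot α}
    {G B B' : List (NonemptyInterval α)} (h : Improves S n p (G ++ B) B')
    (hmin : AllMinimal S (G ++ B)) (hc : ChainFrom p (G ++ B))
    (hG : ∀ i < G.length, NoExchange S i p G)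
    (hB : ∀ J B', B = J :: B' → NoExchanges S k J.snd B') (hn : k + G.length ≤ n) :
    NoExchanges S k p B' ∨ ∃ g, B' = g ++ B ∧ g.length = G.length + 1 ∧ GreedyFrom S p g := by
  rcases h with ⟨rfl, h⟩ | ⟨g, R, h, rfl⟩
  · left
    exact (h.mono_size hn).noExchanges_append (chainFrom_append.1 hc).1
      (fun J hJ => (hmin J (by simp [hJ])).1) hB
  · rcases h.noExchanges_or hmin hc hG hB with h' | ⟨rfl, hlen⟩
    · exact .inl h'
    · exact .inr ⟨g, rfl, hlen, h.greedyFrom⟩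

/-- Three attempts to improve after `p` repair all gaps to the right of `p`. -/
theorem noExchanges_of_improves {S : Finset (NonemptyInterval α)} {n k : ℕ} {p : WithBot α}
    {G B B₁ B₂ B₃ : List (NonemptyInterval α)}
    (h₁ : Improves S n p (G ++ B) B₁) (h₂ : Improves S n p B₁ B₂) (h₃ : Improves S n p B₂ B₃)
    (hmin : AllMinimal S (G ++ B)) (hc : ChainFrom p (G ++ B))
    (hG : ∀ i < G.length, NoExchange S i p G)
    (hB : ∀ J B', B = J :: B' → NoExchanges S k J.snd B') (hn : k + G.length + 2 ≤ n)
    (hD : ∀ g, GreedyFrom S p g → ChainFrom p (g ++ B) → g.length = G.length + 3 →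
      NoExchanges S k (endFrom p g) B) : NoExchanges S k p B₃ := by
  have hm₁ := h₁.allMinimal hmin hc
  have hc₁ := h₁.chainFrom hc
  have hm₂ := h₂.allMinimal hm₁ hc₁
  have hc₂ := h₂.chainFrom hc₁
  have hc₃ := h₃.chainFrom hc₂
  rcases h₁.noExchanges_or hmin hc hG hB (by omega) with h | ⟨g, rfl, hl, hg⟩
  · exact h₃.noExchanges hm₂ hc₂ (h₂.noExchanges hm₁ hc₁ h)
  rcases h₂.noExchanges_or hm₁ hc₁ hg.noExchange hB (by omega) with h | ⟨g, rfl, hl, hg⟩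
  · exact h₃.noExchanges hm₂ hc₂ h
  rcases h₃.noExchanges_or hm₂ hc₂ hg.noExchange hB (by omega) with h | ⟨g, rfl, hl, hg⟩
  · exact h
  exact NoExchanges.append_greedy hg (hD g hg hc₃ (by omega))

end ListTheory

/-! ### Solutions and their repair after a change of the set. -/

section Solutions

variable {α : Type*} [LinearOrder α]

/-- `L` lists, from left to right, an independent set of inclusion-minimal members of `S` that has
no exchange of size at most `k`. -/
structure IsSolution (S : Finset (NonemptyInterval α)) (k : ℕ)
    (L : List (NonemptyInterval α)) : Prop where
  chain : ChainFrom ⊥ L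
  minimal : AllMinimal S L
  noExchanges : NoExchanges S k ⊥ L

/-- A chain that starts behind the left end of `x` cannot contain `x`, so it does not see the
change. -/
theorem NoExchange.congr_right {S S' : Finset (NonemptyInterval α)} {x : NonemptyInterval α}
    (hS : ∀ y, y ≠ x → (y ∈ S' ↔ y ∈ S)) {k : ℕ} {p : WithBot α}
    {B : List (NonemptyInterval α)} (h : NoExchange S k p B) (hp : (x.fst : WithBot α) ≤ p) :
    NoExchange S' k p B := by
  intro c d hc hc' hk
  refine h c d hc (fun J hJ => (hS J ?_).1 (hc' J hJ)) hk
  rintro rfl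
  exact absurd (hc.lt_fst J hJ) (not_lt.2 hp)

theorem NoExchanges.congr_right {S S' : Finset (NonemptyInterval α)} {x : NonemptyInterval α}
    (hS : ∀ y, y ≠ x → (y ∈ S' ↔ y ∈ S)) {k : ℕ} {p : WithBot α}
    {B : List (NonemptyInterval α)} (h : NoExchanges S k p B) (hc : ChainFrom p B)
    (hp : (x.fst : WithBot α) ≤ p) : NoExchanges S' k p B := by
  rintro B₁ B₂ rfl
  exact (h B₁ B₂ rfl).congr_right hS (hp.trans (chainFrom_append.1 hc).1.le_endFrom)

/-- Chains that use a changed interval `x` do not matter as long as the solution lies to the left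
of `x`. -/
theorem NoExchange.congr_left {S S' : Finset (NonemptyInterval α)} {x : NonemptyInterval α}
    (hS : ∀ y, y ≠ x → (y ∈ S' ↔ y ∈ S)) {k : ℕ} {p : WithBot α}
    {B C D : List (NonemptyInterval α)} (h : NoExchange S k p (B ++ C))
    (hB : ∀ J ∈ B, J.snd < x.fst) (hk : k < B.length) : NoExchange S' k p (B ++ D) := by
  intro c d hc hc' hck
  have hlt : c.length < B.length := by omega
  refine ⟨B[c.length], by rw [List.getElem?_append_left hlt, List.getElem?_eq_getElem hlt], ?_⟩
  by_cases hx : x ∈ c ++ [d]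
  · have h1 := hB _ (List.getElem_mem hlt)
    have h2 : x.snd ≤ d.snd := by
      have := hc.snd_le_endFrom x hx
      rw [endFrom_append] at this
      exact WithBot.coe_le_coe.1 this
    exact (NonemptyInterval.fst_le_snd _).trans (h1.le.trans (x.fst_le_snd.trans h2))
  · obtain ⟨J, hJ, hd⟩ := h c d hc
      (fun J hJ => (hS J (by rintro rfl; exact hx hJ)).1 (hc' J hJ)) hck
    rw [List.getElem?_append_left hlt, List.getElem?_eq_getElem hlt] at hJ
    obtain rfl := Option.some.inj hJ
    exact hd

/-- The change at `x` matters only to intervals that contain `x`, including `x` itself. -/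
theorem AllMinimal.congr {S S' : Finset (NonemptyInterval α)} {x : NonemptyInterval α}
    (hS : ∀ y, y ≠ x → (y ∈ S' ↔ y ∈ S)) {L : List (NonemptyInterval α)} (h : AllMinimal S L)
    (hx : ∀ J ∈ L, ¬ x ≤ J) : AllMinimal S' L := by
  intro J hJ
  refine ⟨(hS J (by rintro rfl; exact hx J hJ le_rfl)).2 (h J hJ).1, fun d hd hdJ => ?_⟩
  exact (h J hJ).2 d ((hS d (by rintro rfl; exact hx J hJ hdJ)).1 hd) hdJ

theorem exists_split_at {c : List (NonemptyInterval α)} {m : ℕ} (h : m < c.length) :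
    ∃ a d b, c = a ++ d :: b ∧ a.length = m :=
  ⟨c.take m, c.get ⟨m, h⟩, c.drop (m + 1), by simp, by simp; omega⟩

/-- A chain of length at least `B.length + 2` in the changed set passes the next interval of the
old solution. -/
theorem NoExchange.exists_fst_le_of_length {S S' : Finset (NonemptyInterval α)}
    {x : NonemptyInterval α} (hS : ∀ y, y ≠ x → (y ∈ S' ↔ y ∈ S)) {k : ℕ} {p : WithBot α}
    {B C g : List (NonemptyInterval α)} (h : NoExchange S k p (B ++ C)) (hB : B.length ≤ k)
    (hg : ChainFrom p g) (hgS : ∀ J ∈ g, J ∈ S') (hl : B.length + 2 ≤ g.length) :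
    ∃ J, C[0]? = some J ∧ (J.fst : WithBot α) ≤ endFrom p g := by
  classical
  -- Only `x` can be missing from `S`. Without it the chain still has at least `B.length + 1`
  -- members, all in `S`, and the old gap condition applies to the first of them.
  set g' := g.erase x with hg'
  have hsub : g'.Sublist g := List.erase_sublist
  have hlen : g.length ≤ g'.length + 1 := by
    rw [hg', List.length_erase]; split <;> omega
  obtain ⟨a, d, b, hab, ha⟩ := exists_split_at (c := g') (m := B.length) (by omega)
  have hc' : ChainFrom p (a ++ [d]) :=
    hg.sublist ((by simp [hab] : (a ++ [d]).Sublist g').trans hsub)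
  have hmem : ∀ J ∈ a ++ [d], J ∈ g' := fun J hJ => by
    rw [hab]; simp at hJ ⊢; tauto
  obtain ⟨J, hJ, hd⟩ := h a d hc' (fun J hJ => by
    have h1 := hmem J hJ
    rw [hg', hg.nodup.mem_erase_iff] at h1
    exact (hS J h1.1).1 (hgS J h1.2)) (by omega)
  rw [ha, List.getElem?_append_right le_rfl, Nat.sub_self] at hJ
  refine ⟨J, hJ, le_trans ?_ (hg.snd_le_endFrom d (hsub.subset (hmem d (by simp))))⟩
  exact_mod_cast hd

variable {S S' : Finset (NonemptyInterval α)} {x : NonemptyInterval α} {k n : ℕ}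
  {A B B₁ B₂ M C₁ C₂ C₃ : List (NonemptyInterval α)}

/-- After a change of the set at `x` and the removal of the interval around `x`, three attempts to
improve, started `k` intervals before `x`, restore a solution. -/
theorem IsSolution.update_of_improves (hL : IsSolution S k (A ++ (B₁ ++ (M ++ B₂))))
    (hS : ∀ y, y ≠ x → (y ∈ S' ↔ y ∈ S))
    (hM : M = [] ∨ ∃ K, M = [K] ∧ x ≤ K) (hx : ∀ J ∈ A ++ (B₁ ++ B₂), ¬ x ≤ J)
    (hA : ∀ J ∈ A ++ B₁, J.snd < x.fst) (hB₂ : ∀ J ∈ B₂, x.fst ≤ J.snd)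
    (hB₁ : B₁.length ≤ k) (hAB : A ≠ [] → B₁.length = k) (hn : 2 * k + 2 ≤ n)
    (h₁ : Improves S' n (endFrom ⊥ A) (B₁ ++ B₂) C₁) (h₂ : Improves S' n (endFrom ⊥ A) C₁ C₂)
    (h₃ : Improves S' n (endFrom ⊥ A) C₂ C₃) : IsSolution S' k (A ++ C₃) := by
  have hsub : (A ++ (B₁ ++ B₂)).Sublist (A ++ (B₁ ++ (M ++ B₂))) := by simp
  have hchain := hL.chain.sublist hsub
  have hmin' : AllMinimal S' (A ++ (B₁ ++ B₂)) :=
    AllMinimal.congr hS (fun J hJ => hL.minimal J (hsub.subset hJ)) hx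
  have hc := (chainFrom_append.1 hchain).2
  have hmin : AllMinimal S' (B₁ ++ B₂) := fun J hJ => hmin' J (List.mem_append_right _ hJ)
  have hm₁ := h₁.allMinimal hmin hc
  have hc₁ := h₁.chainFrom hc
  have hm₂ := h₂.allMinimal hm₁ hc₁
  have hc₂ := h₂.chainFrom hc₁
  have hright : NoExchanges S k (endFrom (endFrom ⊥ A) (B₁ ++ M)) B₂ := by
    have := hL.noExchanges.append_right (A := A)
    rw [← List.append_assoc] at this
    exact this.append_right
  have hcB : ChainFrom (endFrom (endFrom ⊥ A) B₁) B₂ := (chainFrom_append.1 hc).2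
  have hpA := hL.noExchanges.append_right.noExchange
  have hrep : NoExchanges S' k (endFrom ⊥ A) C₃ := by
    refine noExchanges_of_improves h₁ h₂ h₃ hmin hc ?_ ?_ (by omega) ?_
    -- The block `B₁` lies to the left of `x`, so a chain through `x` passes it in any case.
    · intro i hi
      have := NoExchange.congr_left (D := []) hS (hpA.mono_size (k := i) (by omega))
        (fun J hJ => hA J (List.mem_append_right _ hJ)) hi
      simpa using this
    -- Chains behind an interval of `B₂` start to the right of `x.fst`, so they do not contain `x`.
    · rintro J B' rfl
      refine NoExchanges.congr_right hS ?_ hcB.2 (by exact_mod_cast hB₂ J (by simp))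
      exact (noExchanges_cons.1 hright).2
    · intro g hg hcg hlen
      rw [chainFrom_append] at hcg
      have hgS : ∀ J ∈ g, J ∈ S' := fun J hJ => (hg.allMinimal J hJ).1
      -- With nothing removed, the greedy chain is so long that it must reach `B₂`, which
      -- contradicts disjointness. With `K` removed, it suffices that the chain ends no earlier than
      -- `K`.
      rcases hM with rfl | ⟨K, rfl, hxK⟩
      · exfalso
        obtain ⟨J, hJ, hle⟩ := NoExchange.exists_fst_le_of_length hS (C := B₂) (g := g)
          (by simpa using hpA) hB₁ hcg.1 hgS (by omega)
        have := hcg.2.lt_fst J (List.mem_of_getElem? hJ)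
        exact absurd this (not_lt.2 hle)
      · have hK : NoExchanges S k K.snd B₂ := by
          rw [endFrom_append] at hright; exact hright
        have hxK₁ : K.fst ≤ x.fst := hxK.1
        have hxK₂ : x.snd ≤ K.snd := hxK.2
        have hKm := (hL.minimal K (by simp)).2
        suffices hend : (K.snd : WithBot α) ≤ endFrom (endFrom ⊥ A) g by
          have hxK' : (x.fst : WithBot α) ≤ K.snd := by
            exact_mod_cast x.fst_le_snd.trans hxK₂
          refine ((hK.congr_right hS ?_ hxK').mono_start hend)
          have := hL.chain
          rw [chainFrom_append, chainFrom_append] at this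
          exact this.2.2.2
        obtain ⟨a, e, b, rfl, ha⟩ := exists_split_at (c := g) (m := B₁.length) (by omega)
        have hb : b.length = 2 := by simp at hlen; omega
        obtain ⟨f, h, rfl⟩ := List.length_eq_two.1 hb
        have hce : ChainFrom (endFrom ⊥ A) (a ++ [e]) := hcg.1.sublist (by simp)
        have hcr := (chainFrom_append.1 hcg.1).2
        have hef : e.snd < f.fst := fst_lt_of_before hcr.2.1
        have hfh : f.snd < h.fst := fst_lt_of_before hcr.2.2.1
        -- The first `B₁.length + 1` intervals reach `K`: if they include `x`, because `x` lies in
        -- `K`; otherwise by the old gap condition.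
        have hKe : K.fst ≤ e.snd := by
          by_cases hxa : x ∈ a ++ [e]
          · have := hce.snd_le_endFrom x hxa
            rw [endFrom_append] at this
            exact hxK₁.trans (x.fst_le_snd.trans (WithBot.coe_le_coe.1 this))
          · obtain ⟨J, hJ, hd⟩ := hpA a e hce (fun J hJ => by
              refine (hS J (by rintro rfl; exact hxa hJ)).1 (hgS J ?_)
              simp at hJ ⊢; tauto) (by omega)
            rw [ha, List.getElem?_append_right le_rfl, Nat.sub_self] at hJ
            obtain rfl : K = J := by simpa using hJ
            exact hd
        have hend : endFrom (endFrom ⊥ A) (a ++ e :: [f, h]) = h.snd := by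
          rw [endFrom_append]; rfl
        rw [hend, WithBot.coe_le_coe]
        -- At least one of `f`, `h` is an old interval. It starts to the right of `K.fst`, so by
        -- minimality of `K` it ends no earlier than `K`. Two spare intervals are needed because one
        -- may be `x`.
        by_cases hfx : f = x
        · have hhx : h ≠ x := by
            rintro rfl; subst hfx; exact absurd f.fst_le_snd (not_le.2 hfh)
          refine snd_le_snd_of_fst_lt hKm ((hS h hhx).1 (hgS h (by simp))) ?_
          exact lt_of_le_of_lt hKe (hef.trans_le (f.fst_le_snd.trans hfh.le))
        · have := snd_le_snd_of_fst_lt hKm ((hS f hfx).1 (hgS f (by simp))) (hKe.trans_lt hef)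
          exact this.trans (hfh.le.trans h.fst_le_snd)
  have hpoint : ∀ (i : ℕ) (J : NonemptyInterval α), (B₁ ++ B₂)[i]? = some J →
      ∃ J', C₃[i]? = some J' ∧ J'.fst ≤ J.fst := by
    intro i J hJ
    obtain ⟨J₁, hJ₁, hle₁⟩ := h₁.pointwise hmin hc i J hJ
    obtain ⟨J₂, hJ₂, hle₂⟩ := h₂.pointwise hm₁ hc₁ i J₁ hJ₁
    obtain ⟨J₃, hJ₃, hle₃⟩ := h₃.pointwise hm₂ hc₂ i J₂ hJ₂
    exact ⟨J₃, hJ₃, hle₃.trans (hle₂.trans hle₁)⟩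
  refine ⟨chainFrom_append.2 ⟨(chainFrom_append.1 hchain).1, h₃.chainFrom hc₂⟩, ?_, ?_⟩
  · intro J hJ
    rcases List.mem_append.1 hJ with hJ | hJ
    · exact hmin' J (List.mem_append_left _ hJ)
    · exact h₃.allMinimal hm₂ hc₂ J hJ
  · intro D₁ D₂ hD
    -- Nonempty `A` forces `B₁.length = k`, so more than `k` intervals separate such a gap from `x`.
    -- Its condition survives the change of the set, and then the replacement of the suffix by `C₃`,
    -- by `hpoint`.
    have hA' : ∀ E J F, A = E ++ J :: F →
        NoExchange S' k (endFrom ⊥ E) (J :: F ++ C₃) := by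
      rintro E J F rfl
      have h0 : NoExchange S k (endFrom ⊥ E) ((J :: F ++ B₁) ++ (M ++ B₂)) := by
        have := hL.noExchanges E (J :: F ++ (B₁ ++ (M ++ B₂))) (by simp)
        simpa using this
      have h1 := h0.congr_left (D := B₂) hS
        (fun J' hJ' => hA J' (by simp at hJ' ⊢; tauto))
        (by have := hAB (by simp); simp; omega)
      refine h1.of_pointwise fun i J' hJ' => ?_
      rw [List.append_assoc] at hJ'
      rcases lt_or_ge i (J :: F).length with hi | hi
      · rw [List.getElem?_append_left hi] at hJ' ⊢
        exact ⟨J', hJ', le_rfl⟩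
      · rw [List.getElem?_append_right hi] at hJ' ⊢
        exact hpoint _ _ hJ'
    rcases List.append_eq_append_iff.1 hD with ⟨E, rfl, hE⟩ | ⟨E, hE, rfl⟩
    · rw [endFrom_append]
      exact hrep E D₂ hE
    · cases E with
      | nil =>
        have : A = D₁ := by simpa using hE
        subst this
        exact hrep.noExchange
      | cons J F => exact hA' D₁ J F hE

/-! ### Local optimality of solutions -/

theorem isSolution_nil : IsSolution (∅ : Finset (NonemptyInterval α)) k [] :=
  ⟨trivial, fun J hJ => by simp at hJ,
    noExchanges_nil.2 fun c d _ hS _ => by simpa using hS d (by simp)⟩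

theorem disjoint_iff_before {J K : NonemptyInterval α} :
    Disjoint (J : Set α) (K : Set α) ↔ J.snd < K.fst ∨ K.snd < J.fst := by
  rw [Set.disjoint_left]
  constructor
  · intro h
    by_contra hcon
    push Not at hcon
    rcases le_total J.fst K.fst with hle | hle
    · exact h (a := K.fst) (NonemptyInterval.mem_coe_interval.2 ⟨hle, hcon.1⟩)
        (NonemptyInterval.mem_coe_interval.2 ⟨le_rfl, K.fst_le_snd⟩)
    · exact h (a := J.fst) (NonemptyInterval.mem_coe_interval.2 ⟨le_rfl, J.fst_le_snd⟩)
        (NonemptyInterval.mem_coe_interval.2 ⟨hle, hcon.2⟩)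
  · rintro (h | h) a ha hb
    · exact absurd (ha.2.trans_lt h) (not_lt.2 hb.1)
    · exact absurd (hb.2.trans_lt h) (not_lt.2 ha.1)

theorem ChainFrom.isIndep {p : WithBot α}
    {L : List (NonemptyInterval α)} (h : ChainFrom p L) : IsIndep L.toFinset := by
  intro J hJ K hK hne
  rw [Finset.mem_coe, List.mem_toFinset] at hJ hK
  rw [Function.onFun, disjoint_iff_before]
  let R : NonemptyInterval α → NonemptyInterval α → Prop :=
    fun J K => J.snd < K.fst ∨ K.snd < J.fst
  have : Std.Symm R := ⟨fun _ _ h => Or.symm h⟩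
  have hR : L.Pairwise R := h.pairwise.imp Or.inl
  exact hR.forall hJ hK hne

/-- An independent set can be listed from left to right. -/
theorem IsIndep.exists_chainFrom {I : Finset (NonemptyInterval α)} (h : IsIndep I) :
    ∃ c, ChainFrom ⊥ c ∧ (∀ J, J ∈ c ↔ J ∈ I) ∧ c.length = I.card := by
  classical
  suffices H : ∀ (n : ℕ) (I : Finset (NonemptyInterval α)), IsIndep I → I.card = n →
      ∃ c : List (NonemptyInterval α), c.Pairwise (fun J K => J.snd < K.fst) ∧
        (∀ J, J ∈ c ↔ J ∈ I) ∧ c.length = I.card by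
    obtain ⟨c, hc, hm, hl⟩ := H _ I h rfl
    exact ⟨c, chainFrom_of_pairwise hc (fun J _ => WithBot.bot_lt_coe _), hm, hl⟩
  intro n
  induction n with
  | zero =>
    intro I _ hI
    obtain rfl := Finset.card_eq_zero.1 hI
    exact ⟨[], .nil, by simp, rfl⟩
  | succ n ih =>
    intro I hI hn
    obtain ⟨J, hJ, hmin⟩ := I.exists_min_image (fun J => J.fst)
      (Finset.card_pos.1 (by omega))
    obtain ⟨c, hc, hm, hl⟩ := ih (I.erase J)
      (hI.subset (by simp)) (by rw [Finset.card_erase_of_mem hJ]; omega)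
    refine ⟨J :: c, .cons (fun K hK => ?_) hc, fun K => ?_, ?_⟩
    · have hK' := Finset.mem_erase.1 ((hm K).1 hK)
      rcases disjoint_iff_before.1 (hI hJ hK'.2 hK'.1.symm) with h | h
      · exact h
      · exact absurd (K.fst_le_snd.trans_lt h) (not_lt.2 (hmin K hK'.2))
    · rw [List.mem_cons, hm, Finset.mem_erase]
      constructor
      · rintro (rfl | h)
        · exact hJ
        · exact h.2
      · intro h; by_cases hKJ : K = J
        · exact .inl hKJ
        · exact .inr ⟨hKJ, h⟩
    · rw [List.length_cons, hl, Finset.card_erase_of_mem hJ]; omega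

theorem exists_first_common (c B : List (NonemptyInterval α)) :
    (∀ J ∈ c, J ∉ B) ∨ ∃ c₁ J c₂ D₁ D₂, c = c₁ ++ J :: c₂ ∧ B = D₁ ++ J :: D₂ ∧
      ∀ K ∈ c₁, K ∉ B := by
  induction c with
  | nil => left; simp
  | cons K c ih =>
    by_cases hK : K ∈ B
    · obtain ⟨D₁, D₂, rfl⟩ := List.append_of_mem hK
      exact .inr ⟨[], K, c, D₁, D₂, rfl, rfl, by simp⟩
    · rcases ih with h | ⟨c₁, J, c₂, D₁, D₂, rfl, rfl, h⟩
      · left; simpa [hK] using h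
      · exact .inr ⟨K :: c₁, J, c₂, D₁, D₂, rfl, rfl, by
        rintro L hL
        rcases List.mem_cons.1 hL with rfl | hL
        · exact hK
        · exact h L hL⟩

/-- A chain that misses at most `k` intervals of the solution is not longer than it. -/
theorem NoExchanges.length_le {p : WithBot α} {c : List (NonemptyInterval α)}
    (hB : NoExchanges S k p B) (hBc : ChainFrom p B) (hc : ChainFrom p c) (hcS : ∀ J ∈ c, J ∈ S)
    (hk : ∀ D : List (NonemptyInterval α), D.Sublist B → (∀ J ∈ D, J ∉ c) → D.length ≤ k) :
    c.length ≤ B.length := by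
  induction hn : B.length using Nat.strong_induction_on generalizing B c p with
  | _ n ih =>
  subst hn
  rcases exists_first_common c B with h | ⟨c₁, J, c₂, D₁, D₂, rfl, rfl, hc₁⟩
  · have hBk : B.length ≤ k := hk B (List.Sublist.refl _) (fun J hJ hJc => h J hJc hJ)
    by_contra hlt
    obtain ⟨a, d, b, rfl, ha⟩ := exists_split_at (c := c) (m := B.length) (by omega)
    obtain ⟨J, hJ, -⟩ := hB.noExchange a d (hc.sublist (by simp))
      (fun J hJ => hcS J (by simp at hJ ⊢; tauto)) (by omega)
    rw [List.getElem?_eq_none (by omega)] at hJ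
    simp at hJ
  · rw [chainFrom_append] at hBc hc
    -- The intervals of `D₁` end before `J` and avoid `c₁`, so none of them occurs in the whole
    -- chain.
    have hD₁k : D₁.length ≤ k := by
      refine hk D₁ (by simp) fun K hK hKc => ?_
      rcases List.mem_append.1 hKc with hKc | hKc
      · exact hc₁ K hKc (by simp [hK])
      · have h1 : endFrom p D₁ < J.fst := hBc.2.1
        have h2 := (hBc.1.snd_le_endFrom K hK).trans_lt h1
        rcases List.mem_cons.1 hKc with rfl | hKc
        · exact absurd K.fst_le_snd (not_le.2 (fst_lt_of_before h2))
        · have h3 := hc.2.2.lt_fst K hKc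
          have h4 := (fst_lt_of_before h2).trans_le (J.fst_le_snd)
          exact absurd (h4.trans (fst_lt_of_before h3)) (not_lt.2 K.fst_le_snd)
    have hlen₁ : c₁.length ≤ D₁.length := by
      by_contra hlt
      obtain ⟨a, d, b, rfl, ha⟩ := exists_split_at (c := c₁) (m := D₁.length) (by omega)
      obtain ⟨K, hK, hd⟩ := hB.noExchange a d (hc.1.sublist (by simp))
        (fun J hJ => hcS J (by simp at hJ ⊢; tauto)) (by omega)
      rw [ha, List.getElem?_append_right le_rfl, Nat.sub_self] at hK
      obtain rfl : J = K := by simpa using hK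
      have h1 := (hc.1.snd_le_endFrom d (by simp)).trans_lt hc.2.1
      exact absurd (fst_lt_of_before h1) (not_lt.2 hd)
    -- Behind the common interval `J` the same comparison starts afresh.
    have hlen₂ : c₂.length ≤ D₂.length := by
      refine ih D₂.length (by simp; omega) (B := D₂) (c := c₂) (p := J.snd) ?_ hBc.2.2 hc.2.2
        (fun K hK => hcS K (by simp [hK])) (fun D hD hDc => ?_) rfl
      · exact (noExchanges_cons.1 hB.append_right).2
      · refine hk D (hD.trans (by simp)) fun K hK hKc => ?_
        rcases List.mem_append.1 hKc with hKc | hKc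
        · exact hc₁ K hKc (by simp [hD.subset hK])
        · rcases List.mem_cons.1 hKc with rfl | hKc
          · exact absurd K.fst_le_snd
              (not_le.2 (fst_lt_of_before (hBc.2.2.lt_fst K (hD.subset hK))))
          · exact hDc K hK hKc
    simp; omega

/-- The outcome of a forbidden exchange would be a chain longer than `L` by one that misses only
members of `A`, hence at most `k` intervals of `L`. -/
theorem IsSolution.isKValid {L : List (NonemptyInterval α)}
    (h : IsSolution S k L) : IsKValid k S L.toFinset := by
  have hsub : L.toFinset ⊆ S := fun J hJ => (h.minimal J (by simpa using hJ)).1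
  refine ⟨⟨hsub, h.chain.isIndep, ?_⟩, ?_⟩
  · intro t ht A hA B hB hAt hBt hind
    have hind' := hind
    obtain ⟨c, hc, hm, hl⟩ := IsIndep.exists_chainFrom hind
    have hle := h.noExchanges.length_le h.chain hc (fun J hJ => ?_) ?_
    · have hcard : (L.toFinset \ A ∪ B).card = L.toFinset.card + 1 := by
        rw [Finset.card_union_of_disjoint, Finset.card_sdiff_of_subset hA, hAt, hBt]
        · have := Finset.card_le_card hA
          omega
        · rw [Finset.disjoint_left]
          intro J hJ hJB
          exact (Finset.mem_sdiff.1 (hB hJB)).2 (Finset.mem_sdiff.1 hJ).1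
      have := List.toFinset_card_of_nodup h.chain.nodup
      have hc2 : c.length = L.toFinset.card + 1 := by rw [hl, ← hcard]
      omega
    · have := (hm J).1 hJ
      have h2 : J ∈ L.toFinset \ A ∪ B := by convert this
      rcases Finset.mem_union.1 h2 with h2 | h2
      · exact hsub (Finset.mem_sdiff.1 h2).1
      · exact (Finset.mem_sdiff.1 (hB h2)).1
    · intro D hD hDc
      have hDA : D.toFinset ⊆ A := fun J hJ => by
        by_contra hJA
        have hJ' : J ∈ D := by simpa using hJ
        refine hDc J hJ' ((hm J).2 ?_)
        have : J ∈ L.toFinset \ A ∪ B :=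
          Finset.mem_union_left _ (Finset.mem_sdiff.2 ⟨by simpa using hD.subset hJ', hJA⟩)
        convert this
      have := Finset.card_le_card hDA
      rw [List.toFinset_card_of_nodup (h.chain.nodup.sublist hD)] at this
      omega
  · intro J hJ K hK hJK
    rw [Finset.mem_sdiff] at hJ
    have := (h.minimal K (by simpa using hK)).2 J hJ.1 hJK
    subst this
    exact hJ.2 hK

/-- Every `k + 2` intervals of the competitor use up at least `k + 1` intervals of the solution: the
first `k + 1` reach the start of its (k + 1)-st interval, and the next one ends no earlier than that
interval, by minimality. -/
theorem NoExchanges.mul_length_le {p : WithBot α} {c : List (NonemptyInterval α)}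
    (hB : NoExchanges S k p B) (hmin : AllMinimal S B) (hc : ChainFrom p c)
    (hcS : ∀ J ∈ c, J ∈ S) : (k + 1) * c.length ≤ (k + 2) * B.length := by
  induction hn : B.length using Nat.strong_induction_on generalizing B c p with
  | _ n ih =>
  subst hn
  rcases le_or_gt c.length B.length with hle | hlt
  · exact Nat.mul_le_mul (by omega) hle
  -- The minimum makes the split exist; the gap condition then provides an interval of `B` at that
  -- index, so the minimum is `k`.
  · obtain ⟨a, d, b, rfl, ha⟩ := exists_split_at (c := c) (m := min k B.length) (by omega)
    obtain ⟨J, hJ, hd⟩ := hB.noExchange a d (hc.sublist (by simp))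
      (fun J hJ => hcS J (by simp at hJ ⊢; tauto)) (by omega)
    have haB := (List.getElem?_eq_some_iff.1 hJ).1
    have hak : a.length = k := by omega
    obtain ⟨D₁, J', D₂, rfl, hD₁⟩ := exists_split_at haB
    obtain rfl : J' = J := by
      rw [← hD₁, List.getElem?_append_right le_rfl, Nat.sub_self] at hJ; simpa using hJ
    cases b with
    | nil => simp at hlt; omega
    | cons e b =>
      rw [chainFrom_append] at hc
      have hJm := (hmin J' (by simp)).2
      have hJe : J'.snd ≤ e.snd := snd_le_snd_of_fst_lt hJm (hcS e (by simp))
        (hd.trans_lt (fst_lt_of_before hc.2.2.1))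
      have := ih D₂.length (by simp; omega) (B := D₂) (c := b) (p := J'.snd)
        (noExchanges_cons.1 hB.append_right).2 (fun K hK => hmin K (by simp [hK]))
        (hc.2.2.2.mono (by exact_mod_cast hJe)) (fun K hK => hcS K (by simp [hK])) rfl
      simp only [List.length_append, List.length_cons]
      rw [hD₁, hak]
      nlinarith

theorem IsSolution.isApproxMIS
    {L : List (NonemptyInterval α)} (h : IsSolution S k L) {ε : ℝ} (hε : 1 ≤ ε * (k + 1)) :
    IsApproxMIS ε S L.toFinset := by
  refine ⟨fun J hJ => (h.minimal J (by simpa using hJ)).1, h.chain.isIndep, ?_⟩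
  have hle : (k + 1) * indepNum S ≤ (k + 2) * L.length := by
    classical
    unfold indepNum
    have hmem : ∃ I ∈ S.powerset.filter IsIndep,
        (S.powerset.filter IsIndep).sup Finset.card = I.card :=
      Finset.exists_mem_eq_sup _ ⟨∅, by simp [IsIndep]⟩ _
    obtain ⟨I, hI, hsup⟩ := hmem
    have hI' := Finset.mem_filter.1 hI
    obtain ⟨c, hc, hm, hl⟩ := IsIndep.exists_chainFrom hI'.2
    have := h.noExchanges.mul_length_le h.minimal hc
      (fun J hJ => Finset.mem_powerset.1 hI'.1 ((hm J).1 hJ))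
    rw [hl] at this
    convert this using 2
  rw [List.toFinset_card_of_nodup h.chain.nodup]
  have hle' : ((k : ℝ) + 1) * indepNum S ≤ (k + 2) * L.length := by exact_mod_cast hle
  have hk : (0 : ℝ) < k + 1 := by positivity
  have hL : (0 : ℝ) ≤ L.length := by positivity
  refine le_of_mul_le_mul_left ?_ hk
  nlinarith

end Solutions

/-! ### Balanced search trees of intervals -/

/-- A binary tree of intervals. -/
inductive ITree (α : Type*) [LinearOrder α] where
  | leaf : ITree α
  | node : ITree α → NonemptyInterval α → ITree α → ITree α

/-! ### The lexicographic order and the choice of the next interval. -/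

section Order

variable {α : Type*} [LinearOrder α]

/-- The lexicographic order of intervals. -/
def LexLt (J K : NonemptyInterval α) : Prop := J.fst < K.fst ∨ J.fst = K.fst ∧ J.snd < K.snd

instance : DecidableRel (LexLt (α := α)) := fun _ _ => inferInstanceAs (Decidable (_ ∨ _))

theorem LexLt.trans {J K L : NonemptyInterval α} (h : LexLt J K) (h' : LexLt K L) :
    LexLt J L := by
  unfold LexLt at *
  rcases h with h | ⟨h₁, h₂⟩ <;> rcases h' with h' | ⟨h₁', h₂'⟩
  · exact .inl (h.trans h')
  · exact .inl (h₁' ▸ h)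
  · exact .inl (h₁ ▸ h')
  · exact .inr ⟨h₁.trans h₁', h₂.trans h₂'⟩

theorem LexLt.irrefl (J : NonemptyInterval α) : ¬ LexLt J J := by simp [LexLt]

theorem LexLt.asymm {J K : NonemptyInterval α} (h : LexLt J K) : ¬ LexLt K J :=
  fun h' => LexLt.irrefl _ (h.trans h')

theorem eq_of_not_lexLt {J K : NonemptyInterval α} (h : ¬ LexLt J K) (h' : ¬ LexLt K J) :
    J = K := by
  unfold LexLt at *
  push Not at h h'
  have h₁ := le_antisymm h'.1 h.1
  exact NonemptyInterval.ext (Prod.ext h₁ (le_antisymm (h'.2 h₁.symm) (h.2 h₁)))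

theorem LexLt.fst_le {J K : NonemptyInterval α} (h : LexLt J K) : J.fst ≤ K.fst := by
  rcases h with h | h
  · exact h.le
  · exact h.1.le

theorem lexLt_of_before {J K : NonemptyInterval α} (h : J.snd < K.fst) : LexLt J K :=
  .inl (J.fst_le_snd.trans_lt h)

/-- The better of two candidates for the next interval. -/
def pick : Option (NonemptyInterval α) → Option (NonemptyInterval α) →
    Option (NonemptyInterval α)
  | none, b => b
  | some J, none => some J
  | some J, some K =>
    if K.snd < J.snd then some K else if J.snd < K.snd then some J else
      if J.fst < K.fst then some K else some J

/-- `o` is the interval with property `X` that has the least right end and, among those, the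
greatest left end. -/
def IsBest (X : NonemptyInterval α → Prop) (o : Option (NonemptyInterval α)) : Prop :=
  (o = none ∧ ∀ d, ¬ X d) ∨ ∃ c, o = some c ∧ X c ∧
    ∀ d, X d → c.snd < d.snd ∨ (c.snd = d.snd ∧ d.fst ≤ c.fst)

theorem IsBest.congr {X Y : NonemptyInterval α → Prop} {o : Option (NonemptyInterval α)}
    (h : IsBest X o) (hXY : ∀ d, X d ↔ Y d) : IsBest Y o := by
  have : X = Y := funext fun d => propext (hXY d)
  exact this ▸ h

theorem isBest_singleton (J : NonemptyInterval α) : IsBest (fun d => d = J) (some J) :=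
  .inr ⟨J, rfl, rfl, fun d hd => by subst hd; simp⟩

theorem IsBest.pick {X Y : NonemptyInterval α → Prop} {a b : Option (NonemptyInterval α)}
    (ha : IsBest X a) (hb : IsBest Y b) : IsBest (fun d => X d ∨ Y d) (pick a b) := by
  rcases ha with ⟨rfl, ha⟩ | ⟨J, rfl, hJ, ha⟩
  · exact hb.congr fun d => by simp [ha]
  rcases hb with ⟨rfl, hb⟩ | ⟨K, rfl, hK, hb⟩
  · refine IsBest.congr (.inr ⟨J, rfl, hJ, ha⟩) fun d => by simp [hb]
  have key : ∀ M N : NonemptyInterval α, (M.snd < N.snd ∨ (M.snd = N.snd ∧ N.fst ≤ M.fst)) →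
      ∀ d : NonemptyInterval α, (N.snd < d.snd ∨ (N.snd = d.snd ∧ d.fst ≤ N.fst)) →
      (M.snd < d.snd ∨ (M.snd = d.snd ∧ d.fst ≤ M.fst)) := by
    intro M N h d h'
    rcases h with h | ⟨h₁, h₂⟩ <;> rcases h' with h' | ⟨h₁', h₂'⟩
    · exact .inl (h.trans h')
    · exact .inl (h.trans_eq h₁')
    · exact .inl (h₁.trans_lt h')
    · exact .inr ⟨h₁.trans h₁', h₂'.trans h₂⟩
  have hJ' : (J.snd < K.snd ∨ (J.snd = K.snd ∧ K.fst ≤ J.fst)) →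
      IsBest (fun d => X d ∨ Y d) (some J) := fun h =>
    .inr ⟨J, rfl, .inl hJ, fun d hd => hd.elim (ha d) fun hd => key J K h d (hb d hd)⟩
  have hK' : (K.snd < J.snd ∨ (K.snd = J.snd ∧ J.fst ≤ K.fst)) →
      IsBest (fun d => X d ∨ Y d) (some K) := fun h =>
    .inr ⟨K, rfl, .inr hK, fun d hd => hd.elim (fun hd => key K J h d (ha d hd)) (hb d)⟩
  simp only [_root_.pick]
  split_ifs with h₁ h₂ h₃
  · exact hK' (.inl h₁)
  · exact hJ' (.inl h₂)
  · exact hK' (.inr ⟨le_antisymm (not_lt.1 h₂) (not_lt.1 h₁), h₃.le⟩)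
  · exact hJ' (.inr ⟨le_antisymm (not_lt.1 h₁) (not_lt.1 h₂), not_lt.1 h₃⟩)

end Order

/-! ### AVL trees of intervals. -/

namespace ITree

variable {α : Type*} [LinearOrder α]

/-- The height of a tree. -/
def height : ITree α → ℕ
  | leaf => 0
  | node l _ r => max l.height r.height + 1

/-- The in-order traversal. -/
def toList : ITree α → List (NonemptyInterval α)
  | leaf => []
  | node l J r => l.toList ++ J :: r.toList

/-- The heights of siblings differ by at most one. -/
def Balanced : ITree α → Prop
  | leaf => True
  | node l _ r => l.Balanced ∧ r.Balanced ∧ l.height ≤ r.height + 1 ∧ r.height ≤ l.height + 1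

/-- The interval with the least right end. -/
def best : ITree α → Option (NonemptyInterval α)
  | leaf => none
  | node l J r => pick (some J) (pick l.best r.best)

/-- Rotation at a node whose left subtree is too high. -/
def rotR : ITree α → NonemptyInterval α → ITree α → ITree α
  | node a K leaf, J, r => node a K (node leaf J r)
  | node a K (node c M d), J, r =>
    if a.height < (node c M d).height then node (node a K c) M (node d J r)
    else node a K (node (node c M d) J r)
  | leaf, J, r => node leaf J r

/-- Rotation at a node whose right subtree is too high. -/
def rotL : ITree α → NonemptyInterval α → ITree α → ITree α
  | l, J, node leaf K b => node (node l J leaf) K b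
  | l, J, node (node c M d) K b =>
    if b.height < (node c M d).height then node (node l J c) M (node d K b)
    else node (node l J (node c M d)) K b
  | l, J, leaf => node l J leaf

/-- A node, rebalanced if the heights of its subtrees differ by two. -/
def bal (l : ITree α) (J : NonemptyInterval α) (r : ITree α) : ITree α :=
  if l.height = r.height + 2 then rotR l J r
  else if r.height = l.height + 2 then rotL l J r else node l J r

/-- Insertion. -/
def ins (x : NonemptyInterval α) : ITree α → ITree α
  | leaf => node leaf x leaf
  | node l J r =>
    if LexLt x J then bal (l.ins x) J r else if LexLt J x then bal l J (r.ins x) else node l J r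

/-- The first interval, and the tree of all others. -/
def delMin : ITree α → NonemptyInterval α → ITree α → NonemptyInterval α × ITree α
  | leaf, J, r => (J, r)
  | node l K m, J, r => ((delMin l K m).1, bal (delMin l K m).2 J r)

/-- The union of two adjacent siblings. -/
def glue : ITree α → ITree α → ITree α
  | l, leaf => l
  | l, node a K b => bal l (delMin a K b).1 (delMin a K b).2

/-- Deletion. -/
def del (x : NonemptyInterval α) : ITree α → ITree α
  | leaf => leaf
  | node l J r =>
    if LexLt x J then bal (l.del x) J r else if LexLt J x then bal l J (r.del x) else glue l r

/-- The best interval to the right of `p`. -/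
def next (p : WithBot α) : ITree α → Option (NonemptyInterval α)
  | leaf => none
  | node l J r =>
    if p < (J.fst : WithBot α) then pick (pick (some J) r.best) (l.next p) else r.next p

/-- The last interval that ends before `y`. -/
def pred (y : α) : ITree α → Option (NonemptyInterval α)
  | leaf => none
  | node l J r => if J.snd < y then some ((r.pred y).getD J) else l.pred y

theorem toList_rotR (l : ITree α) (J : NonemptyInterval α) (r : ITree α) :
    (rotR l J r).toList = l.toList ++ J :: r.toList := by
  unfold rotR; split
  · simp [toList]
  · split_ifs <;> simp [toList]
  · rfl

theorem toList_rotL (l : ITree α) (J : NonemptyInterval α) (r : ITree α) :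
    (rotL l J r).toList = l.toList ++ J :: r.toList := by
  unfold rotL; split
  · simp [toList]
  · split_ifs <;> simp [toList]
  · rfl

theorem toList_bal (l : ITree α) (J : NonemptyInterval α) (r : ITree α) :
    (bal l J r).toList = l.toList ++ J :: r.toList := by
  unfold bal; split_ifs
  · exact toList_rotR l J r
  · exact toList_rotL l J r
  · rfl

theorem rotR_spec {l r : ITree α} (J : NonemptyInterval α) (hl : l.Balanced) (hr : r.Balanced)
    (h : l.height = r.height + 2) : (rotR l J r).Balanced ∧
      (rotR l J r).height ≤ l.height + 1 ∧ l.height ≤ (rotR l J r).height := by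
  unfold rotR; split
  · simp only [Balanced, height] at *
    casesm* _ ∧ _
    constructorm* _ ∧ _ <;> first | assumption | trivial | omega
  · split_ifs <;> simp only [Balanced, height] at * <;> casesm* _ ∧ _ <;>
      constructorm* _ ∧ _ <;> first | assumption | omega
  · simp [height] at h

theorem rotL_spec {l r : ITree α} (J : NonemptyInterval α) (hl : l.Balanced) (hr : r.Balanced)
    (h : r.height = l.height + 2) : (rotL l J r).Balanced ∧
      (rotL l J r).height ≤ r.height + 1 ∧ r.height ≤ (rotL l J r).height := by
  unfold rotL; split
  · simp only [Balanced, height] at *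
    casesm* _ ∧ _
    constructorm* _ ∧ _ <;> first | assumption | trivial | omega
  · split_ifs <;> simp only [Balanced, height] at * <;> casesm* _ ∧ _ <;>
      constructorm* _ ∧ _ <;> first | assumption | omega
  · simp [height] at h

/-- The exact height in the last clause covers the case without rotation; with it, updates are seen
to change heights by at most one. -/
theorem bal_spec {l r : ITree α} (J : NonemptyInterval α) (hl : l.Balanced) (hr : r.Balanced)
    (h₁ : l.height ≤ r.height + 2) (h₂ : r.height ≤ l.height + 2) : (bal l J r).Balanced ∧
      (bal l J r).height ≤ max l.height r.height + 1 ∧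
      max l.height r.height ≤ (bal l J r).height ∧
      (l.height ≤ r.height + 1 → r.height ≤ l.height + 1 →
        (bal l J r).height = max l.height r.height + 1) := by
  unfold bal; split_ifs with h h'
  · obtain ⟨h3, h4, h5⟩ := rotR_spec J hl hr h
    exact ⟨h3, by omega, by omega, by omega⟩
  · obtain ⟨h3, h4, h5⟩ := rotL_spec J hl hr h'
    exact ⟨h3, by omega, by omega, by omega⟩
  · exact ⟨⟨hl, hr, by omega, by omega⟩, by simp [height], by simp [height], by simp [height]⟩

theorem ins_spec (x : NonemptyInterval α) {t : ITree α} (h : t.Balanced) :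
    (t.ins x).Balanced ∧ t.height ≤ (t.ins x).height ∧ (t.ins x).height ≤ t.height + 1 := by
  induction t with
  | leaf => simp [ins, Balanced, height]
  | node l J r ihl ihr =>
    obtain ⟨hl, hr, h₁, h₂⟩ := h
    obtain ⟨l1, l2, l3⟩ := ihl hl
    obtain ⟨r1, r2, r3⟩ := ihr hr
    unfold ins; split_ifs
    · obtain ⟨b1, b2, b3, b4⟩ := bal_spec J l1 hr (by omega) (by omega)
      refine ⟨b1, ?_, ?_⟩ <;> simp only [height] <;> omega
    · obtain ⟨b1, b2, b3, b4⟩ := bal_spec J hl r1 (by omega) (by omega)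
      refine ⟨b1, ?_, ?_⟩ <;> simp only [height] <;> omega
    · exact ⟨⟨hl, hr, h₁, h₂⟩, by omega, by omega⟩

theorem delMin_spec {l r : ITree α} {J : NonemptyInterval α} (h : (node l J r).Balanced) :
    (delMin l J r).2.Balanced ∧ (delMin l J r).2.height ≤ (node l J r).height ∧
      (node l J r).height ≤ (delMin l J r).2.height + 1 ∧
      (node l J r).toList = (delMin l J r).1 :: (delMin l J r).2.toList := by
  induction l generalizing J r with
  | leaf => obtain ⟨-, hr, h₁, h₂⟩ := h; simp_all [delMin, height, toList]
  | node l K m ih =>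
    obtain ⟨hl, hr, h₁, h₂⟩ := h
    obtain ⟨d1, d2, d3, d4⟩ := ih hl
    obtain ⟨b1, b2, b3, b4⟩ := bal_spec J d1 hr (by omega) (by omega)
    refine ⟨b1, ?_, ?_, ?_⟩
    · simp only [delMin]; rw [height]; omega
    · simp only [delMin]; rw [height]; omega
    · simp only [delMin]; rw [toList_bal, toList, d4]; simp

theorem glue_spec {l r : ITree α} {J : NonemptyInterval α} (h : (node l J r).Balanced) :
    (glue l r).Balanced ∧ (glue l r).height ≤ (node l J r).height ∧
      (node l J r).height ≤ (glue l r).height + 1 ∧ (glue l r).toList = l.toList ++ r.toList := by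
  obtain ⟨hl, hr, h₁, h₂⟩ := h
  cases r with
  | leaf => simp_all [glue, height, toList]
  | node a K b =>
    obtain ⟨d1, d2, d3, d4⟩ := delMin_spec hr
    obtain ⟨b1, b2, b3, b4⟩ := bal_spec (delMin a K b).1 hl d1 (by omega) (by omega)
    refine ⟨b1, ?_, ?_, ?_⟩
    · simp only [glue]; rw [height]; omega
    · simp only [glue]; rw [height]; omega
    · simp only [glue]; rw [toList_bal, d4]

theorem del_spec (x : NonemptyInterval α) {t : ITree α} (h : t.Balanced) :
    (t.del x).Balanced ∧ (t.del x).height ≤ t.height ∧ t.height ≤ (t.del x).height + 1 := by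
  induction t with
  | leaf => simp [del, Balanced, height]
  | node l J r ihl ihr =>
    have hn := h
    obtain ⟨hl, hr, h₁, h₂⟩ := h
    obtain ⟨l1, l2, l3⟩ := ihl hl
    obtain ⟨r1, r2, r3⟩ := ihr hr
    unfold del; split_ifs
    · obtain ⟨b1, b2, b3, b4⟩ := bal_spec J l1 hr (by omega) (by omega)
      refine ⟨b1, ?_, ?_⟩ <;> simp only [height] <;> omega
    · obtain ⟨b1, b2, b3, b4⟩ := bal_spec J hl r1 (by omega) (by omega)
      refine ⟨b1, ?_, ?_⟩ <;> simp only [height] <;> omega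
    · obtain ⟨g1, g2, g3, -⟩ := glue_spec hn
      exact ⟨g1, g2, g3⟩

theorem pairwise_lexLt_append_cons {l r : List (NonemptyInterval α)} {J : NonemptyInterval α} :
    (l ++ J :: r).Pairwise LexLt ↔ l.Pairwise LexLt ∧ r.Pairwise LexLt ∧
      (∀ K ∈ l, LexLt K J) ∧ ∀ K ∈ r, LexLt J K := by
  rw [List.pairwise_append, List.pairwise_cons]
  constructor
  · rintro ⟨h1, ⟨h2, h3⟩, h4⟩
    exact ⟨h1, h3, fun K hK => h4 K hK J (by simp), h2⟩
  · rintro ⟨h1, h2, h3, h4⟩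
    refine ⟨h1, ⟨h4, h2⟩, fun K hK M hM => ?_⟩
    rcases List.mem_cons.1 hM with rfl | hM
    · exact h3 K hK
    · exact (h3 K hK).trans (h4 M hM)

theorem mem_ins (x : NonemptyInterval α) (t : ITree α) (y : NonemptyInterval α) :
    y ∈ (t.ins x).toList ↔ y = x ∨ y ∈ t.toList := by
  induction t with
  | leaf => simp [ins, toList]
  | node l J r ihl ihr =>
    unfold ins; split_ifs with h h'
    · rw [toList_bal]; simp [toList, ihl, or_assoc]
    · rw [toList_bal]; simp [toList, ihr]; tauto
    · have := eq_of_not_lexLt h h'; subst this; simp [toList]; tauto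

theorem pairwise_ins (x : NonemptyInterval α) {t : ITree α} (h : t.toList.Pairwise LexLt) :
    (t.ins x).toList.Pairwise LexLt := by
  induction t with
  | leaf => simp [ins, toList]
  | node l J r ihl ihr =>
    have h0 := h
    rw [toList, pairwise_lexLt_append_cons] at h
    obtain ⟨h1, h2, h3, h4⟩ := h
    unfold ins; split_ifs with hx hx'
    · rw [toList_bal, pairwise_lexLt_append_cons]
      refine ⟨ihl h1, h2, fun K hK => ?_, h4⟩
      rcases (mem_ins _ _ _).1 hK with rfl | hK
      · exact hx
      · exact h3 K hK
    · rw [toList_bal, pairwise_lexLt_append_cons]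
      refine ⟨h1, ihr h2, h3, fun K hK => ?_⟩
      rcases (mem_ins _ _ _).1 hK with rfl | hK
      · exact hx'
      · exact h4 K hK
    · exact h0

theorem del_toList (x : NonemptyInterval α) {t : ITree α} (hb : t.Balanced)
    (h : t.toList.Pairwise LexLt) :
    (t.del x).toList.Pairwise LexLt ∧ ∀ y, y ∈ (t.del x).toList ↔ y ≠ x ∧ y ∈ t.toList := by
  induction t with
  | leaf => simp [del, toList]
  | node l J r ihl ihr =>
    have h0 := h
    have hb0 := hb
    rw [toList, pairwise_lexLt_append_cons] at h
    obtain ⟨h1, h2, h3, h4⟩ := h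
    obtain ⟨hl, hr, -, -⟩ := hb
    obtain ⟨l1, l2⟩ := ihl hl h1
    obtain ⟨r1, r2⟩ := ihr hr h2
    unfold del; split_ifs with hx hx'
    · rw [toList_bal, pairwise_lexLt_append_cons]
      refine ⟨⟨l1, h2, fun K hK => h3 K ((l2 K).1 hK).2, h4⟩, fun y => ?_⟩
      have hJ : J ≠ x := by rintro rfl; exact LexLt.irrefl _ hx
      have hr' : ∀ y ∈ r.toList, y ≠ x := by
        rintro y hy rfl; exact hx.asymm (h4 _ hy)
      simp only [List.mem_append, List.mem_cons, l2, toList]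
      constructor
      · rintro (h | rfl | h)
        · exact ⟨h.1, .inl h.2⟩
        · exact ⟨hJ, .inr (.inl rfl)⟩
        · exact ⟨hr' y h, .inr (.inr h)⟩
      · tauto
    · rw [toList_bal, pairwise_lexLt_append_cons]
      refine ⟨⟨h1, r1, h3, fun K hK => h4 K ((r2 K).1 hK).2⟩, fun y => ?_⟩
      have hJ : J ≠ x := by rintro rfl; exact LexLt.irrefl _ hx'
      have hl' : ∀ y ∈ l.toList, y ≠ x := by
        rintro y hy rfl; exact hx'.asymm (h3 _ hy)
      simp only [List.mem_append, List.mem_cons, r2, toList]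
      constructor
      · rintro (h | rfl | h)
        · exact ⟨hl' y h, .inl h⟩
        · exact ⟨hJ, .inr (.inl rfl)⟩
        · exact ⟨h.1, .inr (.inr h.2)⟩
      · tauto
    · obtain rfl := eq_of_not_lexLt hx hx'
      rw [(glue_spec hb0).2.2.2]
      refine ⟨h0.sublist (by simp [toList]), fun y => ?_⟩
      have hl' : ∀ y ∈ l.toList, y ≠ x := by
        rintro y hy rfl; exact LexLt.irrefl _ (h3 _ hy)
      have hr' : ∀ y ∈ r.toList, y ≠ x := by
        rintro y hy rfl; exact LexLt.irrefl _ (h4 _ hy)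
      simp only [List.mem_append, List.mem_cons, toList]
      constructor
      · rintro (h | h)
        · exact ⟨hl' y h, .inl h⟩
        · exact ⟨hr' y h, .inr (.inr h)⟩
      · tauto

/-- The tree `t` is a balanced search tree for the set `X`. -/
structure Represents (t : ITree α) (X : Finset (NonemptyInterval α)) : Prop where
  balanced : t.Balanced
  sorted : t.toList.Pairwise LexLt
  mem : ∀ y, y ∈ t.toList ↔ y ∈ X

theorem represents_leaf : (leaf : ITree α).Represents ∅ :=
  ⟨trivial, .nil, by simp [toList]⟩

theorem Represents.ins {t : ITree α} {X : Finset (NonemptyInterval α)} (h : t.Represents X)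
    (x : NonemptyInterval α) : (t.ins x).Represents (insert x X) :=
  ⟨(ins_spec x h.balanced).1, pairwise_ins x h.sorted, fun y => by
    rw [mem_ins, Finset.mem_insert, h.mem]⟩

theorem Represents.del {t : ITree α} {X : Finset (NonemptyInterval α)} (h : t.Represents X)
    (x : NonemptyInterval α) : (t.del x).Represents (X.erase x) :=
  ⟨(del_spec x h.balanced).1, (del_toList x h.balanced h.sorted).1, fun y => by
    rw [(del_toList x h.balanced h.sorted).2, Finset.mem_erase, h.mem]⟩

theorem best_spec (t : ITree α) : IsBest (fun d => d ∈ t.toList) t.best := by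
  induction t with
  | leaf => exact .inl ⟨rfl, by simp [toList]⟩
  | node l J r ihl ihr =>
    refine ((isBest_singleton J).pick (ihl.pick ihr)).congr fun d => ?_
    simp only [toList, List.mem_append, List.mem_cons]; tauto

/-- Left ends increase along the tree. If the root starts after `p`, so does its whole right
subtree, whose best interval is known, and only the left subtree is searched; otherwise the root and
the left subtree are excluded. -/
theorem next_spec {t : ITree α} (h : t.toList.Pairwise LexLt) (p : WithBot α) :
    IsBest (fun d => d ∈ t.toList ∧ p < (d.fst : WithBot α)) (t.next p) := by
  induction t with
  | leaf => exact .inl ⟨rfl, by simp [toList]⟩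
  | node l J r ihl ihr =>
    rw [toList, pairwise_lexLt_append_cons] at h
    obtain ⟨h1, h2, h3, h4⟩ := h
    unfold next; split_ifs with hp
    · refine ((((isBest_singleton J).pick r.best_spec)).pick (ihl h1)).congr fun d => ?_
      have hr : d ∈ r.toList → p < (d.fst : WithBot α) := fun hd =>
        hp.trans_le (by exact_mod_cast (h4 d hd).fst_le)
      have hJ : d = J → p < (d.fst : WithBot α) := fun hd => hd ▸ hp
      simp only [toList, List.mem_append, List.mem_cons]; tauto
    · refine (ihr h2).congr fun d => ?_
      have hl : d ∈ l.toList → ¬ p < (d.fst : WithBot α) := fun hd hpd =>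
        hp (hpd.trans_le (by exact_mod_cast (h3 d hd).fst_le))
      have hJ : d = J → ¬ p < (d.fst : WithBot α) := fun hd => hd ▸ hp
      simp only [toList, List.mem_append, List.mem_cons]; tauto

theorem Represents.next_eq_some {t : ITree α} {X : Finset (NonemptyInterval α)}
    (h : t.Represents X) {p : WithBot α} {c : NonemptyInterval α} (hc : t.next p = some c) :
    IsNext X p c := by
  rcases next_spec h.sorted p with ⟨h', -⟩ | ⟨d, h', ⟨hd, hp⟩, hbest⟩
  · simp [hc] at h'
  · obtain rfl := Option.some.inj (hc.symm.trans h')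
    exact ⟨(h.mem c).1 hd, hp, fun e he hpe => hbest e ⟨(h.mem e).2 he, hpe⟩⟩

theorem Represents.next_eq_none {t : ITree α} {X : Finset (NonemptyInterval α)}
    (h : t.Represents X) {p : WithBot α} (hc : t.next p = none) :
    ∀ d ∈ X, ¬ p < (d.fst : WithBot α) := by
  rcases next_spec h.sorted p with ⟨-, h'⟩ | ⟨d, h', -⟩
  · exact fun d hd hp => h' d ⟨(h.mem d).2 hd, hp⟩
  · simp [hc] at h'

/-- Disjointness orders the right ends as well, so one search path suffices. -/
theorem pred_spec {t : ITree α} (h : t.toList.Pairwise (fun J K => J.snd < K.fst)) (y : α) :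
    (t.pred y = none ∧ ∀ J ∈ t.toList, y ≤ J.snd) ∨
      ∃ J L₁ L₂, t.pred y = some J ∧ t.toList = L₁ ++ J :: L₂ ∧ J.snd < y ∧
        ∀ K ∈ L₂, y ≤ K.snd := by
  induction t with
  | leaf => exact .inl ⟨rfl, by simp [toList]⟩
  | node l J r ihl ihr =>
    rw [toList, List.pairwise_append, List.pairwise_cons] at h
    obtain ⟨h1, ⟨h2, h3⟩, h4⟩ := h
    unfold pred; split_ifs with hy
    · right
      rcases ihr h3 with ⟨hn, hr⟩ | ⟨K, L₁, L₂, hK, hL, hKy, hr⟩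
      · exact ⟨J, l.toList, r.toList, by simp [hn], rfl, hy, hr⟩
      · exact ⟨K, l.toList ++ J :: L₁, L₂, by simp [hK], by simp [toList, hL], hKy, hr⟩
    · have hge : ∀ K ∈ J :: r.toList, y ≤ K.snd := by
        intro K hK
        rcases List.mem_cons.1 hK with rfl | hK
        · exact not_lt.1 hy
        · exact (not_lt.1 hy).trans ((h2 K hK).le.trans K.fst_le_snd)
      rcases ihl h1 with ⟨hn, hl⟩ | ⟨K, L₁, L₂, hK, hL, hKy, hl⟩
      · refine .inl ⟨hn, fun K hK => ?_⟩
        rcases List.mem_append.1 hK with hK | hK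
        · exact hl K hK
        · exact hge K hK
      · refine .inr ⟨K, L₁, L₂ ++ J :: r.toList, hK, by simp [toList, hL], hKy, fun M hM => ?_⟩
        rcases List.mem_append.1 hM with hM | hM
        · exact hl M hM
        · exact hge M hM

theorem Represents.toList_eq {t : ITree α} {L : List (NonemptyInterval α)} {p : WithBot α}
    (h : t.Represents L.toFinset) (hL : ChainFrom p L) : t.toList = L := by
  have hs : L.Pairwise LexLt := hL.pairwise.imp lexLt_of_before
  have hn : t.toList.Nodup := h.sorted.imp (fun {J K} hJK => by
    rintro rfl; exact LexLt.irrefl _ hJK)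
  have hp : t.toList.Perm L := (List.perm_ext_iff_of_nodup hn hL.nodup).2
    fun y => by rw [h.mem, List.mem_toFinset]
  exact hp.eq_of_pairwise (fun J K _ _ h h' => absurd h' h.asymm) h.sorted hs

/-- A logarithmic height bound without Fibonacci numbers: the square on the right absorbs the
imbalance. -/
theorem two_pow_height_le {t : ITree α} (h : t.Balanced) :
    2 ^ t.height ≤ (t.toList.length + 1) ^ 2 := by
  induction t with
  | leaf => simp [height, toList]
  | node l J r ihl ihr =>
    obtain ⟨hl, hr, h₁, h₂⟩ := h
    have hl' := ihl hl
    have hr' := ihr hr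
    -- Here `a` and `b` count the intervals in the higher and in the lower subtree. Expanding the
    -- square of (a + 1) + (b + 1) gives at least 2 + 1 + 2 times 2 ^ m, and 4 times is needed.
    have key : ∀ (m a b : ℕ) , 2 ^ (m + 1) ≤ (a + 1) ^ 2 → 2 ^ m ≤ (b + 1) ^ 2 →
        2 ^ (m + 1 + 1) ≤ (a + b + 1 + 1) ^ 2 := by
      intro m a b ha hb
      have hab : 2 ^ m ≤ (a + 1) * (b + 1) := by
        have h1 : (2 ^ m) ^ 2 ≤ ((a + 1) * (b + 1)) ^ 2 := by
          rw [mul_pow, sq]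
          exact Nat.mul_le_mul ((Nat.pow_le_pow_right two_pos (by omega)).trans ha) hb
        exact (Nat.pow_le_pow_iff_left two_ne_zero).1 h1
      have e1 : 2 ^ (m + 1) = 2 * 2 ^ m := by ring
      have e2 : 2 ^ (m + 1 + 1) = 4 * 2 ^ m := by ring
      rw [e1] at ha; rw [e2]
      nlinarith
    have mono : ∀ m h a : ℕ, m ≤ h → 2 ^ h ≤ a → 2 ^ m ≤ a := fun m h a hm ha =>
      (Nat.pow_le_pow_right two_pos hm).trans ha
    have hlen : (node l J r).toList.length + 1 = l.toList.length + r.toList.length + 1 + 1 := by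
      simp [toList]; omega
    rw [hlen, height]
    rcases le_total r.height l.height with hle | hle
    · rw [max_eq_left hle]
      obtain ⟨m, hm⟩ | h0 : (∃ m, l.height = m + 1) ∨ l.height = 0 := by
        cases l.height <;> simp
      · rw [hm] at hl' ⊢
        exact key m _ _ hl' (mono _ _ _ (by omega) hr')
      · rw [h0, zero_add, pow_one]
        nlinarith [Nat.zero_le (l.toList.length + r.toList.length)]
    · rw [max_eq_right hle]
      obtain ⟨m, hm⟩ | h0 : (∃ m, r.height = m + 1) ∨ r.height = 0 := by
        cases r.height <;> simp
      · rw [hm] at hr' ⊢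
        rw [add_comm l.toList.length]
        exact key m _ _ hr' (mono _ _ _ (by omega) hl')
      · rw [h0, zero_add, pow_one]
        nlinarith [Nat.zero_le (l.toList.length + r.toList.length)]

theorem Represents.two_pow_height_le {t : ITree α} {X : Finset (NonemptyInterval α)}
    (h : t.Represents X) : 2 ^ t.height ≤ (X.card + 1) ^ 2 := by
  have hn : t.toList.Nodup := h.sorted.imp (fun {J K} hJK => by
    rintro rfl; exact LexLt.irrefl _ hJK)
  have hX : X = t.toList.toFinset := by ext y; rw [List.mem_toFinset, h.mem]
  rw [hX, List.toFinset_card_of_nodup hn]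
  exact ITree.two_pow_height_le h.balanced

end ITree

/-! ### Reasoning about programs -/

section Programs

variable {α : Type*}

/-- Truth of a datum as a condition of a branch. -/
def Val.IsCons : Val α → Prop
  | .cons _ _ => True
  | _ => False

@[simp] theorem Val.isCons_ofProp (p : Prop) [Decidable p] :
    (Val.ofProp p : Val α).IsCons ↔ p := by
  unfold Val.ofProp; split_ifs with h <;> simp [Val.IsCons, h]

@[simp] theorem Val.isCons_cons (u v : Val α) : (Val.cons u v).IsCons := trivial

@[simp] theorem Val.isCons_nil : ¬ (Val.nil : Val α).IsCons := id

variable [LinearOrder α]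

/-- Subroutine `f` maps `u` to `v` in at most `c` steps. -/
def Computes (defs : List Code) (f : ℕ) (u v : Val α) (c : ℕ) : Prop :=
  ∃ n ≤ c, Runs defs [u] (defs.getD f .nil) v n

/-- Weakest preconditions: the code terminates with a value and a bound for the number of steps
that satisfy `Q`. -/
def Wp (defs : List Code) : Code → List (Val α) → (Val α → ℕ → Prop) → Prop
  | .var i, env, Q => Q (env.getD i .nil) 1
  | .nil, _, Q => Q .nil 1
  | .cons a b, env, Q => Wp defs a env fun u m => Wp defs b env fun v n => Q (.cons u v) (m + n + 1)
  | .fst a, env, Q => Wp defs a env fun u m => Q u.fst (m + 1)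
  | .snd a, env, Q => Wp defs a env fun u m => Q u.snd (m + 1)
  | .lt a b, env, Q => Wp defs a env fun u m => Wp defs b env fun v n => Q (u.lt v) (m + n + 1)
  | .ite a b c, env, Q => Wp defs a env fun u m =>
      (u.IsCons → Wp defs b env fun v n => Q v (m + n + 1)) ∧
      (¬ u.IsCons → Wp defs c env fun v n => Q v (m + n + 1))
  | .bind a b, env, Q => Wp defs a env fun u m => Wp defs b (u :: env) fun v n => Q v (m + n + 1)
  | .call f a, env, Q => Wp defs a env fun u m => ∃ v n, Computes defs f u v n ∧ Q v (m + n + 1)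

/-- The number passed to `Q` is only an upper bound for the true time, since calls enter through
`Computes`, which bounds their time from above. -/
theorem Wp.sound {defs : List Code} {e : Code} {env : List (Val α)} {Q : Val α → ℕ → Prop}
    (h : Wp defs e env Q) : ∃ v n c, Runs defs env e v n ∧ n ≤ c ∧ Q v c := by
  induction e generalizing env Q with
  | var i => exact ⟨_, _, _, .var i, le_rfl, h⟩
  | nil => exact ⟨_, _, _, .nil, le_rfl, h⟩
  | cons a b iha ihb =>
    obtain ⟨u, m, m', hu, hm, h⟩ := iha h
    obtain ⟨v, n, n', hv, hn, h⟩ := ihb h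
    exact ⟨_, _, _, .cons hu hv, by omega, h⟩
  | fst a iha =>
    obtain ⟨u, m, m', hu, hm, h⟩ := iha h
    exact ⟨_, _, _, .fst hu, by omega, h⟩
  | snd a iha =>
    obtain ⟨u, m, m', hu, hm, h⟩ := iha h
    exact ⟨_, _, _, .snd hu, by omega, h⟩
  | lt a b iha ihb =>
    obtain ⟨u, m, m', hu, hm, h⟩ := iha h
    obtain ⟨v, n, n', hv, hn, h⟩ := ihb h
    exact ⟨_, _, _, .lt hu hv, by omega, h⟩
  | ite a b c iha ihb ihc =>
    obtain ⟨u, m, m', hu, hm, h⟩ := iha h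
    cases u with
    | nil =>
      obtain ⟨v, n, n', hv, hn, h⟩ := ihc (h.2 id)
      exact ⟨_, _, _, .iteNil hu hv, by omega, h⟩
    | key x =>
      obtain ⟨v, n, n', hv, hn, h⟩ := ihc (h.2 id)
      exact ⟨_, _, _, .iteKey hu hv, by omega, h⟩
    | cons u₁ u₂ =>
      obtain ⟨v, n, n', hv, hn, h⟩ := ihb (h.1 trivial)
      exact ⟨_, _, _, .iteCons hu hv, by omega, h⟩
  | bind a b iha ihb =>
    obtain ⟨u, m, m', hu, hm, h⟩ := iha h
    obtain ⟨v, n, n', hv, hn, h⟩ := ihb h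
    exact ⟨_, _, _, .bind hu hv, by omega, h⟩
  | call f a iha =>
    obtain ⟨u, m, m', hu, hm, v, n', ⟨n, hn, hv⟩, h⟩ := iha h
    exact ⟨_, _, _, .call hu hv, by omega, h⟩

theorem Wp.mono {defs : List Code} {e : Code} {env : List (Val α)} {Q Q' : Val α → ℕ → Prop}
    (h : Wp defs e env Q) (hQ : ∀ v n, Q v n → Q' v n) : Wp defs e env Q' := by
  induction e generalizing env Q Q' with
  | var | nil => exact hQ _ _ h
  | cons a b iha ihb => exact iha h fun u m h => ihb h fun v n => hQ _ _
  | fst a iha => exact iha h fun u m => hQ _ _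
  | snd a iha => exact iha h fun u m => hQ _ _
  | lt a b iha ihb => exact iha h fun u m h => ihb h fun v n => hQ _ _
  | ite a b c iha ihb ihc =>
    exact iha h fun u m h => ⟨fun hu => ihb (h.1 hu) fun v n => hQ _ _,
      fun hu => ihc (h.2 hu) fun v n => hQ _ _⟩
  | bind a b iha ihb => exact iha h fun u m h => ihb h fun v n => hQ _ _
  | call f a iha => exact iha h fun u m ⟨v, n, hv, h⟩ => ⟨v, n, hv, hQ _ _ h⟩

/-- The value is `w`, and the number of steps is at most `c`. -/
def Result (w : Val α) (c : ℕ) (v : Val α) (n : ℕ) : Prop := v = w ∧ n ≤ c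

theorem Wp.computes {defs : List Code} {f c : ℕ} {u w : Val α}
    (h : Wp defs (defs.getD f .nil) [u] (Result w c)) : Computes defs f u w c := by
  obtain ⟨v, n, m, hr, hn, rfl, hm⟩ := h.sound
  exact ⟨n, hn.trans hm, hr⟩

theorem Computes.mono {defs : List Code} {f c c' : ℕ} {u v : Val α} (h : Computes defs f u v c)
    (hc : c ≤ c') : Computes defs f u v c' := by
  obtain ⟨n, hn, hr⟩ := h
  exact ⟨n, hn.trans hc, hr⟩

/-- A constant in unary. -/
def Code.num : ℕ → Code
  | 0 => .nil
  | n + 1 => .cons .nil (num n)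

theorem wp_num (defs : List Code) (n : ℕ) (env : List (Val α)) (Q : Val α → ℕ → Prop) :
    Wp defs (Code.num n) env Q ↔ Q (Val.unary n) (2 * n + 1) := by
  induction n generalizing Q with
  | zero => rfl
  | succ n ih =>
    simp only [Code.num, Wp, ih, Val.unary]
    rw [show 1 + (2 * n + 1) + 1 = 2 * (n + 1) + 1 by ring]

end Programs

/-! ### The program -/

namespace IntervalProgram

/-- Selection of the better candidate. -/
def pickCode : Code :=
  .ite (.fst (.var 0))
    (.ite (.snd (.var 0))
      (.ite (.lt (.snd (.snd (.var 0))) (.snd (.fst (.var 0)))) (.snd (.var 0))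
        (.ite (.lt (.snd (.fst (.var 0))) (.snd (.snd (.var 0)))) (.fst (.var 0))
          (.ite (.lt (.fst (.fst (.var 0))) (.fst (.snd (.var 0)))) (.snd (.var 0))
            (.fst (.var 0)))))
      (.fst (.var 0)))
    (.snd (.var 0))

/-- Lexicographic comparison. -/
def lexCode : Code :=
  .ite (.lt (.fst (.fst (.var 0))) (.fst (.snd (.var 0)))) (.num 1)
    (.ite (.lt (.fst (.snd (.var 0))) (.fst (.fst (.var 0)))) .nil
      (.lt (.snd (.fst (.var 0))) (.snd (.snd (.var 0)))))

/-- The interval of a node. -/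
def keyOf (t : Code) : Code := .fst (.fst t)

/-- The skewness of a node. -/
def skewOf (t : Code) : Code := .fst (.snd (.fst t))

/-- The parity of the height of a tree. -/
def parityOf (t : Code) : Code := .fst (.snd (.snd (.fst t)))

/-- The best interval of a tree. -/
def bestOf (t : Code) : Code := .snd (.snd (.snd (.fst t)))

/-- The left subtree of a node. -/
def leftOf (t : Code) : Code := .fst (.snd t)

/-- The right subtree of a node. -/
def rightOf (t : Code) : Code := .snd (.snd t)

/-- Comparison of the parities of the heights of two trees. -/
def differCode : Code :=
  .ite (parityOf (.fst (.var 0)))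
    (.ite (parityOf (.snd (.var 0))) .nil (.num 1))
    (parityOf (.snd (.var 0)))

/-- The code of the four arguments of a node: skewness, left subtree, interval, right subtree. -/
def quad (s l x r : Code) : Code := .cons s (.cons l (.cons x r))

/-- The construction of a node. -/
def nodeCode : Code :=
  .bind (.fst (.snd (.var 0)))
    (.bind (.snd (.snd (.snd (.var 1))))
      (.cons
        (.cons (.fst (.snd (.snd (.var 2))))
          (.cons (.fst (.var 2))
            (.cons
              (.ite (.ite (.snd (.fst (.var 2))) (parityOf (.var 1)) (parityOf (.var 0)))
                .nil (.num 1))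
              (.call 0 (.cons (.fst (.snd (.snd (.var 2))))
                (.call 0 (.cons (bestOf (.var 1)) (bestOf (.var 0)))))))))
        (.cons (.var 1) (.var 0))))

/-- A right rotation of the node with left subtree `var 2`, interval `var 1`, right subtree
`var 0`. -/
def rotRCode : Code :=
  .ite (.snd (skewOf (.var 2)))
    (.ite (.snd (.snd (skewOf (.var 2))))
      (.call 3 (quad (.num 2) (leftOf (.var 2)) (keyOf (.var 2))
        (.call 3 (quad (.num 2) (rightOf (.var 2)) (.var 1) (.var 0)))))
      (.call 3 (quad (.num 1) (leftOf (.var 2)) (keyOf (.var 2))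
        (.call 3 (quad (.num 3) (rightOf (.var 2)) (.var 1) (.var 0))))))
    (.bind (rightOf (.var 2))
      (.call 3 (quad (.num 2)
        (.call 3 (quad (.ite (.snd (skewOf (.var 0))) (.num 2) (.num 3))
          (leftOf (.var 3)) (keyOf (.var 3)) (leftOf (.var 0))))
        (keyOf (.var 0))
        (.call 3 (quad (.ite (.snd (.snd (skewOf (.var 0)))) (.num 1) (.num 2))
          (rightOf (.var 0)) (.var 2) (.var 1))))))

/-- A left rotation of the node with left subtree `var 2`, interval `var 1`, right subtree
`var 0`. -/
def rotLCode : Code :=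
  .ite (.snd (.snd (skewOf (.var 0))))
    (.bind (leftOf (.var 0))
      (.call 3 (quad (.num 2)
        (.call 3 (quad (.ite (.snd (skewOf (.var 0))) (.num 2) (.num 3))
          (.var 3) (.var 2) (leftOf (.var 0))))
        (keyOf (.var 0))
        (.call 3 (quad (.ite (.snd (.snd (skewOf (.var 0)))) (.num 1) (.num 2))
          (rightOf (.var 0)) (keyOf (.var 1)) (rightOf (.var 1)))))))
    (.ite (.snd (skewOf (.var 0)))
      (.call 3 (quad (.num 3)
        (.call 3 (quad (.num 1) (.var 2) (.var 1) (leftOf (.var 0))))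
        (keyOf (.var 0)) (rightOf (.var 0))))
      (.call 3 (quad (.num 2)
        (.call 3 (quad (.num 2) (.var 2) (.var 1) (leftOf (.var 0))))
        (keyOf (.var 0)) (rightOf (.var 0)))))

/-- The construction of a node with rebalancing. -/
def balCode : Code :=
  .ite (.fst (.var 0))
    (.ite (.snd (.snd (.snd (.fst (.var 0)))))
      (.bind (.fst (.snd (.var 0)))
        (.bind (.fst (.snd (.snd (.var 1)))) (.bind (.snd (.snd (.snd (.var 2)))) rotRCode)))
      (.call 3 (.var 0)))
    (.bind (.fst (.snd (.var 0)))
      (.bind (.fst (.snd (.snd (.var 1)))) (.bind (.snd (.snd (.snd (.var 2)))) rotLCode)))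

/-- Insertion of `fst (var 0)` into the tree `snd (var 0)`. -/
def insCode : Code :=
  .bind (.snd (.var 0)) (.bind (.fst (.var 1))
    (.ite (.var 1)
      (.ite (.call 1 (.cons (.var 0) (keyOf (.var 1))))
        (.bind (.call 5 (.cons (.var 0) (leftOf (.var 1))))
          (.call 4 (quad
            (.ite (.call 2 (.cons (leftOf (.var 2)) (.var 0)))
              (.cons .nil (skewOf (.var 2))) (skewOf (.var 2)))
            (.var 0) (keyOf (.var 2)) (rightOf (.var 2)))))
        (.ite (.call 1 (.cons (keyOf (.var 1)) (.var 0)))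
          (.bind (.call 5 (.cons (.var 0) (rightOf (.var 1))))
            (.call 4 (quad
              (.ite (.call 2 (.cons (rightOf (.var 2)) (.var 0)))
                (.snd (skewOf (.var 2))) (skewOf (.var 2)))
              (leftOf (.var 2)) (keyOf (.var 2)) (.var 0))))
          (.var 1)))
      (.call 3 (quad (.num 2) .nil (.var 0) .nil))))

/-- Removal of the first interval of the nonempty tree `var 0`. -/
def delMinCode : Code :=
  .ite (leftOf (.var 0))
    (.bind (.call 6 (leftOf (.var 0)))
      (.cons (.fst (.var 0))
        (.call 4 (quad
          (.ite (.call 2 (.cons (leftOf (.var 1)) (.snd (.var 0))))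
            (.snd (skewOf (.var 1))) (skewOf (.var 1)))
          (.snd (.var 0)) (keyOf (.var 1)) (rightOf (.var 1))))))
    (.cons (keyOf (.var 0)) (rightOf (.var 0)))

/-- Deletion of `fst (var 0)` from the tree `snd (var 0)`. -/
def delCode : Code :=
  .bind (.snd (.var 0)) (.bind (.fst (.var 1))
    (.ite (.var 1)
      (.ite (.call 1 (.cons (.var 0) (keyOf (.var 1))))
        (.bind (.call 7 (.cons (.var 0) (leftOf (.var 1))))
          (.call 4 (quad
            (.ite (.call 2 (.cons (leftOf (.var 2)) (.var 0)))
              (.snd (skewOf (.var 2))) (skewOf (.var 2)))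
            (.var 0) (keyOf (.var 2)) (rightOf (.var 2)))))
        (.ite (.call 1 (.cons (keyOf (.var 1)) (.var 0)))
          (.bind (.call 7 (.cons (.var 0) (rightOf (.var 1))))
            (.call 4 (quad
              (.ite (.call 2 (.cons (rightOf (.var 2)) (.var 0)))
                (.cons .nil (skewOf (.var 2))) (skewOf (.var 2)))
              (leftOf (.var 2)) (keyOf (.var 2)) (.var 0))))
          (.ite (rightOf (.var 1))
            (.bind (.call 6 (rightOf (.var 1)))
              (.call 4 (quad
                (.ite (.call 2 (.cons (rightOf (.var 2)) (.snd (.var 0))))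
                  (.cons .nil (skewOf (.var 2))) (skewOf (.var 2)))
                (leftOf (.var 2)) (.fst (.var 0)) (.snd (.var 0)))))
            (leftOf (.var 1)))))
      .nil))

/-- The next interval after the point `fst (var 0)` in the tree `snd (var 0)`. -/
def nextCode : Code :=
  .bind (.snd (.var 0)) (.bind (.fst (.var 1))
    (.ite (.var 1)
      (.ite (.ite (.var 0) (.lt (.fst (.var 0)) (.fst (keyOf (.var 1)))) (.num 1))
        (.call 0 (.cons (.call 0 (.cons (keyOf (.var 1)) (bestOf (rightOf (.var 1)))))
          (.call 8 (.cons (.var 0) (leftOf (.var 1))))))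
        (.call 8 (.cons (.var 0) (rightOf (.var 1)))))
      .nil))

/-- The last interval of the tree `snd (var 0)` that ends before the key `fst (var 0)`. -/
def predCode : Code :=
  .bind (.snd (.var 0)) (.bind (.fst (.var 1))
    (.ite (.var 1)
      (.ite (.lt (.snd (keyOf (.var 1))) (.var 0))
        (.bind (.call 9 (.cons (.var 0) (rightOf (.var 1))))
          (.ite (.var 0) (.var 0) (keyOf (.var 2))))
        (.call 9 (.cons (.var 0) (leftOf (.var 1)))))
      .nil))

/-- The point some intervals before a key. -/
def startCode : Code :=
  .bind (.call 9 (.snd (.var 0)))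
    (.ite (.var 0)
      (.ite (.fst (.var 1))
        (.call 10 (.cons (.snd (.fst (.var 1))) (.cons (.fst (.var 0)) (.snd (.snd (.var 1))))))
        (.cons (.snd (.var 0)) .nil))
      .nil)

/-- The greedy search for an exchange, and its execution. -/
def exchangeCode : Code :=
  .ite (.fst (.var 0))
    (.bind (.call 8 (.cons (.fst (.snd (.var 0))) (.fst (.snd (.snd (.snd (.var 0)))))))
      (.ite (.var 0)
        (.bind (.call 8 (.cons (.fst (.snd (.snd (.var 1)))) (.snd (.snd (.snd (.snd (.var 1)))))))
          (.ite (.var 0)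
            (.ite (.lt (.snd (.var 1)) (.fst (.var 0)))
              (.cons (.call 5 (.cons (.var 1) (.snd (.snd (.snd (.snd (.var 2))))))) .nil)
              (.bind (.call 11 (.cons (.snd (.fst (.var 2)))
                  (.cons (.cons (.snd (.var 1)) .nil) (.cons (.cons (.snd (.var 0)) .nil)
                    (.snd (.snd (.snd (.var 2))))))))
                (.ite (.var 0)
                  (.cons (.call 5 (.cons (.var 2) (.call 7 (.cons (.var 1) (.fst (.var 0)))))) .nil)
                  .nil)))
            (.cons (.call 5 (.cons (.var 1) (.snd (.snd (.snd (.snd (.var 2))))))) .nil)))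
        .nil))
    .nil

/-- One attempt to improve the solution. -/
def improveCode : Code :=
  .bind (.call 11 (.cons (.fst (.var 0)) (.cons (.fst (.snd (.var 0))) (.snd (.var 0)))))
    (.ite (.var 0) (.fst (.var 0)) (.snd (.snd (.snd (.var 1)))))

/-- The removal of the interval of the tree `snd (var 0)` that contains `fst (var 0)`. -/
def removeCode : Code :=
  .bind (.call 8 (.cons (.call 10 (.cons .nil (.cons (.fst (.fst (.var 0))) (.snd (.var 0)))))
      (.snd (.var 0))))
    (.ite (.var 0)
      (.ite (.lt (.fst (.fst (.var 1))) (.fst (.var 0))) (.snd (.var 1))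
        (.ite (.lt (.snd (.var 0)) (.snd (.fst (.var 1)))) (.snd (.var 1))
          (.call 7 (.cons (.var 0) (.snd (.var 1))))))
      (.snd (.var 1)))

/-- The repair of the solution after a change of the set. -/
def repairCode : Code :=
  .bind (.call 15 (.cons (.fst (.var 0)) (.fst (.snd (.snd (.var 0))))))
  (.bind (.call 10 (.cons (.fst (.snd (.snd (.snd (.var 1)))))
      (.cons (.fst (.fst (.var 1))) (.var 0))))
  (.cons
    (.call 12 (.cons (.snd (.snd (.snd (.snd (.var 2)))))
      (.cons (.var 0) (.cons (.fst (.snd (.var 2)))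
        (.call 12 (.cons (.snd (.snd (.snd (.snd (.var 2)))))
          (.cons (.var 0) (.cons (.fst (.snd (.var 2)))
            (.call 12 (.cons (.snd (.snd (.snd (.snd (.var 2)))))
              (.cons (.var 0) (.cons (.fst (.snd (.var 2))) (.var 1)))))))))))))
    (.cons (.fst (.snd (.var 2))) (.snd (.snd (.snd (.var 2)))))))

/-- The number `2 * k + 3`. -/
def budgetCode : Code :=
  .ite (.var 0) (.cons .nil (.cons .nil (.call 14 (.snd (.var 0))))) (.num 3)

/-- All subroutines. -/
def prog : List Code :=
  [pickCode, lexCode, differCode, nodeCode, balCode, insCode, delMinCode, delCode, nextCode,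
    predCode, startCode, exchangeCode, improveCode, repairCode, budgetCode,
    removeCode]

/-- The algorithm. The memory consists of the solution, the set of all intervals, the parameter,
and the bound for the length of a greedy search. -/
def alg : DynAlg where
  defs := prog
  init := .cons .nil (.cons .nil (.cons (.var 0) (.call 14 (.var 0))))
  ins := .call 13 (.cons (.var 0) (.cons (.call 5 (.cons (.var 0) (.fst (.snd (.var 1)))))
    (.cons (.fst (.var 1)) (.snd (.snd (.var 1))))))
  del := .call 13 (.cons (.var 0) (.cons (.call 7 (.cons (.var 0) (.fst (.snd (.var 1)))))
    (.cons (.fst (.var 1)) (.snd (.snd (.var 1))))))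

end IntervalProgram

/-! ### The encoding of optional intervals, points and trees as data. -/

namespace Val

variable {α : Type*}

@[simp] theorem fst_cons (u v : Val α) : (cons u v).fst = u := rfl

@[simp] theorem snd_cons (u v : Val α) : (cons u v).snd = v := rfl

@[simp] theorem fst_nil : (nil : Val α).fst = nil := rfl

@[simp] theorem snd_nil : (nil : Val α).snd = nil := rfl

@[simp] theorem isCons_unary_succ (n : ℕ) : (unary (n + 1) : Val α).IsCons := trivial

@[simp] theorem unary_zero : (unary 0 : Val α) = nil := rfl

@[simp] theorem snd_unary_succ (n : ℕ) : (unary (n + 1) : Val α).snd = unary n := rfl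

theorem snd_unary (n : ℕ) : (unary n : Val α).snd = unary (n - 1) := by
  cases n <;> rfl

variable [LinearOrder α]

/-- An optional interval as a datum. -/
def ofOption : Option (NonemptyInterval α) → Val α
  | none => nil
  | some J => interval J

/-- A point or `-∞` as a datum. -/
def ofPoint : WithBot α → Val α
  | ⊥ => nil
  | (a : α) => cons (key a) nil

/-- A tree as a datum. Every node carries the difference of the heights of its subtrees, the parity
of its height, and its best interval. -/
def ofTree : ITree α → Val α
  | .leaf => nil
  | .node l J r => cons
      (cons (interval J) (cons (unary (l.height + 2 - r.height))
        (cons (ofProp ((ITree.node l J r).height % 2 = 1)) (ofOption (ITree.node l J r).best))))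
      (cons (ofTree l) (ofTree r))

/-- An optional tree as a datum. -/
def ofOptionTree : Option (ITree α) → Val α
  | none => nil
  | some t => cons (ofTree t) nil

theorem ofTree_parity (t : ITree α) :
    (ofTree t).fst.snd.snd.fst = ofProp (t.height % 2 = 1) := by
  cases t with
  | leaf => simp [ofTree, fst, snd, ofProp, ITree.height]
  | node => simp [ofTree, fst, snd]

theorem ofTree_best (t : ITree α) : (ofTree t).fst.snd.snd.snd = ofOption t.best := by
  cases t with
  | leaf => simp [ofTree, fst, snd, ofOption, ITree.best]
  | node => simp [ofTree, fst, snd]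

@[simp] theorem lt_key (a b : α) : (key a).lt (key b) = ofProp (a < b) := rfl

@[simp] theorem isCons_ofTree_node (l r : ITree α) (J : NonemptyInterval α) :
    (ofTree (.node l J r)).IsCons := trivial

@[simp] theorem isCons_interval (J : NonemptyInterval α) : (interval J).IsCons := trivial

@[simp] theorem interval_fst (J : NonemptyInterval α) : (interval J).fst = key J.fst := rfl

@[simp] theorem interval_snd (J : NonemptyInterval α) : (interval J).snd = key J.snd := rfl

end Val

/-! ### Correctness and time of nodes, rotations and rebalancing. -/

namespace IntervalProgram

open Val

variable {α : Type*} [LinearOrder α]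

theorem computes_pick (a b : Option (NonemptyInterval α)) :
    Computes prog 0 (cons (ofOption a) (ofOption b)) (ofOption (pick a b)) 50 := by
  refine Wp.computes ?_
  show Wp prog pickCode _ _
  cases a with
  | none => simp [pickCode, Result, Wp, fst_cons, snd_cons, ofOption, pick]
  | some J => cases b with
    | none => simp [pickCode, Result, Wp, fst_cons, snd_cons, ofOption, pick, interval]
    | some K =>
      simp [pickCode, Result, Wp, fst_cons, snd_cons, ofOption, pick, interval, lt_key]
      refine ⟨fun h => ?_, fun h => ⟨fun h' => ?_, fun h' => ⟨fun h'' => ?_, fun h'' => ?_⟩⟩⟩ <;>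
        simp [*, not_lt.2]

theorem computes_lex (J K : NonemptyInterval α) :
    Computes prog 1 (cons (interval J) (interval K)) (ofProp (LexLt J K)) 40 := by
  refine Wp.computes ?_
  show Wp prog lexCode _ _
  simp [lexCode, Result, Wp, wp_num, fst_cons, snd_cons, interval, lt_key]
  refine ⟨fun h => ?_, fun h => ⟨fun h' => ?_, fun h' => ?_⟩⟩
  · simp [LexLt, h, ofProp, unary]
  · have : ¬ LexLt J K := by
      rintro (h1 | h1)
      · exact absurd h1 (not_lt.2 h)
      · exact absurd h1.1 h'.ne'
    simp [ofProp, this]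
  · have := le_antisymm h h'
    simp [LexLt, this]

/-- When `s` and `t` are a tree before and after an update, their heights differ by at most one, and
this test decides in constant time whether the height has changed. -/
theorem computes_differ (s t : ITree α) : Computes prog 2 (cons (ofTree s) (ofTree t))
    (ofProp (s.height % 2 ≠ t.height % 2)) 40 := by
  refine Wp.computes ?_
  show Wp prog differCode _ _
  rcases Nat.mod_two_eq_zero_or_one s.height with h | h <;>
    rcases Nat.mod_two_eq_zero_or_one t.height with h' | h' <;>
      simp [differCode, Result, parityOf, Wp, wp_num, ofTree_parity, h, h', ofProp, unary]

/-- The skewness is `2` plus the height difference. It tells which subtree is the higher one, and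
the parity of the new height is the opposite of that subtree's parity. -/
theorem computes_node {l r : ITree α} (J : NonemptyInterval α) {β : ℕ}
    (hβ : β + r.height = l.height + 2) (h₁ : 1 ≤ β) (h₂ : β ≤ 3) :
    Computes prog 3 (cons (unary β) (cons (ofTree l) (cons (interval J) (ofTree r))))
      (ofTree (.node l J r)) 250 := by
  refine Wp.computes ?_
  show Wp prog nodeCode _ _
  have hs : l.height + 2 - r.height = β := by omega
  have hl : (ITree.node l J r).height = max l.height r.height + 1 := rfl
  obtain rfl | rfl | rfl : β = 1 ∨ β = 2 ∨ β = 3 := by omega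
  all_goals
    simp [nodeCode, Result, parityOf, bestOf, Wp, wp_num, ofTree_parity, ofTree_best]
    refine ⟨fun hp => ⟨_, _, computes_pick _ _, _, _, computes_pick (some J) _, ?_, by omega⟩,
      fun hp => ⟨_, _, computes_pick _ _, _, _, computes_pick (some J) _, ?_, by omega⟩⟩
    all_goals
      simp [ofTree, hs, hl, ITree.best, unary, ofProp]
      omega

theorem ofTree_node (l r : ITree α) (J : NonemptyInterval α) : ofTree (.node l J r) = cons
    (cons (interval J) (cons (unary (l.height + 2 - r.height))
        (cons (ofProp ((ITree.node l J r).height % 2 = 1)) (ofOption (ITree.node l J r).best))))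
      (cons (ofTree l) (ofTree r)) := rfl

theorem wp_rotR {l r : ITree α} (J : NonemptyInterval α) (hl : l.Balanced)
    (h : l.height = r.height + 2) (env : List (Val α)) (w : Val α)
    (hw : ofTree (ITree.rotR l J r) = w) :
    Wp prog rotRCode (ofTree r :: interval J :: ofTree l :: env) (Result w 900) := by
  unfold ITree.rotR at hw; split at hw
  · next a K =>
    simp only [ITree.Balanced, ITree.height] at hl h
    have hs : a.height + 2 - (ITree.leaf : ITree α).height = 3 := by
      simp only [ITree.height]; omega
    simp [rotRCode, quad, skewOf, leftOf, rightOf, keyOf, Wp, wp_num, ofTree_node, hs]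
    refine ⟨_, _, computes_node J ?_ ?_ ?_, _, _, computes_node K ?_ ?_ ?_, hw, ?_⟩ <;>
      (try simp only [ITree.height]) <;> omega
  · next a K c M d =>
    simp only [ITree.Balanced, ITree.height] at hl h
    split_ifs at hw with hlt
    · simp only [ITree.height] at hlt
      have hs : a.height + 2 - (ITree.node c M d).height = 1 := by
        simp only [ITree.height]; omega
      have hs' : c.height + 2 - d.height = 1 ∨ c.height + 2 - d.height = 2 ∨
          c.height + 2 - d.height = 3 := by omega
      rcases hs' with hs' | hs' | hs' <;>
      · simp [rotRCode, quad, skewOf, leftOf, rightOf, keyOf, Wp, wp_num, ofTree_node, hs, hs']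
        refine ⟨_, _, computes_node K ?_ ?_ ?_, _, _, computes_node J ?_ ?_ ?_,
          _, _, computes_node M ?_ ?_ ?_, hw, ?_⟩ <;>
        (try simp only [ITree.height]) <;> omega
    · simp only [ITree.height] at hlt
      have hs : a.height + 2 - (ITree.node c M d).height = 2 ∨
          a.height + 2 - (ITree.node c M d).height = 3 := by
        simp only [ITree.height]; omega
      rcases hs with hs | hs <;>
      · have hs2 := hs
        simp only [ITree.height] at hs2
        rw [ofTree_node a]
        simp [rotRCode, quad, skewOf, leftOf, rightOf, keyOf, Wp, wp_num, hs]
        refine ⟨_, _, computes_node J ?_ ?_ ?_, _, _, computes_node K ?_ ?_ ?_, hw, ?_⟩ <;>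
        (try simp only [ITree.height]) <;> omega
  · simp [ITree.height] at h

theorem wp_rotL {l r : ITree α} (J : NonemptyInterval α) (hr : r.Balanced)
    (h : r.height = l.height + 2) (env : List (Val α)) (w : Val α)
    (hw : ofTree (ITree.rotL l J r) = w) :
    Wp prog rotLCode (ofTree r :: interval J :: ofTree l :: env) (Result w 900) := by
  unfold ITree.rotL at hw; split at hw
  · next K b =>
    simp only [ITree.Balanced, ITree.height] at hr h
    have hs : (ITree.leaf : ITree α).height + 2 - b.height = 1 := by
      simp only [ITree.height]; omega
    simp [rotLCode, quad, skewOf, leftOf, rightOf, keyOf, Wp, wp_num, ofTree_node, hs]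
    refine ⟨_, _, computes_node J ?_ ?_ ?_, _, _, computes_node K ?_ ?_ ?_, hw, ?_⟩ <;>
      (try simp only [ITree.height]) <;> omega
  · next c M d K b =>
    simp only [ITree.Balanced, ITree.height] at hr h
    split_ifs at hw with hlt
    · simp only [ITree.height] at hlt
      have hs : (ITree.node c M d).height + 2 - b.height = 3 := by
        simp only [ITree.height]; omega
      have hs' : c.height + 2 - d.height = 1 ∨ c.height + 2 - d.height = 2 ∨
          c.height + 2 - d.height = 3 := by omega
      rcases hs' with hs' | hs' | hs' <;>
      · simp [rotLCode, quad, skewOf, leftOf, rightOf, keyOf, Wp, wp_num, ofTree_node, hs, hs']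
        refine ⟨_, _, computes_node J ?_ ?_ ?_, _, _, computes_node K ?_ ?_ ?_,
          _, _, computes_node M ?_ ?_ ?_, hw, ?_⟩ <;>
        (try simp only [ITree.height]) <;> omega
    · simp only [ITree.height] at hlt
      have hs : (ITree.node c M d).height + 2 - b.height = 1 ∨
          (ITree.node c M d).height + 2 - b.height = 2 := by
        simp only [ITree.height]; omega
      rcases hs with hs | hs <;>
      · have hs2 := hs
        simp only [ITree.height] at hs2
        rw [ofTree_node _ b]
        simp [rotLCode, quad, skewOf, leftOf, rightOf, keyOf, Wp, wp_num, hs]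
        refine ⟨_, _, computes_node J ?_ ?_ ?_, _, _, computes_node K ?_ ?_ ?_, hw, ?_⟩ <;>
        (try simp only [ITree.height]) <;> omega
  · simp [ITree.height] at h

/-- Skewness `0` and `4` are the two cases that need a rotation; `1`, `2` and `3` are balanced. -/
theorem computes_bal {l r : ITree α} (J : NonemptyInterval α) (hl : l.Balanced) (hr : r.Balanced)
    {β : ℕ} (hβ : β + r.height = l.height + 2) (h₂ : β ≤ 4) :
    Computes prog 4 (cons (unary β) (cons (ofTree l) (cons (interval J) (ofTree r))))
      (ofTree (ITree.bal l J r)) 1000 := by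
  refine Wp.computes ?_
  show Wp prog balCode _ _
  -- The target value becomes opaque, so that simplifying the program leaves it alone; its cases are
  -- then resolved in `hw`.
  generalize hw : ofTree (ITree.bal l J r) = w
  unfold ITree.bal at hw
  obtain rfl | rfl | rfl | rfl | rfl : β = 0 ∨ β = 1 ∨ β = 2 ∨ β = 3 ∨ β = 4 := by omega
  · rw [if_neg (by omega), if_pos (by omega)] at hw
    simp [balCode, Wp]
    refine (wp_rotL J hr (by omega) _ w hw).mono fun v m hv => ⟨hv.1, ?_⟩
    have := hv.2
    omega
  · rw [if_neg (by omega), if_neg (by omega)] at hw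
    simp [balCode, Wp]
    exact ⟨_, _, computes_node (β := 1) J (by omega) (by omega) (by omega), hw, by omega⟩
  · rw [if_neg (by omega), if_neg (by omega)] at hw
    simp [balCode, Wp]
    exact ⟨_, _, computes_node (β := 2) J (by omega) (by omega) (by omega), hw, by omega⟩
  · rw [if_neg (by omega), if_neg (by omega)] at hw
    simp [balCode, Wp]
    exact ⟨_, _, computes_node (β := 3) J (by omega) (by omega) (by omega), hw, by omega⟩
  · rw [if_pos (by omega)] at hw
    simp [balCode, Wp]
    refine (wp_rotR J hl (by omega) _ w hw).mono fun v m hv => ⟨hv.1, ?_⟩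
    have := hv.2
    omega

end IntervalProgram

/-! ### Correctness and time of the tree operations. -/

namespace IntervalProgram

open Val

variable {α : Type*} [LinearOrder α]

theorem computes_ins (x : NonemptyInterval α) {t : ITree α} (ht : t.Balanced) :
    Computes prog 5 (cons (interval x) (ofTree t)) (ofTree (t.ins x)) (2000 * (t.height + 1)) := by
  induction t with
  | leaf =>
    refine Wp.computes ?_
    show Wp prog insCode _ _
    generalize hw : ofTree (ITree.ins x .leaf) = w
    simp [insCode, quad, Wp, wp_num, ofTree]
    exact ⟨_, _, computes_node (l := .leaf) (r := .leaf) (β := 2) x rfl (by omega) (by omega),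
      hw, by omega⟩
  | node l J r ihl ihr =>
    obtain ⟨hl, hr, h₁, h₂⟩ := ht
    obtain ⟨l1, l2, l3⟩ := ITree.ins_spec x hl
    obtain ⟨r1, r2, r3⟩ := ITree.ins_spec x hr
    refine Wp.computes ?_
    show Wp prog insCode _ _
    generalize hw : ofTree (ITree.ins x (.node l J r)) = w
    unfold ITree.ins at hw
    have hn : (ITree.node l J r).height = max l.height r.height + 1 := rfl
    rw [ofTree_node] at *
    simp [insCode, quad, keyOf, skewOf, leftOf, rightOf, Wp]
    refine ⟨_, _, computes_lex _ _, ?_, ?_⟩ <;> rw [isCons_ofProp] <;> intro h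
    · rw [if_pos h] at hw
      -- Insertion raises the height of the left subtree by at most one, so a change of parity means
      -- that the skewness grows by exactly one.
      refine ⟨_, _, ihl hl, _, _, computes_differ _ _, ?_, ?_⟩ <;> rw [isCons_ofProp] <;> intro h'
      · refine ⟨_, _, computes_bal J l1 hr (β := l.height + 2 - r.height + 1) ?_ ?_, hw, ?_⟩ <;>
          omega
      · refine ⟨_, _, computes_bal J l1 hr (β := l.height + 2 - r.height) ?_ ?_, hw, ?_⟩ <;>
          omega
    · rw [if_neg h] at hw
      refine ⟨_, _, computes_lex _ _, ?_, ?_⟩ <;> rw [isCons_ofProp] <;> intro h'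
      · rw [if_pos h'] at hw
        refine ⟨_, _, ihr hr, _, _, computes_differ _ _, ?_, ?_⟩ <;> rw [isCons_ofProp] <;>
          intro h'
        · rw [snd_unary]
          refine ⟨_, _, computes_bal J hl r1 (β := l.height + 2 - r.height - 1) ?_ ?_, hw, ?_⟩ <;>
            omega
        · refine ⟨_, _, computes_bal J hl r1 (β := l.height + 2 - r.height) ?_ ?_, hw, ?_⟩ <;>
            omega
      · rw [if_neg h'] at hw
        exact ⟨hw, by omega⟩

theorem computes_delMin {l r : ITree α} {J : NonemptyInterval α}
    (ht : (ITree.node l J r).Balanced) :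
    Computes prog 6 (ofTree (.node l J r))
      (cons (interval (ITree.delMin l J r).1) (ofTree (ITree.delMin l J r).2))
      (2000 * ((ITree.node l J r).height + 1)) := by
  induction l generalizing J r with
  | leaf =>
    refine Wp.computes ?_
    show Wp prog delMinCode _ _
    simp [delMinCode, keyOf, leftOf, rightOf, Wp, ofTree_node, ITree.delMin]
    simp [ofTree, Result]
    omega
  | node a K b ih =>
    obtain ⟨hl, hr, h₁, h₂⟩ := ht
    obtain ⟨d1, d2, d3, -⟩ := ITree.delMin_spec hl
    refine Wp.computes ?_
    show Wp prog delMinCode _ _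
    generalize hw : ofTree (ITree.delMin (.node a K b) J r).2 = w
    have hn : (ITree.node (.node a K b) J r).height =
      max (ITree.node a K b).height r.height + 1 := rfl
    rw [ofTree_node (.node a K b)]
    simp [delMinCode, quad, keyOf, skewOf, leftOf, rightOf, Wp]
    refine ⟨_, _, ih hl, ?_⟩
    simp
    refine ⟨_, _, computes_differ _ _, ?_, ?_⟩ <;> rw [isCons_ofProp] <;> intro h'
    · rw [snd_unary]
      refine ⟨_, _, computes_bal J d1 hr (β := (ITree.node a K b).height + 2 - r.height - 1)
        ?_ ?_, congrArg _ hw, ?_⟩ <;> omega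
    · refine ⟨_, _, computes_bal J d1 hr (β := (ITree.node a K b).height + 2 - r.height)
        ?_ ?_, congrArg _ hw, ?_⟩ <;> omega

theorem computes_del (x : NonemptyInterval α) {t : ITree α} (ht : t.Balanced) :
    Computes prog 7 (cons (interval x) (ofTree t)) (ofTree (t.del x)) (4000 * (t.height + 1)) := by
  induction t with
  | leaf =>
    refine Wp.computes ?_
    show Wp prog delCode _ _
    simp [delCode, Wp, ofTree, ITree.del, Result, ITree.height]
  | node l J r ihl ihr =>
    obtain ⟨hl, hr, h₁, h₂⟩ := ht
    obtain ⟨l1, l2, l3⟩ := ITree.del_spec x hl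
    obtain ⟨r1, r2, r3⟩ := ITree.del_spec x hr
    refine Wp.computes ?_
    show Wp prog delCode _ _
    generalize hw : ofTree (ITree.del x (.node l J r)) = w
    unfold ITree.del at hw
    have hn : (ITree.node l J r).height = max l.height r.height + 1 := rfl
    rw [ofTree_node] at *
    simp [delCode, quad, keyOf, skewOf, leftOf, rightOf, Wp]
    refine ⟨_, _, computes_lex _ _, ?_, ?_⟩ <;> rw [isCons_ofProp] <;> intro h
    · rw [if_pos h] at hw
      refine ⟨_, _, ihl hl, _, _, computes_differ _ _, ?_, ?_⟩ <;> rw [isCons_ofProp] <;> intro h'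
      · rw [snd_unary]
        refine ⟨_, _, computes_bal J l1 hr (β := l.height + 2 - r.height - 1) ?_ ?_, hw, ?_⟩ <;>
          omega
      · refine ⟨_, _, computes_bal J l1 hr (β := l.height + 2 - r.height) ?_ ?_, hw, ?_⟩ <;>
          omega
    · rw [if_neg h] at hw
      refine ⟨_, _, computes_lex _ _, ?_, ?_⟩ <;> rw [isCons_ofProp] <;> intro h'
      · rw [if_pos h'] at hw
        refine ⟨_, _, ihr hr, _, _, computes_differ _ _, ?_, ?_⟩ <;> rw [isCons_ofProp] <;>
          intro h'
        · refine ⟨_, _, computes_bal J hl r1 (β := l.height + 2 - r.height + 1) ?_ ?_, hw, ?_⟩ <;>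
            omega
        · refine ⟨_, _, computes_bal J hl r1 (β := l.height + 2 - r.height) ?_ ?_, hw, ?_⟩ <;>
            omega
      · rw [if_neg h'] at hw
        cases r with
        | leaf =>
          simp [ofTree]
          exact ⟨hw, by omega⟩
        | node a K b =>
          obtain ⟨d1, d2, d3, -⟩ := ITree.delMin_spec hr
          simp
          refine ⟨_, _, computes_delMin hr, ?_⟩
          simp
          refine ⟨_, _, computes_differ _ _, ?_, ?_⟩ <;> rw [isCons_ofProp] <;> intro h'
          · refine ⟨_, _, computes_bal _ hl d1
              (β := l.height + 2 - (ITree.node a K b).height + 1) ?_ ?_, hw, ?_⟩ <;> omega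
          · refine ⟨_, _, computes_bal _ hl d1
              (β := l.height + 2 - (ITree.node a K b).height) ?_ ?_, hw, ?_⟩ <;> omega

/-- Each level costs one recursive call and constant work, because the best interval of the right
subtree is stored at its root. -/
theorem computes_next (p : WithBot α) (t : ITree α) :
    Computes prog 8 (cons (ofPoint p) (ofTree t)) (ofOption (t.next p))
      (500 * (t.height + 1)) := by
  induction t with
  | leaf =>
    refine Wp.computes ?_
    show Wp prog nextCode _ _
    simp [nextCode, Wp, ofTree, ITree.next, Result, ITree.height, ofOption]
  | node l J r ihl ihr =>
    refine Wp.computes ?_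
    show Wp prog nextCode _ _
    generalize hw : ofOption (ITree.next p (.node l J r)) = w
    unfold ITree.next at hw
    have hn : (ITree.node l J r).height = max l.height r.height + 1 := rfl
    rw [ofTree_node] at *
    cases p with
    | bot =>
      rw [if_pos (WithBot.bot_lt_coe _)] at hw
      simp [nextCode, keyOf, bestOf, leftOf, rightOf, Wp, wp_num, ofPoint, ofTree_best]
      exact ⟨_, _, computes_pick (some J) _, _, _, ihl, _, _, computes_pick _ _, hw, by omega⟩
    | coe a =>
      simp [nextCode, keyOf, bestOf, leftOf, rightOf, Wp, wp_num, ofPoint, ofTree_best]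
      refine ⟨fun h => ?_, fun h => ?_⟩
      · rw [if_pos (by exact_mod_cast h)] at hw
        exact ⟨_, _, computes_pick (some J) _, _, _, ihl, _, _, computes_pick _ _, hw, by omega⟩
      · rw [if_neg (by exact_mod_cast not_lt.2 h)] at hw
        exact ⟨_, _, ihr, hw, by omega⟩

theorem computes_pred (y : α) (t : ITree α) :
    Computes prog 9 (cons (key y) (ofTree t)) (ofOption (t.pred y)) (500 * (t.height + 1)) := by
  induction t with
  | leaf =>
    refine Wp.computes ?_
    show Wp prog predCode _ _
    simp [predCode, Wp, ofTree, ITree.pred, Result, ITree.height, ofOption]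
  | node l J r ihl ihr =>
    refine Wp.computes ?_
    show Wp prog predCode _ _
    generalize hw : ofOption (ITree.pred y (.node l J r)) = w
    unfold ITree.pred at hw
    have hn : (ITree.node l J r).height = max l.height r.height + 1 := rfl
    rw [ofTree_node] at *
    simp [predCode, keyOf, leftOf, rightOf, Wp]
    refine ⟨fun h => ⟨_, _, ihr, ?_⟩, fun h => ?_⟩
    · rw [if_pos h] at hw
      cases hK : r.pred y with
      | none =>
        rw [hK] at hw
        simp [ofOption]
        exact ⟨hw, by omega⟩
      | some K =>
        rw [hK] at hw
        simp [ofOption]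
        exact ⟨hw, by omega⟩
    · rw [if_neg (not_lt.2 h)] at hw
      exact ⟨_, _, ihl, hw, by omega⟩

/-- The end of the interval that precedes the last `n` intervals that end before `y`. -/
def startPoint (t : ITree α) : ℕ → α → WithBot α
  | 0, y => match t.pred y with
    | none => ⊥
    | some J => J.snd
  | n + 1, y => match t.pred y with
    | none => ⊥
    | some J => startPoint t n J.fst

theorem computes_start (t : ITree α) (n : ℕ) (y : α) :
    Computes prog 10 (cons (unary n) (cons (key y) (ofTree t))) (ofPoint (startPoint t n y))
      ((n + 1) * (600 * (t.height + 1))) := by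
  induction n generalizing y with
  | zero =>
    refine Wp.computes ?_
    show Wp prog startCode _ _
    simp [startCode, Wp]
    refine ⟨_, _, computes_pred _ _, ?_⟩
    unfold startPoint
    cases t.pred y with
    | none => simp [ofOption, ofPoint, Result]; omega
    | some J => simp [ofOption, ofPoint, Result]; omega
  | succ n ih =>
    refine Wp.computes ?_
    show Wp prog startCode _ _
    simp [startCode, Wp]
    refine ⟨_, _, computes_pred _ _, ?_⟩
    unfold startPoint
    have hmul : (n + 1 + 1) * (600 * (t.height + 1)) =
      (n + 1) * (600 * (t.height + 1)) + 600 * (t.height + 1) := by ring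
    rw [hmul]
    cases t.pred y with
    | none => simp [ofOption, ofPoint, Result]; omega
    | some J =>
      simp [ofOption]
      exact ⟨_, _, ih J.fst, rfl, by omega⟩

end IntervalProgram

/-! ### The greedy search for an exchange, on trees. -/

namespace ITree

variable {α : Type*} [LinearOrder α]

/-- The greedy search for an exchange, and its execution: `p` is the end of the greedy chain, and
`q` is the end of the last interval to be removed. -/
def exchange (S I : ITree α) : ℕ → WithBot α → WithBot α → Option (ITree α)
  | 0, _, _ => none
  | n + 1, p, q =>
    match S.next p with
    | none => none
    | some c =>
      match I.next q with
      | none => some (I.ins c)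
      | some J =>
        if c.snd < J.fst then some (I.ins c)
        else (exchange S I n c.snd J.snd).map fun t => (t.del J).ins c

/-- One attempt to improve the solution. -/
def improve (S I : ITree α) (n : ℕ) (p : WithBot α) : ITree α := (exchange S I n p p).getD I

/-- Among disjoint intervals the least right end belongs to the leftmost one, so the query that
serves the set also steps through the solution. -/
theorem next_eq_head {t : ITree α} {A B : List (NonemptyInterval α)}
    (ht : t.Represents (A ++ B).toFinset) (hc : ChainFrom ⊥ (A ++ B)) :
    t.next (endFrom ⊥ A) = B.head? := by
  rw [chainFrom_append] at hc
  have hmem : ∀ d, d ∈ (A ++ B).toFinset → endFrom ⊥ A < (d.fst : WithBot α) → d ∈ B := by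
    intro d hd hlt
    rcases List.mem_append.1 (List.mem_toFinset.1 hd) with hd | hd
    · have := lt_of_le_of_lt (hc.1.snd_le_endFrom d hd) hlt
      exact absurd d.fst_le_snd (not_le.2 (fst_lt_of_before this))
    · exact hd
  cases h : t.next (endFrom ⊥ A) with
  | none =>
    cases B with
    | nil => rfl
    | cons J B => exact absurd hc.2.1 (ht.next_eq_none h J (by simp))
  | some c =>
    have hn := ht.next_eq_some h
    have hcB := hmem c hn.1 hn.2.1
    cases B with
    | nil => simp at hcB
    | cons J B =>
      rcases List.mem_cons.1 hcB with rfl | hcB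
      · rfl
      · have h1 := hn.snd_le (d := J) (by simp) hc.2.1
        have h2 := fst_lt_of_before (hc.2.2.lt_fst c hcB)
        exact absurd (h2.trans_le c.fst_le_snd) (not_lt.2 h1)

/-- The start `p` of the greedy chain and the end of `A` must be independent: they coincide only at
the beginning, and afterwards both move right. A failing search proves optimality because greedy
stays ahead. -/
theorem exchange_spec {S : Finset (NonemptyInterval α)} {s t : ITree α} (hs : s.Represents S)
    {n : ℕ} {p : WithBot α} {A B : List (NonemptyInterval α)}
    (ht : t.Represents (A ++ B).toFinset) (hc : ChainFrom ⊥ (A ++ B)) :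
    match exchange s t n p (endFrom ⊥ A) with
    | none => ∀ m < n, NoExchange S m p B
    | some t' => ∃ g R, Exchange S p B g R ∧ t'.Represents (A ++ (g ++ R)).toFinset := by
  induction n generalizing p A B with
  | zero => simp [exchange]
  | succ n ih =>
    have hcB := (chainFrom_append.1 hc).2
    have hIns : ∀ c, (t.ins c).Represents (A ++ ([c] ++ B)).toFinset := fun c => by
      convert ht.ins c using 1
      ext y; simp
    unfold exchange
    rw [next_eq_head ht hc]
    cases h : s.next p with
    | none =>
      intro m hm c d hcd hS hk
      cases c with
      | nil => exact absurd hcd.1 (hs.next_eq_none h d (hS d (by simp)))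
      | cons e c => exact absurd hcd.1 (hs.next_eq_none h e (hS e (by simp)))
    | some c =>
      have hn := hs.next_eq_some h
      cases B with
      | nil => exact ⟨[c], [], .base hn trivial, hIns c⟩
      | cons J B =>
        simp only [List.head?_cons]
        split_ifs with hlt
        · exact ⟨[c], J :: B, .base hn ⟨by exact_mod_cast hlt, hcB.2⟩, hIns c⟩
        · have hJc := not_lt.1 hlt
          have hAJ : A ++ J :: B = (A ++ [J]) ++ B := by simp
          rw [hAJ] at ht hc
          have hend : endFrom ⊥ (A ++ [J]) = J.snd := by rw [endFrom_append]; rfl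
          have := ih (p := c.snd) ht hc
          rw [hend] at this
          cases hE : exchange s t n c.snd J.snd with
          | none =>
            rw [hE] at this
            intro m hm a d had hS hk
            cases a with
            | nil => exact ⟨J, rfl, hJc.trans (hn.snd_le (hS d (by simp)) had.1)⟩
            | cons e a =>
              have he := hn.snd_le (hS e (by simp)) had.1
              simp only [List.length_cons] at hk
              obtain ⟨K, hK, hd⟩ := this (m - 1) (by omega) a d
                (had.2.mono (by exact_mod_cast he))
                (fun K hK => hS K (by simp at hK ⊢; tauto)) (by omega)
              exact ⟨K, by simpa using hK, hd⟩
          | some t' =>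
            rw [hE] at this
            obtain ⟨g, R, hg, ht'⟩ := this
            refine ⟨c :: g, R, .step hn hJc hg, ?_⟩
            -- The inner exchange is carried out first and leaves `J` in the tree. Deleting `J` then
            -- hits no new interval, and since `c` is inserted last, `c` may equal `J`.
            have hJg : J ∉ g ++ R := fun hJ =>
              absurd (fst_lt_of_before (hg.chainFrom.lt_fst J hJ)) (not_lt.2 hJc)
            have hJA : J ∉ A := fun hJ => by
              have := hc.nodup
              simp [List.nodup_append] at this
              exact (this.2.2 J hJ).1 rfl
            convert (ht'.del J).ins c using 1
            ext y
            simp only [List.mem_toFinset, Finset.mem_insert, Finset.mem_erase, List.mem_append,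
              List.mem_cons, List.not_mem_nil, or_false] at hJg ⊢
            constructor
            · rintro (h | (h | h) | h)
              · exact .inr ⟨by rintro rfl; exact hJA h, by tauto⟩
              · exact .inl h
              · exact .inr ⟨by rintro rfl; exact hJg (.inl h), by tauto⟩
              · exact .inr ⟨by rintro rfl; exact hJg (.inr h), by tauto⟩
            · tauto

theorem improve_spec {S : Finset (NonemptyInterval α)} {s t : ITree α} (hs : s.Represents S)
    {n : ℕ} {A B : List (NonemptyInterval α)}
    (ht : t.Represents (A ++ B).toFinset) (hc : ChainFrom ⊥ (A ++ B)) :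
    ∃ B', Improves S n (endFrom ⊥ A) B B' ∧
      (improve s t (n + 1) (endFrom ⊥ A)).Represents (A ++ B').toFinset := by
  have := exchange_spec hs (n := n + 1) (p := endFrom ⊥ A) ht hc
  unfold improve
  cases h : exchange s t (n + 1) (endFrom ⊥ A) (endFrom ⊥ A) with
  | none => rw [h] at this; exact ⟨B, .inl ⟨rfl, this n (by omega)⟩, ht⟩
  | some t' =>
    rw [h] at this
    obtain ⟨g, R, hg, ht'⟩ := this
    exact ⟨_, .inr ⟨g, R, hg, rfl⟩, ht'⟩

end ITree

/-! ### The start of the search, and the repair after an update. -/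

namespace IntervalProgram

open Val

variable {α : Type*} [LinearOrder α]

/-- The position of `x` in the solution is found by separate searches; this identifies the
splittings they produce. -/
theorem append_eq_append_of_forall {β : Type*} {P : β → Prop} {U V U' V' : List β}
    (h : U ++ V = U' ++ V') (hU : ∀ y ∈ U, P y) (hV : ∀ y ∈ V, ¬ P y) (hU' : ∀ y ∈ U', P y)
    (hV' : ∀ y ∈ V', ¬ P y) : U = U' ∧ V = V' := by
  classical
  have h1 : ∀ U V : List β, (∀ y ∈ U, P y) → (∀ y ∈ V, ¬ P y) →
      (U ++ V).filter (fun y => decide (P y)) = U := by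
    intro U V hU hV
    rw [List.filter_append, List.filter_eq_self.2 (by simpa using hU),
      List.filter_eq_nil_iff.2 (by simpa using hV), List.append_nil]
  have h2 : U = U' := by rw [← h1 U V hU hV, h, h1 U' V' hU' hV']
  subst h2
  exact ⟨rfl, List.append_cancel_left h⟩

/-- Each predecessor step moves one interval into the block `B`. The block is shorter than `n` only
if the search runs out of intervals, and then `A` is empty. -/
theorem startPoint_spec {t : ITree α} {L : List (NonemptyInterval α)} (hc : ChainFrom ⊥ L)
    (ht : t.toList = L) (n : ℕ) (y : α) :
    ∃ A B C, L = A ++ (B ++ C) ∧ startPoint t n y = endFrom ⊥ A ∧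
      (∀ J ∈ A ++ B, J.snd < y) ∧ (∀ J ∈ C, y ≤ J.snd) ∧ B.length ≤ n ∧
      (A ≠ [] → B.length = n) := by
  subst ht
  have hnone : ∀ (n : ℕ) (y : α), (∀ J ∈ t.toList, y ≤ J.snd) → ∃ A B C,
      t.toList = A ++ (B ++ C) ∧ ⊥ = endFrom ⊥ A ∧
      (∀ J ∈ A ++ B, J.snd < y) ∧ (∀ J ∈ C, y ≤ J.snd) ∧ B.length ≤ n ∧
      (A ≠ [] → B.length = n) := fun n y h => ⟨[], [], t.toList, by simpa [endFrom] using h⟩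
  induction n generalizing y with
  | zero =>
    unfold startPoint
    rcases ITree.pred_spec hc.pairwise y with ⟨hp, h⟩ | ⟨J, U, V, hp, hUV, hJ, hV⟩
    · rw [hp]; exact hnone 0 y h
    · rw [hp]
      refine ⟨U ++ [J], [], V, by simp [hUV], by rw [endFrom_append]; rfl, ?_, hV, by simp,
        by simp⟩
      intro K hK
      rw [List.append_nil, List.mem_append] at hK
      rcases hK with hK | hK
      · have := hc.pairwise
        rw [hUV, List.pairwise_append] at this
        exact (this.2.2 K hK J (by simp)).trans (J.fst_le_snd.trans_lt hJ)
      · obtain rfl := List.mem_singleton.1 hK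
        exact hJ
  | succ n ih =>
    unfold startPoint
    rcases ITree.pred_spec hc.pairwise y with ⟨hp, h⟩ | ⟨J, U, V, hp, hUV, hJ, hV⟩
    · rw [hp]; exact hnone _ y h
    · rw [hp]
      obtain ⟨A, B, C, hL, hst, hAB, hC, hB, hBn⟩ := ih J.fst
      have hpw := hc.pairwise
      rw [hUV, List.pairwise_append, List.pairwise_cons] at hpw
      have hU : ∀ K ∈ U, K.snd < J.fst := fun K hK => hpw.2.2 K hK J (by simp)
      have hV' : ∀ K ∈ J :: V, ¬ K.snd < J.fst := by
        intro K hK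
        rw [not_lt]
        rcases List.mem_cons.1 hK with rfl | hK
        · exact K.fst_le_snd
        · exact J.fst_le_snd.trans ((hpw.2.1.1 K hK).le.trans K.fst_le_snd)
      obtain ⟨h1, h2⟩ := append_eq_append_of_forall (P := fun K => K.snd < J.fst)
        (by rw [List.append_assoc, ← hL, hUV] : (A ++ B) ++ C = U ++ (J :: V)) hAB
        (fun K hK => not_lt.2 (hC K hK)) hU hV'
      refine ⟨A, B ++ [J], V, by rw [hL, h2]; simp, hst, ?_, hV, by simpa using hB,
        fun hA => by simpa using hBn hA⟩
      intro K hK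
      rw [← List.append_assoc, h1, List.mem_append] at hK
      rcases hK with hK | hK
      · exact (hU K hK).trans (J.fst_le_snd.trans_lt hJ)
      · obtain rfl := List.mem_singleton.1 hK
        exact hJ

/-- The removal of the interval of the solution that contains `x`, if there is one. -/
def removeAround (x : NonemptyInterval α) (t : ITree α) : ITree α :=
  match t.next (startPoint t 0 x.fst) with
  | none => t
  | some K => if x.fst < K.fst then t else if K.snd < x.snd then t else t.del K

/-- The repair of the solution after a change of the set. -/
def repair (x : NonemptyInterval α) (s t : ITree α) (k : ℕ) : ITree α :=
  let t' := removeAround x t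
  let p := startPoint t' k x.fst
  (s.improve (s.improve (s.improve t' (2 * k + 3) p) (2 * k + 3) p) (2 * k + 3) p)

theorem removeAround_spec {x : NonemptyInterval α} {t : ITree α} {L : List (NonemptyInterval α)}
    (hc : ChainFrom ⊥ L) (ht : t.Represents L.toFinset) :
    ∃ U M V, L = U ++ (M ++ V) ∧ (M = [] ∨ ∃ K, M = [K] ∧ x ≤ K) ∧
      (∀ J ∈ U ++ V, ¬ x ≤ J) ∧ (∀ J ∈ U, J.snd < x.fst) ∧ (∀ J ∈ V, x.fst ≤ J.snd) ∧
      (removeAround x t).Represents (U ++ V).toFinset := by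
  obtain ⟨A, B, C, hL, hst, hAB, hC, hB, -⟩ := startPoint_spec hc (ht.toList_eq hc) 0 x.fst
  obtain rfl := List.length_eq_zero_iff.1 (Nat.le_zero.1 hB)
  simp only [List.nil_append, List.append_nil] at hL hAB
  subst hL
  have hA : ∀ J ∈ A, ¬ x ≤ J := fun J hJ hx =>
    absurd (x.fst_le_snd.trans hx.2) (not_le.2 (hAB J hJ))
  unfold removeAround
  rw [hst, ITree.next_eq_head ht hc]
  cases C with
  | nil => exact ⟨A, [], [], rfl, .inl rfl, by simpa using hA, hAB, by simp, ht⟩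
  | cons K C =>
    have hcC := (chainFrom_append.1 hc).2.2
    have hxK := hC K (by simp)
    -- Only the first interval that ends at or after `x.fst` can contain `x`: all later ones start
    -- after it ends.
    have hC' : ∀ J ∈ C, ¬ x ≤ J := fun J hJ hx => by
      have h1 : K.snd < J.fst := fst_lt_of_before (hcC.lt_fst J hJ)
      have h2 : J.fst ≤ x.fst := hx.1
      exact absurd (h1.trans_le h2) (not_lt.2 hxK)
    simp only [List.head?_cons]
    have hno : ¬ x ≤ K → ∃ U M V, A ++ K :: C = U ++ (M ++ V) ∧ (M = [] ∨ ∃ K, M = [K] ∧ x ≤ K) ∧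
        (∀ J ∈ U ++ V, ¬ x ≤ J) ∧ (∀ J ∈ U, J.snd < x.fst) ∧ (∀ J ∈ V, x.fst ≤ J.snd) ∧
        t.Represents (U ++ V).toFinset := fun hx =>
      ⟨A, [], K :: C, rfl, .inl rfl, fun J hJ => by
        rcases List.mem_append.1 hJ with hJ | hJ
        · exact hA J hJ
        rcases List.mem_cons.1 hJ with rfl | hJ
        · exact hx
        · exact hC' J hJ, hAB, hC, ht⟩
    split_ifs with h1 h2
    · exact hno fun hx => absurd hx.1 (not_le.2 h1)
    · exact hno fun hx => absurd hx.2 (not_le.2 h2)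
    · refine ⟨A, [K], C, rfl, .inr ⟨K, rfl, not_lt.1 h1, not_lt.1 h2⟩, fun J hJ => ?_, hAB,
        fun J hJ => hC J (by simp [hJ]), ?_⟩
      · rcases List.mem_append.1 hJ with hJ | hJ
        · exact hA J hJ
        · exact hC' J hJ
      · convert ht.del K using 1
        have hn := hc.nodup
        rw [List.nodup_append, List.nodup_cons] at hn
        ext y
        simp only [List.mem_toFinset, List.mem_append, Finset.mem_erase, List.mem_cons]
        constructor
        · rintro (h | h)
          · exact ⟨fun hy => hn.2.2 y h K (by simp) hy, .inl h⟩
          · exact ⟨by rintro rfl; exact hn.2.1.1 h, .inr (.inr h)⟩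
        · tauto

variable {S S' : Finset (NonemptyInterval α)} {x : NonemptyInterval α} {k : ℕ}
  {L : List (NonemptyInterval α)} {s t : ITree α}

theorem repair_spec (hL : IsSolution S k L) (hS : ∀ y, y ≠ x → (y ∈ S' ↔ y ∈ S))
    (hs : s.Represents S') (ht : t.Represents L.toFinset) :
    ∃ L', IsSolution S' k L' ∧ (repair x s t k).Represents L'.toFinset := by
  obtain ⟨U, M, V, rfl, hM, hx, hU, hV, ht'⟩ := removeAround_spec hL.chain ht (x := x)
  have hc' : ChainFrom ⊥ (U ++ V) := hL.chain.sublist (by simp)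
  obtain ⟨A, B, C, hUV, hst, hAB, hC, hB, hBk⟩ :=
    startPoint_spec hc' (ht'.toList_eq hc') k x.fst
  obtain ⟨rfl, rfl⟩ := append_eq_append_of_forall (P := fun K => K.snd < x.fst)
    (by rw [List.append_assoc, hUV] : U ++ V = (A ++ B) ++ C) hU
    (fun K hK => not_lt.2 (hV K hK)) hAB (fun K hK => not_lt.2 (hC K hK))
  simp only [List.append_assoc] at hL hx ht' hc' ⊢
  unfold repair
  simp only [hst]
  have hA := (chainFrom_append.1 hc').1
  -- An exchange of size t takes t + 1 greedy steps, so a budget of 2k + 3 steps covers all sizes up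
  -- to 2k + 2.
  obtain ⟨B₁, h₁, ht₁⟩ := ITree.improve_spec hs (n := 2 * k + 2) ht' hc'
  have hc₁ : ChainFrom ⊥ (A ++ B₁) :=
    chainFrom_append.2 ⟨hA, h₁.chainFrom (chainFrom_append.1 hc').2⟩
  obtain ⟨B₂, h₂, ht₂⟩ := ITree.improve_spec hs (n := 2 * k + 2) ht₁ hc₁
  have hc₂ : ChainFrom ⊥ (A ++ B₂) :=
    chainFrom_append.2 ⟨hA, h₂.chainFrom (chainFrom_append.1 hc₁).2⟩
  obtain ⟨B₃, h₃, ht₃⟩ := ITree.improve_spec hs (n := 2 * k + 2) ht₂ hc₂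
  exact ⟨A ++ B₃, hL.update_of_improves hS hM hx hAB hC hB hBk le_rfl h₁ h₂ h₃, ht₃⟩

end IntervalProgram

/-! ### Running time of the repair. -/

namespace IntervalProgram

open Val

variable {α : Type*} [LinearOrder α]

/-- The height hypothesis covers all trees for subsets of `S`, because the tree of the solution is
modified during the search. -/
theorem computes_exchange {S : Finset (NonemptyInterval α)} {s t : ITree α} {H : ℕ}
    (hH : ∀ (u : ITree α) (X : Finset (NonemptyInterval α)), u.Represents X → X ⊆ S →
      u.height ≤ H) (hs : s.Represents S) (n : ℕ) (p : WithBot α)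
    {A B : List (NonemptyInterval α)} (ht : t.Represents (A ++ B).toFinset)
    (hc : ChainFrom ⊥ (A ++ B)) (hAB : (A ++ B).toFinset ⊆ S) :
    Computes prog 11 (cons (unary n) (cons (ofPoint p) (cons (ofPoint (endFrom ⊥ A))
      (cons (ofTree s) (ofTree t))))) (ofOptionTree (s.exchange t n p (endFrom ⊥ A)))
      (n * (8000 * (H + 1)) + 100) := by
  have hsH := hH s S hs subset_rfl
  have htH := hH t _ ht hAB
  induction n generalizing p A B with
  | zero =>
    refine Wp.computes ?_
    show Wp prog exchangeCode _ _
    simp [exchangeCode, Wp, ITree.exchange, ofOptionTree, Result]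
  | succ n ih =>
    refine Wp.computes ?_
    show Wp prog exchangeCode _ _
    generalize hw : ofOptionTree (s.exchange t (n + 1) p (endFrom ⊥ A)) = w
    have hnext := ITree.next_eq_head ht hc
    have hmul : (n + 1) * (8000 * (H + 1)) = n * (8000 * (H + 1)) + 8000 * (H + 1) := by ring
    rw [hmul]
    unfold ITree.exchange at hw
    rw [hnext] at hw
    simp [exchangeCode, Wp]
    refine ⟨_, _, computes_next _ _, ?_⟩
    cases h : s.next p with
    | none =>
      rw [h] at hw
      simp [ofOption]
      exact ⟨hw, by omega⟩
    | some c =>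
      rw [h] at hw
      have hn := hs.next_eq_some h
      simp [ofOption]
      refine ⟨_, _, computes_next _ _, ?_⟩
      rw [hnext]
      cases B with
      | nil =>
        simp only [List.head?_nil] at hw ⊢
        simp [ofOption]
        exact ⟨_, _, computes_ins c ht.balanced, hw, by omega⟩
      | cons J B =>
        simp only [List.head?_cons] at hw ⊢
        simp [ofOption]
        refine ⟨fun hlt => ?_, fun hlt => ?_⟩
        · rw [if_pos hlt] at hw
          exact ⟨_, _, computes_ins c ht.balanced, hw, by omega⟩
        · rw [if_neg (not_lt.2 hlt)] at hw
          have hAJ : A ++ J :: B = (A ++ [J]) ++ B := by simp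
          rw [hAJ] at ht hc hAB
          have hend : endFrom ⊥ (A ++ [J]) = J.snd := by rw [endFrom_append]; rfl
          have hrec := ih c.snd ht hc hAB
          have hspec := ITree.exchange_spec hs (n := n) (p := c.snd) ht hc
          rw [hend] at hrec hspec
          refine ⟨_, _, hrec, ?_⟩
          cases hE : s.exchange t n c.snd J.snd with
          | none =>
            rw [hE] at hw
            simp [ofOptionTree]
            exact ⟨hw, by omega⟩
          | some t' =>
            rw [hE] at hw hspec
            obtain ⟨g, R, hg, ht'⟩ := hspec
            -- This intermediate set need not be independent, as `J` is not yet deleted; being a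
            -- subset of `S` is enough to bound the height.
            have hsub : ((A ++ [J]) ++ (g ++ R)).toFinset ⊆ S := by
              intro y hy
              rcases List.mem_append.1 (List.mem_toFinset.1 hy) with hy | hy
              · exact hAB (List.mem_toFinset.2 (List.mem_append_left _ hy))
              rcases List.mem_append.1 hy with hy | hy
              · exact (hg.greedyFrom.allMinimal y hy).1
              · exact hAB (List.mem_toFinset.2 (List.mem_append_right _ (hg.kept_subset hy)))
            have h1 := hH t' _ ht' hsub
            have hd := ht'.del J
            have h2 := hH _ _ hd ((Finset.erase_subset _ _).trans hsub)
            simp [ofOptionTree]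
            refine ⟨_, _, computes_del J ht'.balanced, _, _, computes_ins c hd.balanced, hw, ?_⟩
            omega

theorem computes_improve {S : Finset (NonemptyInterval α)} {s t : ITree α} {H : ℕ}
    (hH : ∀ (u : ITree α) (X : Finset (NonemptyInterval α)), u.Represents X → X ⊆ S →
      u.height ≤ H) (hs : s.Represents S) (n : ℕ)
    {A B : List (NonemptyInterval α)} (ht : t.Represents (A ++ B).toFinset)
    (hc : ChainFrom ⊥ (A ++ B)) (hAB : (A ++ B).toFinset ⊆ S) :
    Computes prog 12 (cons (unary n) (cons (ofPoint (endFrom ⊥ A)) (cons (ofTree s) (ofTree t))))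
      (ofTree (s.improve t n (endFrom ⊥ A))) (n * (8000 * (H + 1)) + 200) := by
  refine Wp.computes ?_
  show Wp prog improveCode _ _
  generalize hw : ofTree (s.improve t n (endFrom ⊥ A)) = w
  unfold ITree.improve at hw
  simp [improveCode, Wp]
  refine ⟨_, _, computes_exchange hH hs n _ ht hc hAB, ?_⟩
  cases hE : s.exchange t n (endFrom ⊥ A) (endFrom ⊥ A) with
  | none =>
    rw [hE] at hw
    simp [ofOptionTree]
    exact ⟨hw, by omega⟩
  | some t' =>
    rw [hE] at hw
    simp [ofOptionTree]
    exact ⟨hw, by omega⟩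

/-- The memory of the algorithm. -/
def memory (s t : ITree α) (k : ℕ) : Val α :=
  cons (ofTree t) (cons (ofTree s) (cons (unary k) (unary (2 * k + 3))))

theorem computes_removeAround {t : ITree α} (ht : t.Balanced) (x : NonemptyInterval α) :
    Computes prog 15 (cons (interval x) (ofTree t)) (ofTree (removeAround x t))
      (6000 * (t.height + 1)) := by
  refine Wp.computes ?_
  show Wp prog removeCode _ _
  generalize hw : ofTree (removeAround x t) = w
  unfold removeAround at hw
  simp [removeCode, Wp]
  refine ⟨_, _, computes_start t 0 x.fst, _, _, computes_next _ _, ?_⟩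
  cases h : t.next (startPoint t 0 x.fst) with
  | none =>
    rw [h] at hw
    simp [ofOption]
    exact ⟨hw, by omega⟩
  | some K =>
    rw [h] at hw
    simp [ofOption]
    simp only at hw
    refine ⟨fun h1 => ?_, fun h1 => ⟨fun h2 => ?_, fun h2 => ?_⟩⟩
    · rw [if_pos h1] at hw
      exact ⟨hw, by omega⟩
    · rw [if_neg (not_lt.2 h1), if_pos h2] at hw
      exact ⟨hw, by omega⟩
    · rw [if_neg (not_lt.2 h1), if_neg (not_lt.2 h2)] at hw
      exact ⟨_, _, computes_del K ht, hw, by omega⟩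

theorem computes_repair {S S' : Finset (NonemptyInterval α)} {x : NonemptyInterval α} {k m H : ℕ}
    {L : List (NonemptyInterval α)} {s t : ITree α}
    (hH : ∀ (u : ITree α) (X : Finset (NonemptyInterval α)), u.Represents X → X.card ≤ m →
      u.height ≤ H) (hSm : S.card ≤ m) (hSm' : S'.card ≤ m)
    (hL : IsSolution S k L) (hS : ∀ y, y ≠ x → (y ∈ S' ↔ y ∈ S))
    (hs : s.Represents S') (ht : t.Represents L.toFinset) :
    Computes prog 13 (cons (interval x) (cons (ofTree s) (cons (ofTree t)
      (cons (unary k) (unary (2 * k + 3)))))) (memory s (repair x s t k) k)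
      ((k + 1) * (80000 * (H + 1))) := by
  obtain ⟨U, M, V, rfl, hM, hx, hU, hV, ht'⟩ := removeAround_spec hL.chain ht (x := x)
  have hsub' : (U ++ V).Sublist (U ++ (M ++ V)) := by simp
  have hc' : ChainFrom ⊥ (U ++ V) := hL.chain.sublist hsub'
  have hS' : (U ++ V).toFinset ⊆ S' := fun J hJ => by
    rw [List.mem_toFinset] at hJ
    exact (hS J (by rintro rfl; exact hx J hJ le_rfl)).2 (hL.minimal J (hsub'.subset hJ)).1
  have hH' : ∀ (u : ITree α) (X : Finset (NonemptyInterval α)), u.Represents X → X ⊆ S' →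
      u.height ≤ H := fun u X hu hX => hH u X hu ((Finset.card_le_card hX).trans hSm')
  have hht := hH t _ ht (le_trans (Finset.card_le_card fun J hJ =>
    (hL.minimal J (List.mem_toFinset.1 hJ)).1) hSm)
  have hht' := hH' _ _ ht' hS'
  obtain ⟨A, B, C, hUV, hst, hAB, hC, hB, hBk⟩ :=
    startPoint_spec hc' (ht'.toList_eq hc') k x.fst
  rw [hUV] at ht' hc' hS'
  have hA := (chainFrom_append.1 hc').1
  have hAS : ∀ J ∈ A, J ∈ S' := fun J hJ => hS' (by simp [hJ])
  have step : ∀ (t : ITree α) (D : List (NonemptyInterval α)), t.Represents (A ++ D).toFinset →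
      ChainFrom ⊥ (A ++ D) → (A ++ D).toFinset ⊆ S' → ∃ D',
        (s.improve t (2 * k + 3) (endFrom ⊥ A)).Represents (A ++ D').toFinset ∧
        ChainFrom ⊥ (A ++ D') ∧ (A ++ D').toFinset ⊆ S' := by
    intro t D hD hcD hDS
    obtain ⟨D', h, hD'⟩ := ITree.improve_spec hs (n := 2 * k + 2) hD hcD
    refine ⟨D', hD', chainFrom_append.2 ⟨hA, h.chainFrom (chainFrom_append.1 hcD).2⟩, ?_⟩
    intro J hJ
    rcases List.mem_append.1 (List.mem_toFinset.1 hJ) with hJ | hJ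
    · exact hAS J hJ
    rcases h with ⟨rfl, -⟩ | ⟨g, R, h, rfl⟩
    · exact hDS (by simp [hJ])
    rcases List.mem_append.1 hJ with hJ | hJ
    · exact (h.greedyFrom.allMinimal J hJ).1
    · exact hDS (by simp [h.kept_subset hJ])
  obtain ⟨D₁, ht₁, hc₁, hS₁⟩ := step _ _ ht' hc' hS'
  obtain ⟨D₂, ht₂, hc₂, hS₂⟩ := step _ _ ht₁ hc₁ hS₁
  -- Naming the product makes the final time estimate linear.
  obtain ⟨z, hz⟩ : ∃ z, z = k * (H + 1) := ⟨_, rfl⟩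
  have h3 : (k + 1) * (80000 * (H + 1)) = 80000 * z + 80000 * (H + 1) := by rw [hz]; ring
  have h4 : (k + 1) * (600 * ((removeAround x t).height + 1)) ≤ 600 * z + 600 * (H + 1) := by
    refine (Nat.mul_le_mul_left _ (Nat.mul_le_mul_left _ (Nat.add_le_add_right hht' 1))).trans
      (le_of_eq ?_)
    rw [hz]; ring
  have h5 : (2 * k + 3) * (8000 * (H + 1)) + 200 ≤ 16000 * z + 24000 * (H + 1) + 200 := by
    refine le_of_eq ?_
    rw [hz]; ring
  clear hz
  rw [h3]
  refine Wp.computes ?_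
  show Wp prog repairCode _ _
  unfold repair
  simp [repairCode, Wp]
  refine ⟨_, _, computes_removeAround ht.balanced x, _, _, (computes_start _ k x.fst).mono h4, ?_⟩
  rw [hst]
  refine ⟨_, _, (computes_improve hH' hs _ ht' hc' hS').mono h5, _, _,
    (computes_improve hH' hs _ ht₁ hc₁ hS₁).mono h5, _, _,
    (computes_improve hH' hs _ ht₂ hc₂ hS₂).mono h5, rfl, ?_⟩
  clear h3 h4 h5
  omega

theorem computes_budget (k : ℕ) :
    Computes prog 14 (unary k : Val α) (unary (2 * k + 3)) (20 * (k + 1)) := by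
  induction k with
  | zero =>
    refine Wp.computes ?_
    show Wp prog budgetCode _ _
    simp [budgetCode, Wp, wp_num, Result]
  | succ k ih =>
    refine Wp.computes ?_
    show Wp prog budgetCode _ _
    simp [budgetCode, Wp]
    exact ⟨_, _, ih, rfl, by omega⟩

/-! ### The invariant of the memory and the final time bounds. -/

theorem stores_ofTree (t : ITree α) : Stores (ofTree t) t.toList := by
  induction t with
  | leaf => exact .nil
  | node l J r ihl ihr => exact .node ihl ihr

/-- The invariant of the algorithm. -/
def IsMemory (S : Finset (NonemptyInterval α)) (k : ℕ) (v : Val α) : Prop :=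
  ∃ s t L, v = memory s t k ∧ s.Represents S ∧ t.Represents L.toFinset ∧ IsSolution S k L

theorem IsMemory.holds {S : Finset (NonemptyInterval α)} {k : ℕ} {v : Val α}
    (h : IsMemory S k v) : ∃ L, IsSolution S k L ∧ v.Holds L.toFinset := by
  obtain ⟨s, t, L, rfl, -, ht, hL⟩ := h
  refine ⟨L, hL, _, _, L, rfl, ?_, hL.chain.pairwise, rfl⟩
  have := stores_ofTree t
  rwa [ht.toList_eq hL.chain] at this

theorem runsInit (k : ℕ) : ∃ (v : Val α) (c : ℕ), alg.RunsInit k v c ∧ IsMemory ∅ k v := by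
  have : Wp prog alg.init [(unary k : Val α)] fun v _ => IsMemory ∅ k v := by
    simp [alg, Wp]
    exact ⟨_, ⟨_, computes_budget k⟩, .leaf, .leaf, [], rfl, ITree.represents_leaf,
      ITree.represents_leaf, isSolution_nil⟩
  obtain ⟨v, n, -, hr, -, hv⟩ := this.sound
  exact ⟨v, n, hr, hv⟩

/-- A bound for the height of the search trees when there are `n` intervals. -/
def heightBound (n : ℕ) : ℕ := Nat.log 2 ((n + 2) ^ 2)

theorem height_le_heightBound {n : ℕ} {u : ITree α} {X : Finset (NonemptyInterval α)}
    (hu : u.Represents X) (hX : X.card ≤ n + 1) : u.height ≤ heightBound n :=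
  Nat.le_log_of_pow_le one_lt_two
    (hu.two_pow_height_le.trans (Nat.pow_le_pow_left (by omega) 2))

variable {S : Finset (NonemptyInterval α)} {k : ℕ} {v : Val α}

theorem runsIns (h : IsMemory S k v) (J : NonemptyInterval α) : ∃ w c, alg.RunsIns J v w c ∧
    c ≤ (k + 1) * (90000 * (heightBound S.card + 1)) ∧ IsMemory (insert J S) k w := by
  obtain ⟨s, t, L, rfl, hs, ht, hL⟩ := h
  have hS : ∀ y, y ≠ J → (y ∈ insert J S ↔ y ∈ S) := fun y hy => by simp [hy]
  have hs' := hs.ins J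
  have hcard := Finset.card_insert_le J S
  obtain ⟨L', hL', ht'⟩ := repair_spec (k := k) hL hS hs' ht
  -- One more than the old size, since the set after an insertion may have `S.card + 1` members.
  have hrep := computes_repair (m := S.card + 1) (fun u X hu hX => height_le_heightBound hu hX)
    (by omega) (by omega) hL hS hs' ht
  have hsH := height_le_heightBound hs (n := S.card) (by omega)
  have : Wp prog alg.ins [interval J, memory s t k]
      (Result (memory (s.ins J) (repair J (s.ins J) t k) k)
        ((k + 1) * (90000 * (heightBound S.card + 1)))) := by
    simp [alg, Wp, memory]
    refine ⟨_, _, computes_ins J hs.balanced, _, _, hrep, rfl, ?_⟩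
    have h3 : (k + 1) * (80000 * (heightBound S.card + 1)) =
      80000 * (k * (heightBound S.card + 1)) + 80000 * (heightBound S.card + 1) := by ring
    have h4 : (k + 1) * (90000 * (heightBound S.card + 1)) =
      90000 * (k * (heightBound S.card + 1)) + 90000 * (heightBound S.card + 1) := by ring
    rw [h3, h4]
    omega
  obtain ⟨w, n, c, hr, hn, rfl, hc⟩ := this.sound
  exact ⟨_, n, hr, hn.trans hc, _, _, L', rfl, hs', ht', hL'⟩

theorem runsDel (h : IsMemory S k v) (J : NonemptyInterval α) : ∃ w c, alg.RunsDel J v w c ∧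
    c ≤ (k + 1) * (90000 * (heightBound S.card + 1)) ∧ IsMemory (S.erase J) k w := by
  obtain ⟨s, t, L, rfl, hs, ht, hL⟩ := h
  have hS : ∀ y, y ≠ J → (y ∈ S.erase J ↔ y ∈ S) := fun y hy => by simp [hy]
  have hs' := hs.del J
  have hcard := Finset.card_erase_le (s := S) (a := J)
  obtain ⟨L', hL', ht'⟩ := repair_spec (k := k) hL hS hs' ht
  have hrep := computes_repair (m := S.card + 1) (fun u X hu hX => height_le_heightBound hu hX)
    (by omega) (by omega) hL hS hs' ht
  have hsH := height_le_heightBound hs (n := S.card) (by omega)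
  have : Wp prog alg.del [interval J, memory s t k]
      (Result (memory (s.del J) (repair J (s.del J) t k) k)
        ((k + 1) * (90000 * (heightBound S.card + 1)))) := by
    simp [alg, Wp, memory]
    refine ⟨_, _, computes_del J hs.balanced, _, _, hrep, rfl, ?_⟩
    have h3 : (k + 1) * (80000 * (heightBound S.card + 1)) =
      80000 * (k * (heightBound S.card + 1)) + 80000 * (heightBound S.card + 1) := by ring
    have h4 : (k + 1) * (90000 * (heightBound S.card + 1)) =
      90000 * (k * (heightBound S.card + 1)) + 90000 * (heightBound S.card + 1) := by ring
    rw [h3, h4]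
    omega
  obtain ⟨w, n, c, hr, hn, rfl, hc⟩ := this.sound
  exact ⟨_, n, hr, hn.trans hc, _, _, L', rfl, hs', ht', hL'⟩

/-- Reachability speaks of arbitrary runs; by determinism they are the runs constructed above. -/
theorem isMemory_of_reach (h : alg.Reach k S v) : IsMemory S k v := by
  induction h with
  | init hr =>
    obtain ⟨v, c, hr', hv⟩ := runsInit (α := α) k
    obtain ⟨rfl, -⟩ := Runs.unique hr hr'
    exact hv
  | ins _ hr ih =>
    obtain ⟨w, c, hr', -, hw⟩ := runsIns ih _
    obtain ⟨rfl, -⟩ := Runs.unique hr hr'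
    exact hw
  | del _ hr ih =>
    obtain ⟨w, c, hr', -, hw⟩ := runsDel ih _
    obtain ⟨rfl, -⟩ := Runs.unique hr hr'
    exact hw

/-- Since log 2 exceeds 1/2, the height bound is at most 4 log (n + 2), and the summand 1 is at most
2 log (n + 2). -/
theorem heightBound_add_one_le (n : ℕ) :
    ((heightBound n + 1 : ℕ) : ℝ) ≤ 6 * Real.log ((n : ℝ) + 2) := by
  have hlog2 : (1 / 2 : ℝ) < Real.log 2 := by
    have := Real.log_two_gt_d9
    linarith
  have h2 : Real.log 2 ≤ Real.log ((n : ℝ) + 2) :=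
    Real.log_le_log two_pos (by linarith [Nat.cast_nonneg (α := ℝ) n])
  have hpow : (2 : ℝ) ^ heightBound n ≤ ((n : ℝ) + 2) ^ 2 := by
    exact_mod_cast Nat.pow_log_le_self 2 (by positivity : (n + 2) ^ 2 ≠ 0)
  have hle := Real.log_le_log (by positivity) hpow
  rw [Real.log_pow, Real.log_pow] at hle
  push_cast at hle ⊢
  have hb : (0 : ℝ) ≤ heightBound n := by positivity
  nlinarith

theorem maintains (hk : 1 ≤ k)
    {good : Finset (NonemptyInterval α) → Finset (NonemptyInterval α) → Prop}
    (hgood : ∀ (S : Finset (NonemptyInterval α)) L, IsSolution S k L → good S L.toFinset)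
    {insTime delTime : ℕ → ℝ}
    (hins : ∀ n : ℕ, 1080000 * (k : ℝ) * Real.log ((n : ℝ) + 2) ≤ insTime n)
    (hdel : ∀ n : ℕ, 1080000 * (k : ℝ) * Real.log ((n : ℝ) + 2) ≤ delTime n) :
    alg.Maintains α k good insTime delTime := by
  have hk' : (1 : ℝ) ≤ k := by exact_mod_cast hk
  have bound : ∀ n c : ℕ, c ≤ (k + 1) * (90000 * (heightBound n + 1)) →
      (c : ℝ) ≤ 1080000 * (k : ℝ) * Real.log ((n : ℝ) + 2) := by
    intro n c hc
    -- Here k + 1 ≤ 2k; with the factor 6 from the height bound the constant becomes 6 · 180000 =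
    -- 1080000.
    have h1 : c ≤ 180000 * k * (heightBound n + 1) := by
      refine hc.trans ?_
      nlinarith [Nat.mul_le_mul_right (heightBound n + 1) hk]
    have h2 : (c : ℝ) ≤ 180000 * k * ((heightBound n + 1 : ℕ) : ℝ) := by exact_mod_cast h1
    have h3 := heightBound_add_one_le n
    refine h2.trans ?_
    nlinarith
  refine ⟨?_, fun S v hr => ?_⟩
  · obtain ⟨v, c, h, -⟩ := runsInit (α := α) k
    exact ⟨v, c, h⟩
  · have hm := isMemory_of_reach hr
    refine ⟨?_, fun J => ?_, fun J => ?_⟩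
    · obtain ⟨L, hL, hv⟩ := hm.holds
      exact ⟨_, hv, hgood S L hL⟩
    · obtain ⟨w, c, h, hc, -⟩ := runsIns hm J
      exact ⟨w, c, h, (bound _ _ hc).trans (hins _)⟩
    · obtain ⟨w, c, h, hc, -⟩ := runsDel hm J
      exact ⟨w, c, h, (bound _ _ hc).trans (hdel _)⟩

end IntervalProgram

theorem theorem1 :
    ∃ (P : DynAlg) (C : ℝ),
      (∀ k : ℕ, 1 ≤ k →
        P.Maintains ℝ k (IsKValid k)
          (fun n => C * (k : ℝ) * Real.log ((n : ℝ) + 2))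
          (fun n => C * (k : ℝ) ^ 2 * Real.log ((n : ℝ) + 2))) ∧
      (∀ ε : ℝ, 0 < ε → ∃ k : ℕ, 1 ≤ k ∧ ∃ D : ℝ,
        P.Maintains ℝ k (IsApproxMIS ε)
          (fun n => D * Real.log ((n : ℝ) + 2))
          (fun n => D * Real.log ((n : ℝ) + 2))) := by
  refine ⟨IntervalProgram.alg, 1080000, fun k hk => ?_, fun ε hε => ?_⟩
  -- Deletions also run in time linear in `k`; their quadratic bound follows from k ≤ k².
  · refine IntervalProgram.maintains hk (fun S L hL => hL.isKValid) (fun n => le_rfl) fun n => ?_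
    have hk' : (1 : ℝ) ≤ k := by exact_mod_cast hk
    have hlog : 0 ≤ Real.log ((n : ℝ) + 2) :=
      Real.log_nonneg (by linarith [Nat.cast_nonneg (α := ℝ) n])
    refine mul_le_mul_of_nonneg_right ?_ hlog
    nlinarith
  -- The ratio needs 1 ≤ ε (parameter + 1). The parameter `k + 1` satisfies this and is at least one
  -- even when `k` is zero.
  · obtain ⟨k, hk⟩ := exists_nat_ge (1 / ε)
    refine ⟨k + 1, by omega, 1080000 * ((k + 1 : ℕ) : ℝ), ?_⟩
    refine IntervalProgram.maintains (by omega) (fun S L hL => hL.isApproxMIS ?_)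
      (fun n => le_rfl) fun n => le_rfl
    rw [div_le_iff₀ hε] at hk
    push_cast
    nlinarith
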